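/- Let $T>0$ and write $B(R)=\{x\in\mathbb{R}^d:|x|\le R\}$, $\mathcal L_d$ for Lebesgue measure. Let $b\in L^1([0,T],W^{1,1}_{loc}(\mathbb{R}^d,\mathbb{R}^d))$ be a time-dependent vector field with weak spatial gradient $\nabla b_t$ and divergence $\operatorname{div}(b_t)=\operatorname{tr}(\nabla b_t)$, such that (i) $\frac{|b_t(x)|}{1+|x|}\in L^\infty([0,T]\times\mathbb{R}^d)$; (ii) for any $R>0$, $\int_0^T\|\operatorname{div}(b_t)\|_{L^\infty(B(R))}\,dt<+\infty$; (iii) for any $R>0$, $\int_0^T\int_{B(R)}|\nabla b_t|\log(2+|\nabla b_t|)\,dx\,dt<+\infty$. A map $Y:[0,T]\times\mathbb{R}^d\to\mathbb{R}^d$, with each $Y_t$ Lebesgue measurable, is called a regular Lagrangian flow of $b$ if (1) for a.e. $x$ the curve $t\mapsto Y_t(x)$ is an absolutely continuous integral solution on $[0,T]$ of $dY_t=b_t(Y_t)\,dt$, $Y_0=x$, and (2) $(Y_t)_\#\mathcal L_d\ll\mathcal L_d$ for all $t\in[0,T]$. It has locally bounded compression if for every $R>0$ there is a constant $C$ such that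 $(Y_t)_\#(\mathcal L_d|_{B(R)})\le C\mathcal L_d$ for all $t\in[0,T]$. Then $b$ has a regular Lagrangian flow $Y$ with locally bounded compression; it is unique among such flows (if $Z$ is another one, then for a.e. $x$, $Z_t(x)=Y_t(x)$ for all $t\in[0,T]$); and every such $Y$ has the following properties. For any $R>0$ and $\varepsilon>0$ there exist a Borel set $E\subset B(R)$ with $\mathcal L_d(B(R)\setminus E)<\varepsilon$ and a constant $K$ such that for every $t\in[0,T]$ the restriction $Y_t|_E$ is Lipschitz with constant $K$. In particular, for any $t\in[0,T]$, $Y_t$ is approximately differentiable at $\mathcal L_d$-a.e. $x\in\mathbb{R}^d$, i.e. for a.e. $x$ there is a linear map $L$ such that for every $\varepsilon>0$ the set $\{y:|Y_t(y)-Y_t(x)-L(y-x)|>\varepsilon|y-x|\}$ has Lebesgue density $0$ at $x$. -/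

import Mathlib

open MeasureTheory Set Filter Topology
open scoped ContDiff ENNReal NNReal

/-- `G` is the weak (distributional) gradient of `f ∈ W^{1,1}_loc(ℝᵈ, ℝᵈ)`: both are locally
integrable, and integration by parts holds against every smooth compactly supported test function,
in every direction `v`. Here `G x v` is the derivative of `f` at `x` in the direction `v`. -/
structure IsWeakGradient {d : ℕ} (f : EuclideanSpace ℝ (Fin d) → EuclideanSpace ℝ (Fin d))
    (G : EuclideanSpace ℝ (Fin d) → (EuclideanSpace ℝ (Fin d) →L[ℝ] EuclideanSpace ℝ (Fin d))) :
    Prop where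
  locallyIntegrable : LocallyIntegrable f volume
  locallyIntegrable_grad : LocallyIntegrable G volume
  integral_by_parts : ∀ φ : EuclideanSpace ℝ (Fin d) → ℝ, ContDiff ℝ ∞ φ → HasCompactSupport φ →
    ∀ v : EuclideanSpace ℝ (Fin d),
      ∫ x, (fderiv ℝ φ x v) • f x = - ∫ x, φ x • G x v

/-- `b ∈ L¹([0,T], W^{1,1}_loc(ℝᵈ, ℝᵈ))`, with weak spatial gradient `G t = ∇ b_t`: the integrability
over `[0,T] × B(R)` of `b` and of `G` is, by Tonelli, the integrability in time of the
`W^{1,1}(B(R))` norm. -/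
structure MemL1W11loc {d : ℕ} (T : ℝ)
    (b : ℝ → EuclideanSpace ℝ (Fin d) → EuclideanSpace ℝ (Fin d))
    (G : ℝ → EuclideanSpace ℝ (Fin d) →
      (EuclideanSpace ℝ (Fin d) →L[ℝ] EuclideanSpace ℝ (Fin d))) : Prop where
  isWeakGradient : ∀ᵐ t ∂(volume.restrict (Icc (0 : ℝ) T)), IsWeakGradient (b t) (G t)
  integrable : ∀ R : ℝ, Integrable (fun p : ℝ × EuclideanSpace ℝ (Fin d) => b p.1 p.2)
    ((volume.restrict (Icc (0 : ℝ) T)).prod (volume.restrict (Metric.closedBall 0 R)))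
  integrable_grad : ∀ R : ℝ, Integrable (fun p : ℝ × EuclideanSpace ℝ (Fin d) => G p.1 p.2)
    ((volume.restrict (Icc (0 : ℝ) T)).prod (volume.restrict (Metric.closedBall 0 R)))

/-- The divergence of a vector field with gradient `G`, i.e. the trace of the gradient. -/
noncomputable def divOfGrad {d : ℕ}
    (G : EuclideanSpace ℝ (Fin d) → (EuclideanSpace ℝ (Fin d) →L[ℝ] EuclideanSpace ℝ (Fin d)))
    (x : EuclideanSpace ℝ (Fin d)) : ℝ :=
  LinearMap.trace ℝ (EuclideanSpace ℝ (Fin d)) (G x : EuclideanSpace ℝ (Fin d) →ₗ[ℝ] _)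

/-- `Y` is a regular Lagrangian flow of `b` on `[0,T]`: for a.e. `x` the curve `t ↦ Y t x` is an
absolutely continuous integral solution of `Y' = b_t(Y)`, `Y_0 = x` (being the integral of an
integrable function, the curve is automatically absolutely continuous), and for every
`t ∈ [0,T]` the push-forward of Lebesgue measure under `Y t` is absolutely continuous. -/
structure IsRegularLagrangianFlow {d : ℕ} (T : ℝ)
    (b Y : ℝ → EuclideanSpace ℝ (Fin d) → EuclideanSpace ℝ (Fin d)) : Prop where
  aemeasurable : ∀ t ∈ Icc (0 : ℝ) T, AEMeasurable (Y t) volume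
  integral_solution : ∀ᵐ x ∂(volume : Measure (EuclideanSpace ℝ (Fin d))),
    IntervalIntegrable (fun s => b s (Y s x)) volume 0 T ∧
      ∀ t ∈ Icc (0 : ℝ) T, Y t x = x + ∫ s in (0 : ℝ)..t, b s (Y s x)
  absolutelyContinuous : ∀ t ∈ Icc (0 : ℝ) T, (volume.map (Y t)) ≪ volume

/-- Locally bounded compression: for every `R` there is `C`, independent of `t ∈ [0,T]`, such that
the push-forward under `Y t` of Lebesgue measure on `B(R)` is dominated by `C` times Lebesgue
measure. -/
def HasLocallyBoundedCompression {d : ℕ} (T : ℝ)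
    (Y : ℝ → EuclideanSpace ℝ (Fin d) → EuclideanSpace ℝ (Fin d)) : Prop :=
  ∀ R : ℝ, ∃ C : ℝ≥0, ∀ t ∈ Icc (0 : ℝ) T,
    (volume.restrict (Metric.closedBall (0 : EuclideanSpace ℝ (Fin d)) R)).map (Y t) ≤
      (C : ℝ≥0∞) • (volume : Measure (EuclideanSpace ℝ (Fin d)))

/-- `f` is approximately differentiable at `x`: for some linear map `L`, the approximate limit of
`‖f y - f x - L (y - x)‖ / ‖y - x‖` as `y → x` is zero, i.e. for every `ε > 0` the set where this
quotient exceeds `ε` has Lebesgue density zero at `x`. -/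
def ApproxDifferentiableAt {d : ℕ} (f : EuclideanSpace ℝ (Fin d) → EuclideanSpace ℝ (Fin d))
    (x : EuclideanSpace ℝ (Fin d)) : Prop :=
  ∃ L : EuclideanSpace ℝ (Fin d) →L[ℝ] EuclideanSpace ℝ (Fin d), ∀ ε : ℝ, 0 < ε →
    Tendsto (fun r : ℝ =>
      volume ({y | ε * ‖y - x‖ < ‖f y - f x - L (y - x)‖} ∩ Metric.closedBall x r) /
        volume (Metric.closedBall x r)) (𝓝[>] 0) (𝓝 0)

/-! The proof rests on a Lusin–Lipschitz inequality: for almost all x, y at distance less than ρ,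
|b_t(x) - b_t(y)| ≤ |x - y| (h_t(x) + h_t(y)), where h_t is 12^d times the local maximal function of
|∇b_t| (`IsRegularField.enorm_sub_le`). The L log L hypothesis makes h integrable on [0,T] × B(R)
(`setLIntegral_dyadicMaximal_le`, `IsRegularField.lintegral_lusinKernel_lt_top`).

Along a flow with locally bounded compression, a change of variables shows that the energy H(x) = ∫
h_s(Y_s x) ds is integrable on balls, hence finite almost everywhere. Inserting the inequality in
the integral equations of two trajectories, Gronwall gives |Y_t x - Z_t y| ≤ |x - y| exp(2(H_Y(x) +
H_Z(y))) (`IsGoodCurve.enorm_sub_le`). Equal initial points give uniqueness. On the set where H ≤ l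
the flow is Lipschitz with constant exp(4l), uniformly in time, and Chebyshev makes the complement
small. Rademacher's theorem and Lebesgue density then give approximate differentiability.

Existence uses the same estimate in perturbed form. The field is mollified in space and solved
approximately by an Euler scheme. Its compression is bounded independently of the mollification,
because det(1 + A) ≥ 1 + tr A - η|A| with η chosen small against the gradient bound, so that only
the divergence survives (`IsC1Field.exists_approximate_flow`). Two approximate flows differ by at
most the sum of their defects times the exponential of their energies
(`IsApproximateFlow.ae_enorm_sub_le`). Energies are bounded in L¹ and defects tend to 0 in L¹; along
a subsequence whose defects beat the energies permitted by Borel–Cantelli, almost every trajectory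
converges uniformly in time. The limit inherits the compression bound by Fatou and the equation by
the Lusin–Lipschitz inequality. -/

/-! ### Local maximal function and its L log L estimate -/

section Maximal

variable {E : Type*} [NormedAddCommGroup E] [NormedSpace ℝ E] [FiniteDimensional ℝ E]
  [MeasurableSpace E] [BorelSpace E] (μ : Measure E) [μ.IsAddHaarMeasure]

/-- The local maximal function over closed balls of dyadic radii `ρ / 2 ^ n`. -/
noncomputable def dyadicMaximal (ρ : ℝ) (g : E → ℝ≥0∞) (x : E) : ℝ≥0∞ :=
  ⨆ n : ℕ, (∫⁻ y in Metric.closedBall x (ρ / 2 ^ n), g y ∂μ) /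
    μ (Metric.closedBall x (ρ / 2 ^ n))

lemma measure_closedBall_scale (x : E) {s : ℝ} (hs : 0 ≤ s) {c : ℝ} (hc : 0 ≤ c) :
    μ (Metric.closedBall x (c * s)) =
      ENNReal.ofReal c ^ Module.finrank ℝ E * μ (Metric.closedBall x s) := by
  rw [Measure.addHaar_closedBall_mul μ x hc hs, ENNReal.ofReal_pow hc,
    Measure.addHaar_closedBall_center μ x]

lemma measure_closedBall_pos' (x : E) {s : ℝ} (hs : 0 < s) :
    μ (Metric.closedBall x s) ≠ 0 :=
  (Metric.measure_closedBall_pos μ x hs).ne'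

lemma measure_closedBall_ne_top (x : E) (s : ℝ) : μ (Metric.closedBall x s) ≠ ⊤ :=
  measure_closedBall_lt_top.ne

lemma setLIntegral_dyadic_le (ρ : ℝ) (hρ : 0 < ρ) (g : E → ℝ≥0∞) (x : E) (n : ℕ) :
    ∫⁻ y in Metric.closedBall x (ρ / 2 ^ n), g y ∂μ ≤
      dyadicMaximal μ ρ g x * μ (Metric.closedBall x (ρ / 2 ^ n)) := by
  rw [← ENNReal.div_le_iff (measure_closedBall_pos' μ x (by positivity))
    (measure_closedBall_ne_top μ x _)]
  exact le_iSup (fun n : ℕ => (∫⁻ y in Metric.closedBall x (ρ / 2 ^ n), g y ∂μ) /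
    μ (Metric.closedBall x (ρ / 2 ^ n))) n

/-- Some dyadic radius lies between s and 2s, so using only countably many radii, for which
measurability is easy, costs just a factor 2^d. -/
lemma setLIntegral_closedBall_le_dyadicMaximal {ρ s : ℝ} (hs : 0 < s) (hsρ : s ≤ ρ)
    (g : E → ℝ≥0∞) (x : E) :
    ∫⁻ y in Metric.closedBall x s, g y ∂μ ≤
      2 ^ Module.finrank ℝ E * dyadicMaximal μ ρ g x * μ (Metric.closedBall x s) := by
  have hρ : 0 < ρ := hs.trans_le hsρ
  obtain ⟨n, h1, h2⟩ := exists_nat_pow_near_of_lt_one (x := s / ρ) (y := (1 / 2 : ℝ))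
    (by positivity) ((div_le_one hρ).2 hsρ) (by norm_num) (by norm_num)
  have e : (1 / 2 : ℝ) ^ n = 1 / 2 ^ n := by rw [one_div_pow]
  have h3 : s ≤ ρ / 2 ^ n := by
    rw [e, div_le_iff₀ hρ] at h2
    calc s ≤ _ := h2
      _ = _ := by ring
  have h4 : ρ / 2 ^ n ≤ 2 * s := by
    rw [pow_succ, e, lt_div_iff₀ hρ] at h1
    have : ρ / 2 ^ n = 2 * (1 / 2 ^ n * (1 / 2) * ρ) := by ring
    linarith
  calc ∫⁻ y in Metric.closedBall x s, g y ∂μ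
      ≤ ∫⁻ y in Metric.closedBall x (ρ / 2 ^ n), g y ∂μ :=
        lintegral_mono_set (Metric.closedBall_subset_closedBall h3)
    _ ≤ dyadicMaximal μ ρ g x * μ (Metric.closedBall x (ρ / 2 ^ n)) :=
        setLIntegral_dyadic_le μ ρ hρ g x n
    _ ≤ dyadicMaximal μ ρ g x * μ (Metric.closedBall x (2 * s)) := by
        gcongr
    _ = _ := by
        rw [measure_closedBall_scale μ x hs.le (by norm_num)]
        simp only [ENNReal.ofReal_ofNat]
        ring

/-- Balls of radius at most ρ centred in B(R) stay in B(R + ρ). This is what allows purely local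
integrability hypotheses on the gradient. -/
lemma dyadicMaximal_mono_of_ball {ρ R : ℝ} (hρ : 0 ≤ ρ) (g : E → ℝ≥0∞) {x : E}
    (hx : x ∈ Metric.closedBall (0 : E) R) :
    dyadicMaximal μ ρ g x ≤
      dyadicMaximal μ ρ ((Metric.closedBall (0 : E) (R + ρ)).indicator g) x := by
  refine iSup_mono fun n => ENNReal.div_le_div_right ?_ _
  refine setLIntegral_mono' Metric.isClosed_closedBall.measurableSet fun y hy => ?_
  rw [indicator_of_mem]
  have h1 : ρ / 2 ^ n ≤ ρ := div_le_self hρ (one_le_pow₀ (by norm_num))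
  rw [Metric.mem_closedBall] at *
  linarith [dist_triangle y x 0]

lemma measurable_setLIntegral_closedBall {α : Type*} [MeasurableSpace α] {g : α × E → ℝ≥0∞}
    (hg : Measurable g) (r : ℝ) :
    Measurable (fun p : α × E => ∫⁻ y in Metric.closedBall p.2 r, g (p.1, y) ∂μ) := by
  have hS : MeasurableSet {q : (α × E) × E | q.2 ∈ Metric.closedBall q.1.2 r} := by
    have : Measurable fun q : (α × E) × E => dist q.2 q.1.2 := by fun_prop
    exact measurableSet_le this measurable_const
  have h1 : Measurable ({q : (α × E) × E | q.2 ∈ Metric.closedBall q.1.2 r}.indicator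
      (fun q => g (q.1.1, q.2))) := Measurable.indicator (by fun_prop) hS
  have h2 := Measurable.lintegral_prod_right' (ν := μ) h1
  convert h2 using 2 with p
  rw [← lintegral_indicator Metric.isClosed_closedBall.measurableSet]
  rfl

lemma measurable_dyadicMaximal {α : Type*} [MeasurableSpace α] {g : α × E → ℝ≥0∞}
    (hg : Measurable g) (ρ : ℝ) :
    Measurable (fun p : α × E => dyadicMaximal μ ρ (fun y => g (p.1, y)) p.2) := by
  unfold dyadicMaximal
  refine Measurable.iSup fun n => ?_
  simp_rw [Measure.addHaar_closedBall_center μ]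
  exact (measurable_setLIntegral_closedBall μ hg _).div_const _

lemma measurable_dyadicMaximal_right {g : E → ℝ≥0∞} (hg : Measurable g) (ρ : ℝ) :
    Measurable (dyadicMaximal μ ρ g) := by
  have h := measurable_dyadicMaximal (α := ℝ) μ (hg.comp measurable_snd) ρ
  have h' : Measurable fun x : E => ((0 : ℝ), x) := measurable_prodMk_left
  have h2 := h.comp h'
  simpa only [Function.comp_def] using h2

/-- The weak type `(1,1)` inequality. -/
lemma mul_measure_lt_dyadicMaximal_le {ρ : ℝ} (hρ : 0 < ρ) (g : E → ℝ≥0∞)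
    {l : ℝ≥0∞} :
    l * μ {x | l < dyadicMaximal μ ρ g x} ≤ 4 ^ Module.finrank ℝ E * ∫⁻ y, g y ∂μ := by
  set t := {x | l < dyadicMaximal μ ρ g x} with ht
  have hex : ∀ x : E, ∃ n : ℕ, x ∈ t →
      l < (∫⁻ y in Metric.closedBall x (ρ / 2 ^ n), g y ∂μ) /
        μ (Metric.closedBall x (ρ / 2 ^ n)) := by
    intro x
    by_cases hx : x ∈ t
    · obtain ⟨n, hn⟩ := lt_iSup_iff.1 (show l < dyadicMaximal μ ρ g x from hx)
      exact ⟨n, fun _ => hn⟩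
    · exact ⟨0, fun h => absurd h hx⟩
  choose N hN using hex
  set r : E → ℝ := fun x => ρ / 2 ^ N x with hr
  have hrpos : ∀ x, 0 < r x := fun x => by simp only [hr]; positivity
  -- The enlargement factor in Vitali's lemma must exceed 3; the choice 4 produces the constant 4^d.
  obtain ⟨u, hut, hdisj, hcov⟩ := Vitali.exists_disjoint_subfamily_covering_enlargement_closedBall
    t (fun x => x) r ρ (fun a _ => div_le_self hρ.le (one_le_pow₀ (by norm_num))) 4 (by norm_num)
  have hucount : u.Countable := hdisj.countable_of_nonempty_interior fun x _ =>
    ⟨x, Metric.ball_subset_interior_closedBall (Metric.mem_ball_self (hrpos x))⟩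
  have hball : ∀ x ∈ u, l * μ (Metric.closedBall x (r x)) ≤
      ∫⁻ y in Metric.closedBall x (r x), g y ∂μ := fun x hx =>
    (ENNReal.le_div_iff_mul_le (Or.inl (measure_closedBall_pos' μ x (hrpos x)))
      (Or.inl (measure_closedBall_ne_top μ x _))).1 (hN x (hut hx)).le
  have htsub : t ⊆ ⋃ x ∈ u, Metric.closedBall x (4 * r x) := by
    intro x hx
    obtain ⟨b, hb, hsub⟩ := hcov x hx
    exact mem_biUnion hb (hsub (Metric.mem_closedBall_self (hrpos x).le))
  calc l * μ t ≤ l * ∑' x : u, μ (Metric.closedBall (x : E) (4 * r x)) := by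
        gcongr
        exact (measure_mono htsub).trans (measure_biUnion_le μ hucount _)
    _ = 4 ^ Module.finrank ℝ E * ∑' x : u, l * μ (Metric.closedBall (x : E) (r x)) := by
        rw [ENNReal.tsum_mul_left, mul_left_comm]
        congr 1
        rw [← ENNReal.tsum_mul_left]
        congr 1
        ext x
        rw [measure_closedBall_scale μ _ (hrpos _).le (by norm_num), ENNReal.ofReal_ofNat]
    _ ≤ 4 ^ Module.finrank ℝ E * ∑' x : u, ∫⁻ y in Metric.closedBall (x : E) (r x), g y ∂μ := by
        gcongr with x
        exact hball x x.2
    _ = 4 ^ Module.finrank ℝ E * ∫⁻ y in ⋃ x ∈ u, Metric.closedBall x (r x), g y ∂μ := by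
        rw [lintegral_biUnion hucount (fun x _ => Metric.isClosed_closedBall.measurableSet) hdisj]
    _ ≤ _ := by
        exact mul_le_mul' le_rfl (setLIntegral_le_lintegral _ _)

/-- Pointwise g ≤ g·1_{g > l} + l, and averaging a constant returns it. The weak-type inequality can
thus be applied to the large part of g alone. -/
lemma dyadicMaximal_le_truncate {ρ : ℝ} (hρ : 0 < ρ) {g : E → ℝ≥0∞}
    (l : ℝ≥0∞) (x : E) :
    dyadicMaximal μ ρ g x ≤ dyadicMaximal μ ρ ({y | l < g y}.indicator g) x + l := by
  refine iSup_le fun n => ?_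
  rw [ENNReal.div_le_iff (measure_closedBall_pos' μ x (by positivity))
    (measure_closedBall_ne_top μ x _), add_mul]
  calc ∫⁻ y in Metric.closedBall x (ρ / 2 ^ n), g y ∂μ
      ≤ ∫⁻ y in Metric.closedBall x (ρ / 2 ^ n), ({y | l < g y}.indicator g y + l) ∂μ := by
        refine lintegral_mono fun y => ?_
        by_cases h : l < g y
        · simp [indicator, h]
        · simp only [indicator, mem_setOf_eq, h, if_false, zero_add]
          exact not_lt.1 h
    _ = ∫⁻ y in Metric.closedBall x (ρ / 2 ^ n), {y | l < g y}.indicator g y ∂μ +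
          l * μ (Metric.closedBall x (ρ / 2 ^ n)) := by
        rw [lintegral_add_right _ measurable_const]
        simp
    _ ≤ _ := by
        gcongr
        exact setLIntegral_dyadic_le μ ρ hρ _ x n

/-- A discrete layer-cake formula: if 2^n < a ≤ 2^(n+1) with n ≥ 1, the series is 2 + 4 + … + 2^n =
2^(n+1) - 2. The induction on truncations of a also covers a = ⊤. -/
lemma le_two_add_tsum_dyadic (a : ℝ≥0∞) :
    a ≤ 2 + ∑' k : ℕ, (2 : ℝ≥0∞) ^ (k + 1) * (if (2 : ℝ≥0∞) ^ (k + 1) < a then 1 else 0) := by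
  have key : ∀ n : ℕ, min a (2 ^ (n + 1)) ≤ 2 + ∑ k ∈ Finset.range n,
      (2 : ℝ≥0∞) ^ (k + 1) * (if (2 : ℝ≥0∞) ^ (k + 1) < a then 1 else 0) := by
    intro n
    induction n with
    | zero => simp
    | succ n ih =>
      rw [Finset.sum_range_succ, ← add_assoc]
      by_cases h : (2 : ℝ≥0∞) ^ (n + 1) < a
      · rw [min_eq_right h.le] at ih
        simp only [h, if_true, mul_one]
        calc min a (2 ^ (n + 1 + 1)) ≤ 2 ^ (n + 1 + 1) := min_le_right _ _
          _ = 2 ^ (n + 1) + 2 ^ (n + 1) := by rw [pow_succ _ (n + 1), mul_two]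
          _ ≤ _ := by gcongr
      · rw [min_eq_left (not_lt.1 h)] at ih
        exact (min_le_left _ _).trans (ih.trans (by simp))
  by_contra! hlt
  set S := ∑' k : ℕ, (2 : ℝ≥0∞) ^ (k + 1) * (if (2 : ℝ≥0∞) ^ (k + 1) < a then 1 else 0)
  obtain ⟨n, hn⟩ := ENNReal.exists_nat_gt hlt.ne_top
  have h2 : (2 + S) < 2 ^ (n + 1) := hn.trans (by
    exact_mod_cast (Nat.lt_two_pow_self (n := n)).trans (Nat.pow_lt_pow_right (by norm_num) (by simp)))
  have h3 := (lt_min hlt h2).trans_le (key n)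
  exact absurd (ENNReal.sum_le_tsum (Finset.range n)) (not_le.2 (lt_of_add_lt_add_left h3))

/-- At most 1 + log(2 + f)/log 2 indices count, and log 2 > 2/3 absorbs both terms into 3 log(2 +
f). This count is the logarithm in L log L. -/
lemma tsum_dyadic_count_le {f : ℝ} (hf : 0 ≤ f) :
    ∑' k : ℕ, (if (2 : ℝ≥0∞) ^ k < ENNReal.ofReal f then (1 : ℝ≥0∞) else 0) ≤
      3 * ENNReal.ofReal (Real.log (2 + f)) := by
  set N := ⌊Real.log (2 + f) / Real.log 2⌋₊ + 1 with hN
  have hl2 : 0 < Real.log 2 := Real.log_pos (by norm_num)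
  have hl2f : 0 ≤ Real.log (2 + f) := Real.log_nonneg (by linarith)
  have hlf : Real.log 2 ≤ Real.log (2 + f) := Real.log_le_log (by norm_num) (by linarith)
  rw [tsum_eq_sum (s := Finset.range N)]
  · calc ∑ k ∈ Finset.range N, (if (2 : ℝ≥0∞) ^ k < ENNReal.ofReal f then (1 : ℝ≥0∞) else 0)
        ≤ ∑ k ∈ Finset.range N, 1 := Finset.sum_le_sum fun k _ => by split_ifs <;> simp
      _ = ENNReal.ofReal N := by simp
      _ ≤ ENNReal.ofReal (3 * Real.log (2 + f)) := by
          apply ENNReal.ofReal_le_ofReal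
          have h1 : ((⌊Real.log (2 + f) / Real.log 2⌋₊ : ℕ) : ℝ) ≤ Real.log (2 + f) / Real.log 2 :=
            Nat.floor_le (by positivity)
          have h2 : Real.log (2 + f) / Real.log 2 ≤ 3 / 2 * Real.log (2 + f) := by
            rw [div_le_iff₀ hl2]
            nlinarith [Real.log_two_gt_d9]
          have h3 : 1 ≤ 3 / 2 * Real.log (2 + f) := by nlinarith [Real.log_two_gt_d9]
          rw [hN]
          push_cast
          linarith
      _ = _ := by rw [ENNReal.ofReal_mul (by norm_num), ENNReal.ofReal_ofNat]
  · intro k hk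
    rw [if_neg]
    intro hlt
    apply hk
    rw [Finset.mem_range, hN, Nat.lt_succ_iff, Nat.le_floor_iff (by positivity),
      le_div_iff₀ hl2, ← Real.log_pow]
    have h2 : ((2 : ℝ) ^ k) < f := by
      rw [← ENNReal.ofReal_ofNat 2, ← ENNReal.ofReal_pow (by norm_num)] at hlt
      exact (ENNReal.ofReal_lt_ofReal_iff_of_nonneg (by positivity)).1 hlt
    exact Real.log_le_log (by positivity) (by linarith)

/-- The maximal function of an `L log L` function is locally integrable. -/
lemma setLIntegral_dyadicMaximal_le {ρ : ℝ} (hρ : 0 < ρ) {f : E → ℝ} (hf : Measurable f)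
    (hf0 : ∀ x, 0 ≤ f x) (A : Set E) :
    ∫⁻ x in A, dyadicMaximal μ ρ (fun y => ENNReal.ofReal (f y)) x ∂μ ≤
      2 * μ A + 6 * 4 ^ Module.finrank ℝ E *
        ∫⁻ x, ENNReal.ofReal (f x * Real.log (2 + f x)) ∂μ := by
  set g : E → ℝ≥0∞ := fun y => ENNReal.ofReal (f y) with hg
  have hgm : Measurable g := hf.ennreal_ofReal
  have hMm : Measurable (dyadicMaximal μ ρ g) := measurable_dyadicMaximal_right μ hgm ρ
  -- The level 2^(k+1) is split as 2^k + 2^k: one half truncates g, the other is the level in the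
  -- weak-type bound.
  have hlevel : ∀ k : ℕ, (2 : ℝ≥0∞) ^ (k + 1) * μ {x | (2 : ℝ≥0∞) ^ (k + 1) < dyadicMaximal μ ρ g x} ≤
      2 * 4 ^ Module.finrank ℝ E * ∫⁻ y, {y | (2 : ℝ≥0∞) ^ k < g y}.indicator g y ∂μ := by
    intro k
    have hsub : {x | (2 : ℝ≥0∞) ^ (k + 1) < dyadicMaximal μ ρ g x} ⊆
        {x | (2 : ℝ≥0∞) ^ k < dyadicMaximal μ ρ ({y | (2 : ℝ≥0∞) ^ k < g y}.indicator g) x} := by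
      intro x hx
      have h1 := (show _ < _ from hx).trans_le
        (dyadicMaximal_le_truncate μ hρ ((2 : ℝ≥0∞) ^ k) x)
      rw [pow_succ, mul_two] at h1
      exact lt_of_add_lt_add_right h1
    calc (2 : ℝ≥0∞) ^ (k + 1) * μ {x | (2 : ℝ≥0∞) ^ (k + 1) < dyadicMaximal μ ρ g x}
        ≤ 2 * ((2 : ℝ≥0∞) ^ k *
          μ {x | (2 : ℝ≥0∞) ^ k < dyadicMaximal μ ρ ({y | (2 : ℝ≥0∞) ^ k < g y}.indicator g) x}) := by
          rw [pow_succ, mul_comm ((2 : ℝ≥0∞) ^ k) 2, mul_assoc]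
          rw [pow_succ, mul_comm ((2 : ℝ≥0∞) ^ k) 2] at hsub
          exact mul_le_mul' le_rfl (mul_le_mul' le_rfl (measure_mono hsub))
      _ ≤ 2 * (4 ^ Module.finrank ℝ E * ∫⁻ y, {y | (2 : ℝ≥0∞) ^ k < g y}.indicator g y ∂μ) := by
          exact mul_le_mul' le_rfl (mul_measure_lt_dyadicMaximal_le μ hρ _)
      _ = _ := by ring
  have hms : ∀ k : ℕ, MeasurableSet {x | (2 : ℝ≥0∞) ^ (k + 1) < dyadicMaximal μ ρ g x} :=
    fun k => measurableSet_lt measurable_const hMm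
  have hms' : ∀ k : ℕ, MeasurableSet {x | (2 : ℝ≥0∞) ^ k < g x} :=
    fun k => measurableSet_lt measurable_const hgm
  calc ∫⁻ x in A, dyadicMaximal μ ρ g x ∂μ
      ≤ ∫⁻ x in A, (2 + ∑' k : ℕ, (2 : ℝ≥0∞) ^ (k + 1) *
          (if (2 : ℝ≥0∞) ^ (k + 1) < dyadicMaximal μ ρ g x then 1 else 0)) ∂μ :=
        lintegral_mono fun x => le_two_add_tsum_dyadic _
    _ = 2 * μ A + ∑' k : ℕ, (2 : ℝ≥0∞) ^ (k + 1) * ∫⁻ x in A,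
          (if (2 : ℝ≥0∞) ^ (k + 1) < dyadicMaximal μ ρ g x then 1 else 0) ∂μ := by
        rw [lintegral_add_left measurable_const, lintegral_tsum]
        · congr 1
          · simp
          · congr 1
            ext k
            rw [lintegral_const_mul' _ _ (by simp)]
        · intro k
          exact ((Measurable.ite (hms k) measurable_const measurable_const).const_mul _).aemeasurable
    _ ≤ 2 * μ A + ∑' k : ℕ, (2 : ℝ≥0∞) ^ (k + 1) *
          μ {x | (2 : ℝ≥0∞) ^ (k + 1) < dyadicMaximal μ ρ g x} := by
        refine add_le_add le_rfl (ENNReal.tsum_le_tsum fun k => mul_le_mul' le_rfl ?_)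
        refine (setLIntegral_le_lintegral _ _).trans (le_of_eq ?_)
        rw [← lintegral_indicator_one (hms k)]
        simp [indicator]
    _ ≤ 2 * μ A + ∑' k : ℕ, 2 * 4 ^ Module.finrank ℝ E *
          ∫⁻ y, {y | (2 : ℝ≥0∞) ^ k < g y}.indicator g y ∂μ := by
        exact add_le_add le_rfl (ENNReal.tsum_le_tsum fun k => hlevel k)
    _ = 2 * μ A + 2 * 4 ^ Module.finrank ℝ E *
          ∫⁻ y, ∑' k : ℕ, {y | (2 : ℝ≥0∞) ^ k < g y}.indicator g y ∂μ := by
        rw [ENNReal.tsum_mul_left, lintegral_tsum]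
        exact fun k => (hgm.indicator (hms' k)).aemeasurable
    _ ≤ 2 * μ A + 2 * 4 ^ Module.finrank ℝ E *
          ∫⁻ y, 3 * ENNReal.ofReal (f y * Real.log (2 + f y)) ∂μ := by
        gcongr with y
        calc ∑' k : ℕ, {y | (2 : ℝ≥0∞) ^ k < g y}.indicator g y
            = ∑' k : ℕ, g y * (if (2 : ℝ≥0∞) ^ k < g y then 1 else 0) := by
              congr 1
              ext k
              simp [indicator]
          _ = g y * ∑' k : ℕ, (if (2 : ℝ≥0∞) ^ k < g y then 1 else 0) := ENNReal.tsum_mul_left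
          _ ≤ g y * (3 * ENNReal.ofReal (Real.log (2 + f y))) := by
              gcongr
              exact tsum_dyadic_count_le (hf0 y)
          _ = _ := by
              rw [ENNReal.ofReal_mul (hf0 y)]
              ring
    _ = _ := by
        rw [lintegral_const_mul' _ _ (by simp)]
        ring

lemma setLIntegral_closedBall_dyadicMaximal_le {F : Type*} [NormedAddCommGroup F]
    [MeasurableSpace F] [OpensMeasurableSpace F] {ρ R : ℝ} (hρ : 0 < ρ)
    {G : E → F} (hG : Measurable G) :
    ∫⁻ x in Metric.closedBall (0 : E) R, dyadicMaximal μ ρ (fun y => ‖G y‖ₑ) x ∂μ ≤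
      2 * μ (Metric.closedBall (0 : E) R) + 6 * 4 ^ Module.finrank ℝ E *
        ∫⁻ x in Metric.closedBall (0 : E) (R + ρ),
          ENNReal.ofReal (‖G x‖ * Real.log (2 + ‖G x‖)) ∂μ := by
  have hb : MeasurableSet (Metric.closedBall (0 : E) (R + ρ)) :=
    Metric.isClosed_closedBall.measurableSet
  set f : E → ℝ := (Metric.closedBall (0 : E) (R + ρ)).indicator (fun y => ‖G y‖)
  have h1 := setLIntegral_dyadicMaximal_le μ hρ (f := f) (hG.norm.indicator hb)
    (fun x => indicator_nonneg (fun _ _ => norm_nonneg _) x) (Metric.closedBall (0 : E) R)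
  refine le_trans (setLIntegral_mono' Metric.isClosed_closedBall.measurableSet fun x hx => ?_)
    (h1.trans (le_of_eq ?_))
  · refine (dyadicMaximal_mono_of_ball μ hρ.le _ hx).trans (le_of_eq ?_)
    congr 1
    ext y
    by_cases hy : y ∈ Metric.closedBall (0 : E) (R + ρ) <;> simp [f, indicator, hy]
  · rw [← lintegral_indicator hb]
    congr 3
    ext y
    by_cases hy : y ∈ Metric.closedBall (0 : E) (R + ρ)
    · simp only [f, indicator_of_mem hy]
    · simp only [f, indicator_of_notMem hy]
      simp

end Maximal

/-! ### Gronwall's inequality with an integrable kernel -/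

section Gronwall

lemma setLIntegral_Ioc_add {f : ℝ → ℝ≥0∞} {r s t : ℝ} (hrs : r ≤ s) (hst : s ≤ t) :
    ∫⁻ x in Ioc r t, f x = (∫⁻ x in Ioc r s, f x) + ∫⁻ x in Ioc s t, f x := by
  rw [← Ioc_union_Ioc_eq_Ioc hrs hst, lintegral_union measurableSet_Ioc
    (Ioc_disjoint_Ioc_of_le le_rfl)]

lemma exists_pos_setLIntegral_Ioc_lt {T : ℝ} {k : ℝ → ℝ≥0∞} (hk : ∫⁻ s in Icc 0 T, k s ≠ ⊤)
    {ε : ℝ≥0∞} (hε : ε ≠ 0) :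
    ∃ δ : ℝ, 0 < δ ∧ ∀ s t : ℝ, 0 ≤ s → t ≤ T → t - s < δ → ∫⁻ x in Ioc s t, k x < ε := by
  obtain ⟨δ, hδ, h⟩ := exists_pos_setLIntegral_lt_of_measure_lt hk hε
  obtain ⟨δ', hδ', hδ''⟩ := ENNReal.lt_iff_exists_nnreal_btwn.1 hδ
  refine ⟨δ', by exact_mod_cast hδ', fun s t hs ht hst => ?_⟩
  have hsub : Ioc s t ⊆ Icc 0 T := fun x hx => ⟨hs.trans hx.1.le, hx.2.trans ht⟩
  have h1 := h (Ioc s t) ?_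
  · rwa [Measure.restrict_restrict measurableSet_Ioc, inter_eq_left.2 hsub] at h1
  · refine (Measure.restrict_apply_le _ _).trans_lt (lt_of_le_of_lt ?_ hδ'')
    rw [Real.volume_Ioc]
    calc ENNReal.ofReal (t - s) ≤ ENNReal.ofReal δ' := ENNReal.ofReal_le_ofReal hst.le
      _ = δ' := ENNReal.ofReal_coe_nnreal

/-- Gronwall's inequality with an integrable kernel, for bounded functions. -/
lemma le_mul_exp_of_le_add_setLIntegral {T : ℝ} {u k : ℝ → ℝ≥0∞} {a M : ℝ≥0∞}
    (hu : ∀ t ∈ Icc 0 T, u t ≤ M) (hM : M ≠ ⊤) (hk : ∫⁻ s in Icc 0 T, k s ≠ ⊤)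
    (h : ∀ t ∈ Icc 0 T, u t ≤ a + ∫⁻ s in Ioc 0 t, k s * u s) :
    ∀ t ∈ Icc 0 T, u t ≤
      a * ENNReal.ofReal (Real.exp (2 * (∫⁻ s in Icc 0 T, k s).toReal)) := by
  intro t ht
  by_cases ha : a = ⊤
  · rw [ha, ENNReal.top_mul (by simp [Real.exp_pos])]
    exact le_top
  -- The majorant v is nondecreasing, and finite because u is bounded, so it can be absorbed on the
  -- left. Only domains are split and finite constants pulled out, so u and k need not be
  -- measurable.
  set v : ℝ → ℝ≥0∞ := fun t => a + ∫⁻ s in Ioc 0 t, k s * u s with hv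
  have hIoc : ∀ {s t : ℝ}, 0 ≤ s → t ≤ T → Ioc s t ⊆ Icc 0 T :=
    fun hs ht x hx => ⟨hs.trans hx.1.le, hx.2.trans ht⟩
  have hkfin : ∀ {s t : ℝ}, 0 ≤ s → t ≤ T → ∫⁻ x in Ioc s t, k x ≠ ⊤ := fun hs ht =>
    ne_top_of_le_ne_top hk (lintegral_mono_set (hIoc hs ht))
  have hkufin : ∀ {s t : ℝ}, 0 ≤ s → t ≤ T → ∫⁻ x in Ioc s t, k x * u x ≠ ⊤ := by
    intro s t hs ht
    refine ne_top_of_le_ne_top (ENNReal.mul_ne_top (hkfin hs ht) hM) ?_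
    rw [← lintegral_mul_const' _ _ hM]
    exact setLIntegral_mono' measurableSet_Ioc fun x hx =>
      mul_le_mul' le_rfl (hu x (hIoc hs ht hx))
  have hvfin : ∀ {t : ℝ}, t ≤ T → v t ≠ ⊤ := fun ht =>
    ENNReal.add_ne_top.2 ⟨ha, hkufin le_rfl ht⟩
  -- On steps where k has mass η ≤ 1/2, (1 - η) exp(2η) ≥ (1 - η)(1 + 2η) ≥ 1. This explains the
  -- factor 2 in the exponent.
  obtain ⟨δ, hδ, hδk⟩ := exists_pos_setLIntegral_Ioc_lt hk (ε := ENNReal.ofReal (1 / 2)) (by simp)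
  have hstep : ∀ s t : ℝ, 0 ≤ s → s ≤ t → t ≤ T → t - s < δ →
      (v t).toReal ≤ (v s).toReal * Real.exp (2 * (∫⁻ x in Ioc s t, k x).toReal) := by
    intro s t hs hst ht hd
    have hη := (hδk s t hs ht hd).le
    have hkf := hkfin hs ht
    have hη' : (∫⁻ x in Ioc s t, k x).toReal ≤ 1 / 2 := by
      rw [← ENNReal.toReal_ofReal (show (0 : ℝ) ≤ 1 / 2 by norm_num)]
      exact ENNReal.toReal_mono ENNReal.ofReal_ne_top hη
    have hη0 : 0 ≤ (∫⁻ x in Ioc s t, k x).toReal := ENNReal.toReal_nonneg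
    have h1 : v t ≤ v s + (∫⁻ x in Ioc s t, k x) * v t := by
      calc v t = v s + ∫⁻ x in Ioc s t, k x * u x := by
            simp only [hv]
            rw [setLIntegral_Ioc_add hs hst, add_assoc]
        _ ≤ v s + ∫⁻ x in Ioc s t, k x * v t := by
            refine add_le_add le_rfl (setLIntegral_mono' measurableSet_Ioc fun x hx => ?_)
            refine mul_le_mul' le_rfl ((h x (hIoc hs ht hx)).trans ?_)
            exact add_le_add le_rfl (lintegral_mono_set (Ioc_subset_Ioc_right hx.2))
        _ = _ := by rw [lintegral_mul_const' _ _ (hvfin ht)]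
    have h2 := ENNReal.toReal_mono (ENNReal.add_ne_top.2 ⟨hvfin (hst.trans ht),
      ENNReal.mul_ne_top hkf (hvfin ht)⟩) h1
    rw [ENNReal.toReal_add (hvfin (hst.trans ht)) (ENNReal.mul_ne_top hkf (hvfin ht)),
      ENNReal.toReal_mul] at h2
    set η := (∫⁻ x in Ioc s t, k x).toReal
    have h3 : (v t).toReal * (1 - η) ≤ (v s).toReal := by linarith
    have h4 : 1 ≤ (1 - η) * Real.exp (2 * η) := by
      have := Real.add_one_le_exp (2 * η)
      nlinarith
    have h5 : 0 ≤ (v t).toReal := ENNReal.toReal_nonneg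
    calc (v t).toReal ≤ (v t).toReal * ((1 - η) * Real.exp (2 * η)) :=
          le_mul_of_one_le_right h5 h4
      _ = (v t).toReal * (1 - η) * Real.exp (2 * η) := by ring
      _ ≤ _ := by gcongr
  obtain ⟨N, hN⟩ := exists_nat_gt (t / δ)
  have hN0 : 0 < (N : ℝ) := (div_nonneg ht.1 hδ.le).trans_lt hN
  have hpt : ∀ i : ℕ, i ≤ N → t * i / N ≤ T := fun i hi => by
    refine le_trans ?_ ht.2
    rw [div_le_iff₀ hN0]
    exact mul_le_mul_of_nonneg_left (by exact_mod_cast hi) ht.1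
  have hind : ∀ i : ℕ, i ≤ N → (v (t * i / N)).toReal ≤
      a.toReal * Real.exp (2 * (∫⁻ x in Ioc 0 (t * i / N), k x).toReal) := by
    intro i
    induction i with
    | zero => simp [hv]
    | succ i ih =>
      intro hi
      have h0 : 0 ≤ t * i / N := div_nonneg (mul_nonneg ht.1 (Nat.cast_nonneg _)) hN0.le
      have hd : t * (i + 1 : ℕ) / N - t * i / N < δ := by
        rw [div_lt_iff₀ hδ] at hN
        push_cast
        rw [← sub_div, div_lt_iff₀ hN0]
        linarith
      have hle : t * i / N ≤ t * (i + 1 : ℕ) / N := by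
        rw [div_le_div_iff_of_pos_right hN0]
        push_cast
        nlinarith [ht.1]
      refine (hstep _ _ h0 hle (hpt _ hi) hd).trans ?_
      rw [setLIntegral_Ioc_add h0 hle, ENNReal.toReal_add (hkfin le_rfl (hpt _ (by omega)))
        (hkfin h0 (hpt _ hi)), mul_add, Real.exp_add, ← mul_assoc]
      gcongr
      exact ih (by omega)
  have h1 := hind N le_rfl
  rw [mul_div_cancel_right₀ _ hN0.ne'] at h1
  calc u t ≤ v t := h t ht
    _ = ENNReal.ofReal (v t).toReal := (ENNReal.ofReal_toReal (hvfin ht.2)).symm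
    _ ≤ ENNReal.ofReal (a.toReal * Real.exp (2 * (∫⁻ s in Icc 0 T, k s).toReal)) := by
        refine ENNReal.ofReal_le_ofReal (h1.trans ?_)
        gcongr
        exact hIoc le_rfl ht.2
    _ = _ := by rw [ENNReal.ofReal_mul ENNReal.toReal_nonneg, ENNReal.ofReal_toReal ha]

end Gronwall

/-! ### Two-point estimates for smooth maps from averages of the derivative -/

section Averages

variable {E : Type*} [NormedAddCommGroup E] [NormedSpace ℝ E] [FiniteDimensional ℝ E]
  [MeasurableSpace E] [BorelSpace E] (μ : Measure E) [μ.IsAddHaarMeasure]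
  {F : Type*} [NormedAddCommGroup F] [NormedSpace ℝ F] [CompleteSpace F]

lemma lintegral_comp_homothety {h : E → ℝ≥0∞} (hh : Measurable h) (x : E) {s : ℝ} (hs : 0 < s) :
    ∫⁻ z, h (x + s • (z - x)) ∂μ =
      (ENNReal.ofReal s ^ Module.finrank ℝ E)⁻¹ * ∫⁻ z, h z ∂μ := by
  rw [lintegral_sub_right_eq_self (fun w => h (x + s • w)) x]
  have h1 : ∫⁻ w, h (x + s • w) ∂μ = ∫⁻ w, h (x + w) ∂(Measure.map (fun w => s • w) μ) := by
    rw [lintegral_map (by fun_prop) (by fun_prop)]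
  rw [h1, Measure.map_addHaar_smul μ hs.ne', lintegral_smul_measure, smul_eq_mul,
    lintegral_add_left_eq_self h x, abs_of_pos (by positivity), ENNReal.ofReal_inv_of_pos
    (by positivity), ENNReal.ofReal_pow hs.le]

/-- The homothety of ratio s about x carries B(x, r) onto B(x, sr) and scales volume by s^d, so the
average of the dilated function is an average of g over a smaller ball. -/
lemma setLIntegral_comp_homothety_le {g : E → ℝ≥0∞} (hg : Measurable g) {x : E} {r s : ℝ}
    (hr : 0 < r) (hs : 0 < s) (hs1 : s ≤ 1) {M : ℝ≥0∞}
    (hM : ∀ t, 0 < t → t ≤ r →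
      ∫⁻ y in Metric.closedBall x t, g y ∂μ ≤ M * μ (Metric.closedBall x t)) :
    ∫⁻ z in Metric.closedBall x r, g (x + s • (z - x)) ∂μ ≤ M * μ (Metric.closedBall x r) := by
  have hb : ∀ t, MeasurableSet (Metric.closedBall x t) :=
    fun t => Metric.isClosed_closedBall.measurableSet
  have hso : ENNReal.ofReal s ^ Module.finrank ℝ E ≠ 0 := pow_ne_zero _ (by simpa using hs)
  have hst : ENNReal.ofReal s ^ Module.finrank ℝ E ≠ ⊤ := ENNReal.pow_ne_top ENNReal.ofReal_ne_top
  calc ∫⁻ z in Metric.closedBall x r, g (x + s • (z - x)) ∂μ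
      = ∫⁻ z, (Metric.closedBall x (s * r)).indicator g (x + s • (z - x)) ∂μ := by
        rw [← lintegral_indicator (hb r)]
        congr 1
        ext z
        have : x + s • (z - x) ∈ Metric.closedBall x (s * r) ↔ z ∈ Metric.closedBall x r := by
          simp only [Metric.mem_closedBall, dist_eq_norm, add_sub_cancel_left, norm_smul,
            Real.norm_eq_abs, abs_of_pos hs]
          exact mul_le_mul_iff_right₀ hs
        by_cases hz : z ∈ Metric.closedBall x r
        · rw [indicator_of_mem hz, indicator_of_mem (this.2 hz)]
        · rw [indicator_of_notMem hz, indicator_of_notMem (fun h => hz (this.1 h))]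
    _ = (ENNReal.ofReal s ^ Module.finrank ℝ E)⁻¹ * ∫⁻ z in Metric.closedBall x (s * r), g z ∂μ := by
        rw [lintegral_comp_homothety μ (hg.indicator (hb _)) x hs, lintegral_indicator (hb _)]
    _ ≤ (ENNReal.ofReal s ^ Module.finrank ℝ E)⁻¹ * (M * μ (Metric.closedBall x (s * r))) :=
        mul_le_mul' le_rfl (hM _ (by positivity) (mul_le_of_le_one_left hr.le hs1))
    _ = M * μ (Metric.closedBall x r) := by
        rw [measure_closedBall_scale μ x hr.le hs.le, mul_left_comm M, ← mul_assoc,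
          ENNReal.inv_mul_cancel hso hst, one_mul]

lemma enorm_sub_le_setLIntegral_fderiv {f : E → F} (hf : ContDiff ℝ 1 f) (x z : E) :
    ‖f z - f x‖ₑ ≤ ‖z - x‖ₑ * ∫⁻ s in Ioc (0 : ℝ) 1, ‖fderiv ℝ f (x + s • (z - x))‖ₑ := by
  have hcont : Continuous fun s : ℝ => fderiv ℝ f (x + s • (z - x)) (z - x) :=
    ((hf.continuous_fderiv one_ne_zero).comp (by fun_prop)).clm_apply continuous_const
  have hder : ∀ s : ℝ, HasDerivAt (fun s : ℝ => f (x + s • (z - x)))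
      (fderiv ℝ f (x + s • (z - x)) (z - x)) s := by
    intro s
    have h1 : HasDerivAt (fun s : ℝ => x + s • (z - x)) (z - x) s := by
      simpa using ((hasDerivAt_id s).smul_const (z - x)).const_add x
    exact ((hf.differentiable one_ne_zero) _).hasFDerivAt.comp_hasDerivAt s h1
  have h2 := intervalIntegral.integral_eq_sub_of_hasDerivAt (a := 0) (b := 1)
    (fun s _ => hder s) (hcont.intervalIntegrable _ _)
  simp only [one_smul, add_sub_cancel, zero_smul, add_zero] at h2
  rw [← h2, intervalIntegral.integral_of_le zero_le_one]
  refine (enorm_integral_le_lintegral_enorm _).trans ?_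
  rw [← lintegral_const_mul' _ _ (by simp)]
  refine lintegral_mono fun s => ?_
  rw [mul_comm]
  exact ContinuousLinearMap.le_opENorm _ _

/-- The derivative is integrated along the segment from x to z and then over z. After Tonelli, each
fixed point of the segment parameter is a homothety, to which the bound on averages applies. -/
lemma setLIntegral_enorm_sub_le {f : E → F} (hf : ContDiff ℝ 1 f) {x : E} {r : ℝ} (hr : 0 < r)
    {M : ℝ≥0∞} (hM : ∀ t, 0 < t → t ≤ r →
      ∫⁻ y in Metric.closedBall x t, ‖fderiv ℝ f y‖ₑ ∂μ ≤ M * μ (Metric.closedBall x t)) :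
    ∫⁻ z in Metric.closedBall x r, ‖f z - f x‖ₑ ∂μ ≤
      ENNReal.ofReal r * (M * μ (Metric.closedBall x r)) := by
  have hb : MeasurableSet (Metric.closedBall x r) := Metric.isClosed_closedBall.measurableSet
  have hgc : Continuous fun y => ‖fderiv ℝ f y‖ₑ := (hf.continuous_fderiv one_ne_zero).enorm
  calc ∫⁻ z in Metric.closedBall x r, ‖f z - f x‖ₑ ∂μ
      ≤ ∫⁻ z in Metric.closedBall x r, ENNReal.ofReal r *
          (∫⁻ s in Ioc (0 : ℝ) 1, ‖fderiv ℝ f (x + s • (z - x))‖ₑ) ∂μ := by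
        refine setLIntegral_mono' hb fun z hz => ?_
        refine (enorm_sub_le_setLIntegral_fderiv hf x z).trans (mul_le_mul' ?_ le_rfl)
        rw [← ofReal_norm]
        exact ENNReal.ofReal_le_ofReal (by simpa [dist_eq_norm] using hz)
    _ = ENNReal.ofReal r * ∫⁻ s in Ioc (0 : ℝ) 1, ∫⁻ z in Metric.closedBall x r,
          ‖fderiv ℝ f (x + s • (z - x))‖ₑ ∂μ := by
        rw [lintegral_const_mul' _ _ ENNReal.ofReal_ne_top, lintegral_lintegral_swap]
        have : Continuous fun p : E × ℝ => ‖fderiv ℝ f (x + p.2 • (p.1 - x))‖ₑ :=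
          hgc.comp (by fun_prop)
        exact this.measurable.aemeasurable
    _ ≤ ENNReal.ofReal r * ∫⁻ s in Ioc (0 : ℝ) 1, M * μ (Metric.closedBall x r) := by
        refine mul_le_mul' le_rfl (setLIntegral_mono' measurableSet_Ioc fun s hs => ?_)
        exact setLIntegral_comp_homothety_le μ hgc.measurable hr hs.1 hs.2 hM
    _ = _ := by simp

/-- Two-point estimate for a `C¹` map by averages of its derivative around the two points. -/
lemma enorm_sub_le_of_averages {f : E → F} (hf : ContDiff ℝ 1 f) {x y : E} {Mx My : ℝ≥0∞}
    (hx : ∀ t, 0 < t → t ≤ ‖x - y‖ →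
      ∫⁻ z in Metric.closedBall x t, ‖fderiv ℝ f z‖ₑ ∂μ ≤ Mx * μ (Metric.closedBall x t))
    (hy : ∀ t, 0 < t → t ≤ ‖x - y‖ →
      ∫⁻ z in Metric.closedBall y t, ‖fderiv ℝ f z‖ₑ ∂μ ≤ My * μ (Metric.closedBall y t)) :
    ‖f x - f y‖ₑ ≤ 2 ^ Module.finrank ℝ E * (‖x - y‖ₑ * (Mx + My)) := by
  rcases eq_or_ne x y with rfl | hxy
  · simp
  set r := ‖x - y‖ with hr
  have hr0 : 0 < r := norm_pos_iff.2 (sub_ne_zero.2 hxy)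
  -- The ball of radius r/2 about the midpoint lies in both B(x, r) and B(y, r). Averaging |f x - f
  -- z| + |f z - f y| over its points z costs the volume ratio 2^d.
  set m : E := midpoint ℝ x y
  set I := Metric.closedBall m (r / 2)
  have hI : MeasurableSet I := Metric.isClosed_closedBall.measurableSet
  have hIx : I ⊆ Metric.closedBall x r := by
    refine Metric.closedBall_subset_closedBall' ?_
    rw [dist_midpoint_left, dist_eq_norm, ← hr]
    norm_num
    linarith
  have hIy : I ⊆ Metric.closedBall y r := by
    refine Metric.closedBall_subset_closedBall' ?_
    rw [dist_midpoint_right, dist_eq_norm, ← hr]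
    norm_num
    linarith
  have hI0 : μ I ≠ 0 := measure_closedBall_pos' μ m (by positivity)
  have hIt : μ I ≠ ⊤ := measure_closedBall_ne_top μ m _
  have hvol : ∀ w : E, μ (Metric.closedBall w r) = 2 ^ Module.finrank ℝ E * μ I := by
    intro w
    rw [show r = 2 * (r / 2) by ring, measure_closedBall_scale μ w (by positivity) (by norm_num),
      ENNReal.ofReal_ofNat, Measure.addHaar_closedBall_center μ w,
      ← Measure.addHaar_closedBall_center μ m]
  have hmeas : Measurable fun z => ‖f z - f x‖ₑ :=
    (hf.continuous.sub continuous_const).enorm.measurable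
  have key : μ I * ‖f x - f y‖ₑ ≤ μ I * (2 ^ Module.finrank ℝ E * (‖x - y‖ₑ * (Mx + My))) := by
    calc μ I * ‖f x - f y‖ₑ = ∫⁻ z in I, ‖f x - f y‖ₑ ∂μ := by simp [mul_comm]
      _ ≤ ∫⁻ z in I, (‖f z - f x‖ₑ + ‖f z - f y‖ₑ) ∂μ := by
          refine lintegral_mono fun z => ?_
          have : f x - f y = (f z - f y) - (f z - f x) := by abel
          rw [this, add_comm]
          exact enorm_sub_le
      _ = ∫⁻ z in I, ‖f z - f x‖ₑ ∂μ + ∫⁻ z in I, ‖f z - f y‖ₑ ∂μ := lintegral_add_left hmeas _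
      _ ≤ ENNReal.ofReal r * (Mx * μ (Metric.closedBall x r)) +
          ENNReal.ofReal r * (My * μ (Metric.closedBall y r)) :=
          add_le_add
            ((lintegral_mono_set hIx).trans (setLIntegral_enorm_sub_le μ hf hr0 hx))
            ((lintegral_mono_set hIy).trans (setLIntegral_enorm_sub_le μ hf hr0 hy))
      _ = _ := by
          rw [hvol, hvol, hr, ofReal_norm]
          ring
  exact (ENNReal.mul_le_mul_iff_right hI0 hIt).1 key

end Averages

/-! ### Mollification and averages over balls -/

section Mollify

variable {E : Type*} [NormedAddCommGroup E] [NormedSpace ℝ E] [FiniteDimensional ℝ E]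
  [MeasurableSpace E] [BorelSpace E] (μ : Measure E) [μ.IsAddHaarMeasure]
  {F : Type*} [NormedAddCommGroup F] [NormedSpace ℝ F]

/-- Convolution with a normalized bump function. -/
noncomputable def mollify (φ : ContDiffBump (0 : E)) (f : E → F) (x : E) : F :=
  ∫ y, φ.normed μ (x - y) • f y ∂μ

lemma mollify_eq_convolution (φ : ContDiffBump (0 : E)) (f : E → F) :
    mollify μ φ f = convolution (φ.normed μ) f (ContinuousLinearMap.lsmul ℝ ℝ) μ := by
  ext x
  rw [convolution_eq_swap]
  rfl

lemma normed_eq_zero_of_lt {φ : ContDiffBump (0 : E)} {x y : E} (h : φ.rOut < dist x y) :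
    φ.normed μ (x - y) = 0 := by
  have : x - y ∉ Function.support (φ.normed μ) := by
    rw [φ.support_normed_eq]
    simp only [Metric.mem_ball, dist_zero_right, not_lt, ← dist_eq_norm]
    exact h.le
  simpa using this

lemma lintegral_enorm_normed (φ : ContDiffBump (0 : E)) :
    ∫⁻ x, ‖φ.normed μ x‖ₑ ∂μ = 1 := by
  have h := φ.integral_normed (μ := μ)
  rw [← ofReal_integral_norm_eq_lintegral_enorm φ.integrable_normed]
  simp only [Real.norm_of_nonneg (φ.nonneg_normed _), h, ENNReal.ofReal_one]

/-- By Tonelli the kernel is integrated first, and only points of B(x, s + rOut) contribute. Its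
integral over B(x, s) is at most 1, used if s ≥ rIn, and at most |B(s)|/|B(rIn)|, used if s ≤ rIn.
Since rOut = 2 rIn, the enlarged radius is at most 3 max(s, rIn), so the factor 3^d does not depend
on the scale of the mollifier. -/
lemma setLIntegral_enorm_mollify_le [CompleteSpace F] [MeasurableSpace F] [OpensMeasurableSpace F]
    {φ : ContDiffBump (0 : E)} (hφ : φ.rOut = 2 * φ.rIn) {G : E → F} (hG : Measurable G)
    {x : E} {s ρ : ℝ} (hs : 0 < s) (hsρ : s + φ.rOut ≤ ρ) {M : ℝ≥0∞}
    (hM : ∀ t, 0 < t → t ≤ ρ →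
      ∫⁻ y in Metric.closedBall x t, ‖G y‖ₑ ∂μ ≤ M * μ (Metric.closedBall x t)) :
    ∫⁻ z in Metric.closedBall x s, ‖mollify μ φ G z‖ₑ ∂μ ≤
      3 ^ Module.finrank ℝ E * M * μ (Metric.closedBall x s) := by
  have hrIn := φ.rIn_pos
  have hcont : Continuous (φ.normed μ) := φ.continuous_normed
  have hb : ∀ t, MeasurableSet (Metric.closedBall x t) :=
    fun t => Metric.isClosed_closedBall.measurableSet
  have hswap : ∫⁻ z in Metric.closedBall x s, ‖mollify μ φ G z‖ₑ ∂μ ≤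
      ∫⁻ w, ‖G w‖ₑ * ∫⁻ z in Metric.closedBall x s, ‖φ.normed μ (z - w)‖ₑ ∂μ ∂μ := by
    calc ∫⁻ z in Metric.closedBall x s, ‖mollify μ φ G z‖ₑ ∂μ
        ≤ ∫⁻ z in Metric.closedBall x s, ∫⁻ w, ‖G w‖ₑ * ‖φ.normed μ (z - w)‖ₑ ∂μ ∂μ := by
          refine lintegral_mono fun z => (enorm_integral_le_lintegral_enorm _).trans ?_
          refine lintegral_mono fun w => ?_
          rw [enorm_smul, mul_comm]
      _ = ∫⁻ w, ∫⁻ z in Metric.closedBall x s, ‖G w‖ₑ * ‖φ.normed μ (z - w)‖ₑ ∂μ ∂μ := by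
          rw [lintegral_lintegral_swap]
          refine Measurable.aemeasurable (Measurable.mul (hG.enorm.comp measurable_snd) ?_)
          exact (hcont.comp (continuous_fst.sub continuous_snd)).enorm.measurable
      _ = _ := by
          congr 1
          ext w
          rw [lintegral_const_mul' _ _ (by simp)]
  have hk : ∀ κ : ℝ≥0∞, (∀ w, ∫⁻ z in Metric.closedBall x s, ‖φ.normed μ (z - w)‖ₑ ∂μ ≤ κ) →
      κ ≠ ⊤ → ∫⁻ z in Metric.closedBall x s, ‖mollify μ φ G z‖ₑ ∂μ ≤
        κ * (M * μ (Metric.closedBall x (s + φ.rOut))) := by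
    intro κ hκ hκt
    refine hswap.trans ?_
    calc ∫⁻ w, ‖G w‖ₑ * ∫⁻ z in Metric.closedBall x s, ‖φ.normed μ (z - w)‖ₑ ∂μ ∂μ
        ≤ ∫⁻ w, (Metric.closedBall x (s + φ.rOut)).indicator (fun w => κ * ‖G w‖ₑ) w ∂μ := by
          refine lintegral_mono fun w => ?_
          by_cases hw : w ∈ Metric.closedBall x (s + φ.rOut)
          · rw [indicator_of_mem hw, mul_comm]
            exact mul_le_mul' (hκ w) le_rfl
          · rw [indicator_of_notMem hw]
            have : ∫⁻ z in Metric.closedBall x s, ‖φ.normed μ (z - w)‖ₑ ∂μ = 0 := by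
              rw [← lintegral_zero (μ := μ.restrict (Metric.closedBall x s))]
              refine setLIntegral_congr_fun (hb s) fun z hz => ?_
              rw [normed_eq_zero_of_lt, enorm_zero]
              rw [Metric.mem_closedBall] at hz hw
              have := dist_triangle w z x
              rw [dist_comm w z] at this
              linarith
            rw [this, mul_zero]
      _ = κ * ∫⁻ w in Metric.closedBall x (s + φ.rOut), ‖G w‖ₑ ∂μ := by
          rw [lintegral_indicator (hb _), lintegral_const_mul' _ _ hκt]
      _ ≤ _ := mul_le_mul' le_rfl (hM _ (by linarith [φ.rOut_pos]) hsρ)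
  rcases le_total φ.rIn s with h | h
  · refine (hk 1 (fun w => ?_) ENNReal.one_ne_top).trans ?_
    · refine (setLIntegral_le_lintegral _ _).trans ?_
      rw [lintegral_sub_right_eq_self (fun z => ‖φ.normed μ z‖ₑ) w, lintegral_enorm_normed]
    · calc 1 * (M * μ (Metric.closedBall x (s + φ.rOut)))
          ≤ 1 * (M * μ (Metric.closedBall x (3 * s))) := by
            gcongr
            linarith
        _ = _ := by
            rw [measure_closedBall_scale μ x hs.le (by norm_num), ENNReal.ofReal_ofNat]
            ring
  · have h0 : μ (Metric.closedBall x φ.rIn) ≠ 0 := measure_closedBall_pos' μ x hrIn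
    have ht : μ (Metric.closedBall x φ.rIn) ≠ ⊤ := measure_closedBall_ne_top μ x _
    refine (hk ((μ (Metric.closedBall x φ.rIn))⁻¹ * μ (Metric.closedBall x s)) (fun w => ?_)
      (ENNReal.mul_ne_top (ENNReal.inv_ne_top.2 h0) (measure_closedBall_ne_top μ x s))).trans ?_
    · calc ∫⁻ z in Metric.closedBall x s, ‖φ.normed μ (z - w)‖ₑ ∂μ
          ≤ ∫⁻ z in Metric.closedBall x s, (μ (Metric.closedBall x φ.rIn))⁻¹ ∂μ := by
            refine lintegral_mono fun z => ?_
            have h1 := φ.normed_le_div_measure_closedBall_rIn μ (z - w)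
            rw [← ofReal_norm, Real.norm_of_nonneg (φ.nonneg_normed _)]
            refine (ENNReal.ofReal_le_ofReal h1).trans (le_of_eq ?_)
            rw [Measure.real, ← Measure.addHaar_closedBall_center μ x φ.rIn, one_div,
              ENNReal.ofReal_inv_of_pos (ENNReal.toReal_pos h0 ht), ENNReal.ofReal_toReal ht]
        _ = _ := by simp
    · calc (μ (Metric.closedBall x φ.rIn))⁻¹ * μ (Metric.closedBall x s) *
            (M * μ (Metric.closedBall x (s + φ.rOut)))
          ≤ (μ (Metric.closedBall x φ.rIn))⁻¹ * μ (Metric.closedBall x s) *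
            (M * μ (Metric.closedBall x (3 * φ.rIn))) := by
            gcongr
            linarith
        _ = (μ (Metric.closedBall x φ.rIn))⁻¹ * μ (Metric.closedBall x φ.rIn) *
            (3 ^ Module.finrank ℝ E * M * μ (Metric.closedBall x s)) := by
            rw [measure_closedBall_scale μ x hrIn.le (by norm_num), ENNReal.ofReal_ofNat]
            ring
        _ = _ := by rw [ENNReal.inv_mul_cancel h0 ht, one_mul]

end Mollify

/-! ### A standard sequence of mollifiers -/

section Mollify

variable {E : Type*} [NormedAddCommGroup E] [NormedSpace ℝ E] [FiniteDimensional ℝ E]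
  [MeasurableSpace E] [BorelSpace E] (μ : Measure E) [μ.IsAddHaarMeasure]
  {F : Type*} [NormedAddCommGroup F] [NormedSpace ℝ F]

/-- Bump functions of radii `1 / (2 (n + 1))` and `1 / (n + 1)`. -/
noncomputable def stdBump (E : Type*) [NormedAddCommGroup E] (n : ℕ) : ContDiffBump (0 : E) where
  rIn := 1 / (2 * (n + 1))
  rOut := 1 / (n + 1)
  rIn_pos := by positivity
  rIn_lt_rOut := by
    apply one_div_lt_one_div_of_lt <;> nlinarith [Nat.cast_nonneg (α := ℝ) n]

lemma stdBump_rOut_eq (n : ℕ) : (stdBump E n).rOut = 2 * (stdBump E n).rIn := by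
  simp only [stdBump]
  field_simp

lemma stdBump_rOut_le_one (n : ℕ) : (stdBump E n).rOut ≤ 1 := by
  simp only [stdBump]
  rw [div_le_one (by positivity)]
  linarith [Nat.cast_nonneg (α := ℝ) n]

lemma tendsto_stdBump_rOut : Tendsto (fun n => (stdBump E n).rOut) atTop (𝓝 0) :=
  tendsto_one_div_add_atTop_nhds_zero_nat

lemma ae_tendsto_mollify_stdBump [CompleteSpace F] {f : E → F} (hf : LocallyIntegrable f μ) :
    ∀ᵐ x ∂μ, Tendsto (fun n => mollify μ (stdBump E n) f x) atTop (𝓝 (f x)) := by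
  simp_rw [mollify_eq_convolution]
  exact ContDiffBump.ae_convolution_tendsto_right_of_locallyIntegrable (K := 2)
    tendsto_stdBump_rOut (Eventually.of_forall fun n => (stdBump_rOut_eq n).le) hf

lemma enorm_mollify_le {φ : ContDiffBump (0 : E)} {f : E → F} {x : E} {B : ℝ≥0∞}
    (hB : ∀ᵐ y ∂μ, dist y x ≤ φ.rOut → ‖f y‖ₑ ≤ B) : ‖mollify μ φ f x‖ₑ ≤ B := by
  have hcont : Continuous (φ.normed μ) := φ.continuous_normed
  calc ‖mollify μ φ f x‖ₑ ≤ ∫⁻ y, ‖φ.normed μ (x - y) • f y‖ₑ ∂μ :=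
        enorm_integral_le_lintegral_enorm _
    _ ≤ ∫⁻ y, ‖φ.normed μ (x - y)‖ₑ * B ∂μ := by
        refine lintegral_mono_ae (hB.mono fun y hy => ?_)
        rw [enorm_smul]
        rcases le_or_gt (dist y x) φ.rOut with h | h
        · exact mul_le_mul' le_rfl (hy h)
        · rw [normed_eq_zero_of_lt μ (by rwa [dist_comm])]
          simp
    _ = B := by
        rw [lintegral_mul_const, lintegral_sub_left_eq_self (fun z => ‖φ.normed μ z‖ₑ) x,
          lintegral_enorm_normed, one_mul]
        exact (hcont.comp (continuous_const.sub continuous_id)).enorm.measurable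

lemma measurable_mollify [CompleteSpace F] [MeasurableSpace F] [BorelSpace F]
    [SecondCountableTopology F] {α : Type*} [MeasurableSpace α]
    (φ : ContDiffBump (0 : E)) {f : α → E → F} (hf : Measurable (Function.uncurry f)) :
    Measurable fun p : α × E => mollify μ φ (f p.1) p.2 := by
  have hcont : Continuous (φ.normed μ) := φ.continuous_normed
  have h1 : StronglyMeasurable fun q : (α × E) × E =>
      φ.normed μ (q.1.2 - q.2) • f q.1.1 q.2 := by
    refine Measurable.stronglyMeasurable (Measurable.smul ?_ ?_)
    · exact hcont.measurable.comp (by fun_prop)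
    · exact hf.comp (by fun_prop : Measurable fun q : (α × E) × E => (q.1.1, q.2))
  exact (StronglyMeasurable.integral_prod_right' h1).measurable

lemma integrable_normed_smul {φ : ContDiffBump (0 : E)} {f : E → F} (hf : LocallyIntegrable f μ)
    (x : E) : Integrable (fun y => φ.normed μ (x - y) • f y) μ := by
  have hcont : Continuous fun y => φ.normed μ (x - y) :=
    φ.continuous_normed.comp (continuous_const.sub continuous_id)
  refine hf.integrable_smul_left_of_hasCompactSupport hcont ?_
  exact φ.hasCompactSupport_normed.comp_homeomorph (Homeomorph.subLeft x)

lemma contDiff_mollify [CompleteSpace F] (φ : ContDiffBump (0 : E)) {f : E → F}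
    (hf : LocallyIntegrable f μ) : ContDiff ℝ 1 (mollify μ φ f) := by
  rw [mollify_eq_convolution]
  exact φ.hasCompactSupport_normed.contDiff_convolution_left _ φ.contDiff_normed hf

lemma hasFDerivAt_normed_sub (φ : ContDiffBump (0 : E)) (x y : E) :
    HasFDerivAt (fun y => φ.normed μ (x - y)) (-fderiv ℝ (φ.normed μ) (x - y)) y := by
  have h1 : HasFDerivAt (φ.normed μ) (fderiv ℝ (φ.normed μ) (x - y)) (x - y) :=
    ((φ.contDiff_normed (n := 1)).differentiable one_ne_zero _).hasFDerivAt
  have h2 : HasFDerivAt (fun y : E => x - y) (-ContinuousLinearMap.id ℝ E) y :=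
    (hasFDerivAt_id y).const_sub x
  have h3 := h1.comp y h2
  simpa [Function.comp_def] using h3

end Mollify

/-! ### Weak gradients and the Lusin–Lipschitz inequality -/

section WeakGradient

variable {d : ℕ} {f : EuclideanSpace ℝ (Fin d) → EuclideanSpace ℝ (Fin d)}
    {G : EuclideanSpace ℝ (Fin d) → (EuclideanSpace ℝ (Fin d) →L[ℝ] EuclideanSpace ℝ (Fin d))}

/-- The test function is y ↦ φ(x - y), whose derivative contributes a sign cancelling that of
integration by parts. The right-hand side is the derivative of the mollified f, whence ∇(f * φ) = G
* φ. -/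
lemma IsWeakGradient.mollify_apply (h : IsWeakGradient f G)
    (φ : ContDiffBump (0 : EuclideanSpace ℝ (Fin d))) (x v : EuclideanSpace ℝ (Fin d)) :
    mollify volume φ G x v = ∫ y, (fderiv ℝ (φ.normed volume) (x - y) v) • f y := by
  have hsm : ContDiff ℝ ∞ fun y => φ.normed volume (x - y) :=
    φ.contDiff_normed.comp (contDiff_const.sub contDiff_id)
  have hcs : HasCompactSupport fun y => φ.normed volume (x - y) :=
    φ.hasCompactSupport_normed.comp_homeomorph (Homeomorph.subLeft x)
  have h1 := h.integral_by_parts _ hsm hcs v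
  simp_rw [(hasFDerivAt_normed_sub volume φ x _).fderiv, ContinuousLinearMap.neg_apply, neg_smul]
    at h1
  rw [integral_neg, neg_inj] at h1
  rw [h1, mollify, ContinuousLinearMap.integral_apply
    (integrable_normed_smul volume h.locallyIntegrable_grad x)]
  rfl

lemma IsWeakGradient.hasFDerivAt_mollify (h : IsWeakGradient f G)
    (φ : ContDiffBump (0 : EuclideanSpace ℝ (Fin d))) (x : EuclideanSpace ℝ (Fin d)) :
    HasFDerivAt (mollify volume φ f) (mollify volume φ G x) x := by
  have h1 := φ.hasCompactSupport_normed.hasFDerivAt_convolution_left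
    (ContinuousLinearMap.lsmul ℝ ℝ) (φ.contDiff_normed (μ := volume)) h.locallyIntegrable x
  have h2 := (φ.hasCompactSupport_normed (μ := volume)).fderiv ℝ
  have h3 : Continuous (fderiv ℝ (φ.normed volume)) :=
    (φ.contDiff_normed (n := 1)).continuous_fderiv one_ne_zero
  have e : mollify volume φ G x = convolution (fderiv ℝ (φ.normed volume)) f
      (ContinuousLinearMap.precompL (EuclideanSpace ℝ (Fin d)) (ContinuousLinearMap.lsmul ℝ ℝ))
      volume x := by
    ext1 v
    rw [h.mollify_apply φ x v, convolution_eq_swap, ContinuousLinearMap.integral_apply]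
    · rfl
    · exact ((h2.convolutionExists_left _ h3 h.locallyIntegrable) x).integrable_swap
  rw [mollify_eq_convolution volume φ f, e]
  exact h1

lemma IsWeakGradient.enorm_mollify_sub_le (h : IsWeakGradient f G) (hG : Measurable G)
    {φ : ContDiffBump (0 : EuclideanSpace ℝ (Fin d))} (hφ : φ.rOut = 2 * φ.rIn)
    {x y : EuclideanSpace ℝ (Fin d)} {ρ : ℝ} (hρ : ‖x - y‖ + φ.rOut ≤ ρ) :
    ‖mollify volume φ f x - mollify volume φ f y‖ₑ ≤ ‖x - y‖ₑ *
      (12 ^ d * dyadicMaximal volume ρ (fun z => ‖G z‖ₑ) x +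
        12 ^ d * dyadicMaximal volume ρ (fun z => ‖G z‖ₑ) y) := by
  have hfd : fderiv ℝ (mollify volume φ f) = mollify volume φ G :=
    funext fun x => (h.hasFDerivAt_mollify φ x).fderiv
  have hM : ∀ w : EuclideanSpace ℝ (Fin d), ∀ t, 0 < t → t ≤ ‖x - y‖ →
      ∫⁻ z in Metric.closedBall w t, ‖fderiv ℝ (mollify volume φ f) z‖ₑ ≤
        3 ^ d * (2 ^ d * dyadicMaximal volume ρ (fun z => ‖G z‖ₑ) w) *
          volume (Metric.closedBall w t) := by
    intro w t ht htr
    rw [hfd]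
    have := setLIntegral_enorm_mollify_le volume hφ hG (x := w) ht (ρ := ρ) (by linarith)
      (fun s hs hsρ => setLIntegral_closedBall_le_dyadicMaximal volume hs hsρ (fun z => ‖G z‖ₑ) w)
    simpa only [finrank_euclideanSpace_fin] using this
  refine (enorm_sub_le_of_averages volume (contDiff_mollify volume φ h.locallyIntegrable)
    (hM x) (hM y)).trans (le_of_eq ?_)
  -- The three factors are the midpoint ball (2^d), the mollification (3^d) and the restriction to
  -- dyadic radii (2^d).
  have h12 : (12 : ℝ≥0∞) ^ d = 2 ^ d * 3 ^ d * 2 ^ d := by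
    rw [← mul_pow, ← mul_pow]
    norm_num
  rw [finrank_euclideanSpace_fin, h12]
  ring

/-- The constants in the mollified estimate do not depend on the bump, so it passes to the limit
wherever the mollifications converge. The strict inequality leaves room for the radius of the bump.
-/
lemma IsWeakGradient.enorm_sub_le (h : IsWeakGradient f G) (hG : Measurable G)
    {x y : EuclideanSpace ℝ (Fin d)} {ρ : ℝ} (hρ : ‖x - y‖ < ρ)
    (hx : Tendsto (fun n => mollify volume (stdBump _ n) f x) atTop (𝓝 (f x)))
    (hy : Tendsto (fun n => mollify volume (stdBump _ n) f y) atTop (𝓝 (f y))) :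
    ‖f x - f y‖ₑ ≤ ‖x - y‖ₑ *
      (12 ^ d * dyadicMaximal volume ρ (fun z => ‖G z‖ₑ) x +
        12 ^ d * dyadicMaximal volume ρ (fun z => ‖G z‖ₑ) y) := by
  refine le_of_tendsto (hx.sub hy).enorm ?_
  have h1 : ∀ᶠ n in atTop, (stdBump (EuclideanSpace ℝ (Fin d)) n).rOut < ρ - ‖x - y‖ :=
    tendsto_stdBump_rOut.eventually_lt_const (by linarith)
  filter_upwards [h1] with n hn
  exact h.enorm_mollify_sub_le hG (stdBump_rOut_eq n) (by linarith)

/-- Putting the derivative on the kernel bounds the gradient of the mollified field by the size of f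
alone. A growth bound uniform in time thus yields a Lipschitz bound uniform in time, although G is
only integrable. -/
lemma IsWeakGradient.norm_mollify_grad_le (h : IsWeakGradient f G)
    (φ : ContDiffBump (0 : EuclideanSpace ℝ (Fin d))) {x : EuclideanSpace ℝ (Fin d)} {B : ℝ}
    (hB : ∀ y, dist y x ≤ φ.rOut → ‖f y‖ ≤ B) :
    ‖mollify volume φ G x‖ ≤ (∫ z, ‖fderiv ℝ (φ.normed volume) z‖) * B := by
  have hB0 : 0 ≤ B := (norm_nonneg _).trans (hB x (by simpa using φ.rOut_pos.le))
  have h3 : Continuous (fderiv ℝ (φ.normed volume)) :=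
    (φ.contDiff_normed (n := 1)).continuous_fderiv one_ne_zero
  have hint : Integrable (fun z => ‖fderiv ℝ (φ.normed volume) z‖) :=
    (h3.integrable_of_hasCompactSupport ((φ.hasCompactSupport_normed (μ := volume)).fderiv ℝ)).norm
  refine ContinuousLinearMap.opNorm_le_bound _ (by positivity) fun v => ?_
  rw [h.mollify_apply φ x v]
  calc ‖∫ y, (fderiv ℝ (φ.normed volume) (x - y) v) • f y‖
      ≤ ∫ y, ‖fderiv ℝ (φ.normed volume) (x - y)‖ * (B * ‖v‖) := by
        refine norm_integral_le_of_norm_le ((hint.comp_sub_left x).mul_const _) ?_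
        refine Eventually.of_forall fun y => ?_
        rw [norm_smul]
        rcases le_or_gt (dist y x) φ.rOut with hy | hy
        · calc ‖fderiv ℝ (φ.normed volume) (x - y) v‖ * ‖f y‖
              ≤ (‖fderiv ℝ (φ.normed volume) (x - y)‖ * ‖v‖) * B := by
                gcongr
                · exact ContinuousLinearMap.le_opNorm _ _
                · exact hB y hy
            _ = _ := by ring
        · have h4 : fderiv ℝ (φ.normed volume) (x - y) = 0 := by
            have h5 : x - y ∉ tsupport (φ.normed volume) := by
              rw [φ.tsupport_normed_eq]
              simpa [← dist_eq_norm, dist_comm x y] using hy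
            have h6 := support_fderiv_subset ℝ (f := φ.normed volume)
            by_contra hne
            exact h5 (h6 hne)
          simp [h4]
    _ = _ := by
        rw [integral_mul_const, integral_sub_left_eq_self
          (fun z => ‖fderiv ℝ (φ.normed volume) z‖) volume x]
        ring

lemma divOfGrad_mollify (hG : LocallyIntegrable G volume)
    (φ : ContDiffBump (0 : EuclideanSpace ℝ (Fin d))) (x : EuclideanSpace ℝ (Fin d)) :
    divOfGrad (mollify volume φ G) x = mollify volume φ (divOfGrad G) x := by
  set tr : (EuclideanSpace ℝ (Fin d) →L[ℝ] EuclideanSpace ℝ (Fin d)) →L[ℝ] ℝ :=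
    LinearMap.toContinuousLinearMap ((LinearMap.trace ℝ (EuclideanSpace ℝ (Fin d))).comp
      (ContinuousLinearMap.coeLM ℝ)) with htr
  have h1 := tr.integral_comp_comm (integrable_normed_smul volume (φ := φ) hG x)
  change tr (mollify volume φ G x) = ∫ y, φ.normed volume (x - y) • tr (G y)
  simp_rw [map_smul] at h1
  exact h1.symm

end WeakGradient

/-! ### Borel representatives of the field and the Lusin kernel -/

section RegularField

abbrev Vec (d : ℕ) := EuclideanSpace ℝ (Fin d)

variable {d : ℕ}

lemma IsWeakGradient.congr_ae {f f' : Vec d → Vec d} {G G' : Vec d → (Vec d →L[ℝ] Vec d)}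
    (h : IsWeakGradient f G) (hf : f =ᵐ[volume] f') (hG : G =ᵐ[volume] G') :
    IsWeakGradient f' G' where
  locallyIntegrable := h.locallyIntegrable.congr hf
  locallyIntegrable_grad := h.locallyIntegrable_grad.congr hG
  integral_by_parts φ h1 h2 v := by
    have e1 : ∫ x, (fderiv ℝ φ x v) • f' x = ∫ x, (fderiv ℝ φ x v) • f x :=
      integral_congr_ae (hf.mono fun x hx => by simp only [hx])
    have e2 : ∫ x, φ x • G' x v = ∫ x, φ x • G x v :=
      integral_congr_ae (hG.mono fun x hx => by simp only [hx])
    rw [e1, e2]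
    exact h.integral_by_parts φ h1 h2 v

lemma isWeakGradient_zero : IsWeakGradient (fun _ : Vec d => (0 : Vec d)) (fun _ => 0) where
  locallyIntegrable := locallyIntegrable_const (0 : Vec d)
  locallyIntegrable_grad := locallyIntegrable_const (0 : Vec d →L[ℝ] Vec d)
  integral_by_parts φ _ _ v := by
    simp only [smul_zero, ContinuousLinearMap.zero_apply, integral_zero, neg_zero]

/-- A jointly measurable vector field `b` with a jointly measurable weak gradient `G`, linear growth
and the integrability of the divergence and of `|G| log (2 + |G|)`, all holding at every time. -/
structure IsRegularField (T C : ℝ) (b : ℝ → Vec d → Vec d)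
    (G : ℝ → Vec d → (Vec d →L[ℝ] Vec d)) : Prop where
  measurable : Measurable (Function.uncurry b)
  measurable_grad : Measurable (Function.uncurry G)
  growth : ∀ t x, ‖b t x‖ ≤ C * (1 + ‖x‖)
  isWeakGradient : ∀ t, IsWeakGradient (b t) (G t)
  div_lt_top : ∀ R : ℝ, 0 < R → ∫⁻ t in Icc (0 : ℝ) T,
    eLpNorm (divOfGrad (G t)) ⊤ (volume.restrict (Metric.closedBall 0 R)) < ⊤
  log_lt_top : ∀ R : ℝ, 0 < R → ∫⁻ t in Icc (0 : ℝ) T,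
    ∫⁻ x in Metric.closedBall (0 : Vec d) R,
      ENNReal.ofReal (‖G t x‖ * Real.log (2 + ‖G t x‖)) < ⊤

lemma aestronglyMeasurable_prod_of_closedBall {F : Type*} [NormedAddCommGroup F] {T : ℝ}
    {f : ℝ × Vec d → F} (h : ∀ R : ℝ, Integrable f
      ((volume.restrict (Icc (0 : ℝ) T)).prod (volume.restrict (Metric.closedBall 0 R)))) :
    AEStronglyMeasurable f ((volume.restrict (Icc (0 : ℝ) T)).prod volume) := by
  have hU : (⋃ n : ℕ, (univ : Set ℝ) ×ˢ Metric.closedBall (0 : Vec d) n) = univ := by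
    rw [← prod_iUnion, Metric.iUnion_closedBall_nat, univ_prod_univ]
  rw [← Measure.restrict_univ (μ := (volume.restrict (Icc (0 : ℝ) T)).prod volume), ← hU]
  refine AEStronglyMeasurable.iUnion fun n => ?_
  rw [← Measure.prod_restrict, Measure.restrict_univ]
  exact (h n).aestronglyMeasurable

/-- Jointly Borel versions of b and G are set to zero on a null set of bad times, and b also where
its growth bound fails. The remaining arguments may then use every time and every point, with Fubini
available. -/
lemma exists_isRegularField {T : ℝ} {b : ℝ → Vec d → Vec d}
    {G : ℝ → Vec d → (Vec d →L[ℝ] Vec d)} (hb : MemL1W11loc T b G)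
    (hgrowth : MemLp (fun p : ℝ × Vec d => ‖b p.1 p.2‖ / (1 + ‖p.2‖)) ⊤
      ((volume.restrict (Icc (0 : ℝ) T)).prod volume))
    (hdiv : ∀ R : ℝ, 0 < R → ∫⁻ t in Icc (0 : ℝ) T,
      eLpNorm (divOfGrad (G t)) ⊤ (volume.restrict (Metric.closedBall 0 R)) < ⊤)
    (hlog : ∀ R : ℝ, 0 < R → ∫⁻ t in Icc (0 : ℝ) T,
      ∫⁻ x in Metric.closedBall (0 : Vec d) R,
        ENNReal.ofReal (‖G t x‖ * Real.log (2 + ‖G t x‖)) < ⊤) :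
    ∃ (C : ℝ) (b' : ℝ → Vec d → Vec d) (G' : ℝ → Vec d → (Vec d →L[ℝ] Vec d)),
      0 ≤ C ∧ IsRegularField T C b' G' ∧
      ∀ᵐ p ∂((volume.restrict (Icc (0 : ℝ) T)).prod (volume : Measure (Vec d))),
        b p.1 p.2 = b' p.1 p.2 := by
  classical
  set ν := (volume.restrict (Icc (0 : ℝ) T)).prod (volume : Measure (Vec d)) with hν
  have hbm := aestronglyMeasurable_prod_of_closedBall hb.integrable
  have hGm := aestronglyMeasurable_prod_of_closedBall hb.integrable_grad
  set bm := hbm.mk _ with hbm_def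
  set Gm := hGm.mk _ with hGm_def
  have hbmm : Measurable bm := hbm.stronglyMeasurable_mk.measurable
  have hGmm : Measurable Gm := hGm.stronglyMeasurable_mk.measurable
  set C : ℝ := (eLpNorm (fun p : ℝ × Vec d => ‖b p.1 p.2‖ / (1 + ‖p.2‖)) ⊤ ν).toReal with hC
  have hgr : ∀ᵐ p ∂ν, ‖b p.1 p.2‖ ≤ C * (1 + ‖p.2‖) := by
    have h1 := ae_le_eLpNormEssSup (μ := ν)
      (f := fun p : ℝ × Vec d => ‖b p.1 p.2‖ / (1 + ‖p.2‖))
    filter_upwards [h1] with p hp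
    have h2 := ENNReal.toReal_mono (eLpNorm_exponent_top (μ := ν)
      (f := fun p : ℝ × Vec d => ‖b p.1 p.2‖ / (1 + ‖p.2‖)) ▸ hgrowth.2.ne) hp
    have h0 : 0 < 1 + ‖p.2‖ := by positivity
    rw [toReal_enorm, Real.norm_of_nonneg (by positivity), div_le_iff₀ h0] at h2
    rw [hC, eLpNorm_exponent_top]
    exact h2
  have hbeq : ∀ᵐ p ∂ν, b p.1 p.2 = bm p := hbm.ae_eq_mk
  have hGeq : ∀ᵐ p ∂ν, G p.1 p.2 = Gm p := hGm.ae_eq_mk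
  have hgood : ∀ᵐ t ∂(volume.restrict (Icc (0 : ℝ) T)),
      IsWeakGradient (b t) (G t) ∧ (∀ᵐ x, b t x = bm (t, x)) ∧ (∀ᵐ x, G t x = Gm (t, x)) ∧
        ∀ᵐ x, ‖b t x‖ ≤ C * (1 + ‖x‖) := by
    filter_upwards [hb.isWeakGradient, Measure.ae_ae_of_ae_prod hbeq,
      Measure.ae_ae_of_ae_prod hGeq, Measure.ae_ae_of_ae_prod hgr] with t h1 h2 h3 h4
    exact ⟨h1, h2, h3, h4⟩
  -- A measurable null set containing the bad times keeps the modified fields Borel.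
  set S : Set ℝ := toMeasurable (volume.restrict (Icc (0 : ℝ) T))
    {t | ¬ (IsWeakGradient (b t) (G t) ∧ (∀ᵐ x, b t x = bm (t, x)) ∧
      (∀ᵐ x, G t x = Gm (t, x)) ∧ ∀ᵐ x, ‖b t x‖ ≤ C * (1 + ‖x‖))} with hS
  have hSm : MeasurableSet S := measurableSet_toMeasurable _ _
  have hS0 : volume.restrict (Icc (0 : ℝ) T) S = 0 := by
    rw [hS, measure_toMeasurable]
    exact hgood
  have hSn : ∀ t, t ∉ S → IsWeakGradient (b t) (G t) ∧ (∀ᵐ x, b t x = bm (t, x)) ∧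
      (∀ᵐ x, G t x = Gm (t, x)) ∧ ∀ᵐ x, ‖b t x‖ ≤ C * (1 + ‖x‖) := by
    intro t ht
    by_contra hcon
    exact ht (subset_toMeasurable _ _ hcon)
  have hSae : ∀ᵐ t ∂(volume.restrict (Icc (0 : ℝ) T)), t ∉ S := measure_eq_zero_iff_ae_notMem.1 hS0
  set b' : ℝ → Vec d → Vec d := fun t x =>
    if t ∈ S ∨ C * (1 + ‖x‖) < ‖bm (t, x)‖ then 0 else bm (t, x) with hb'
  set G' : ℝ → Vec d → (Vec d →L[ℝ] Vec d) := fun t x => if t ∈ S then 0 else Gm (t, x) with hG'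
  have hC0 : 0 ≤ C := ENNReal.toReal_nonneg
  have hGG' : ∀ t, t ∉ S → G t =ᵐ[volume] G' t := fun t ht => by
    filter_upwards [(hSn t ht).2.2.1] with x hx
    simp [hG', ht, hx]
  refine ⟨C, b', G', hC0, ⟨?_, ?_, ?_, ?_, ?_, ?_⟩, ?_⟩
  · refine Measurable.ite ?_ measurable_const hbmm
    refine MeasurableSet.union (measurable_fst hSm) ?_
    exact measurableSet_lt (by fun_prop) hbmm.norm
  · exact Measurable.ite (measurable_fst hSm) measurable_const hGmm
  · intro t x
    simp only [hb']
    split_ifs with h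
    · simp only [norm_zero]
      positivity
    · push Not at h
      exact h.2
  · intro t
    by_cases ht : t ∈ S
    · have e1 : b' t = fun _ => 0 := by ext1 x; simp [hb', ht]
      have e2 : G' t = fun _ => 0 := by ext1 x; simp [hG', ht]
      rw [e1, e2]
      exact isWeakGradient_zero
    · obtain ⟨h1, h2, h3, h4⟩ := hSn t ht
      refine h1.congr_ae ?_ (hGG' t ht)
      filter_upwards [h2, h4] with x hx hx'
      rw [hx] at hx'
      simp [hb', ht, hx, hx']
  · intro R hR
    refine lt_of_eq_of_lt (lintegral_congr_ae ?_) (hdiv R hR)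
    filter_upwards [hSae] with t ht
    refine eLpNorm_congr_ae (ae_restrict_of_ae ?_)
    filter_upwards [hGG' t ht] with x hx
    simp only [divOfGrad, hx]
  · intro R hR
    refine lt_of_eq_of_lt (lintegral_congr_ae ?_) (hlog R hR)
    filter_upwards [hSae] with t ht
    refine lintegral_congr_ae (ae_restrict_of_ae ?_)
    filter_upwards [hGG' t ht] with x hx
    simp only [hx]
  · have h1 : ∀ᵐ p ∂ν, p.1 ∉ S := Measure.quasiMeasurePreserving_fst.ae hSae
    filter_upwards [h1, hbeq, hgr] with p hp1 hp2 hp3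
    rw [hp2] at hp3
    simp [hb', hp1, hp2, hp3]

/-- A kernel `h` with `|b t x - b t y| ≤ |x - y| (h t x + h t y)` for nearby `x`, `y`. -/
noncomputable def lusinKernel (G : ℝ → Vec d → (Vec d →L[ℝ] Vec d)) (ρ t : ℝ) (x : Vec d) : ℝ≥0∞ :=
  12 ^ d * dyadicMaximal volume ρ (fun z => ‖G t z‖ₑ) x

/-- The space-time points at which the mollifications of `b` converge to `b`. -/
def regularPoints (b : ℝ → Vec d → Vec d) : Set (ℝ × Vec d) :=
  {p | Tendsto (fun n => mollify volume (stdBump (Vec d) n) (b p.1) p.2) atTop (𝓝 (b p.1 p.2))}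

variable {T C : ℝ} {b : ℝ → Vec d → Vec d} {G : ℝ → Vec d → (Vec d →L[ℝ] Vec d)}

lemma IsRegularField.measurable_lusinKernel (h : IsRegularField T C b G) (ρ : ℝ) :
    Measurable fun p : ℝ × Vec d => lusinKernel G ρ p.1 p.2 := by
  have h1 : Measurable fun p : ℝ × Vec d => ‖G p.1 p.2‖ₑ := h.measurable_grad.enorm
  exact (measurable_dyadicMaximal volume h1 ρ).const_mul _

/-- The maximal estimate at each time, integrated over [0,T]. This is the only place where the L log
L hypothesis enters. -/
lemma IsRegularField.lintegral_lusinKernel_lt_top (h : IsRegularField T C b G) {ρ R : ℝ}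
    (hρ : 0 < ρ) (hR : 0 < R) :
    ∫⁻ t in Icc (0 : ℝ) T, ∫⁻ x in Metric.closedBall (0 : Vec d) R, lusinKernel G ρ t x < ⊤ := by
  have hlog := h.log_lt_top (R + ρ) (by linarith)
  refine lt_of_le_of_lt (b := ∫⁻ t in Icc (0 : ℝ) T, 12 ^ d *
    (2 * volume (Metric.closedBall (0 : Vec d) R) + 6 * 4 ^ d *
      ∫⁻ x in Metric.closedBall (0 : Vec d) (R + ρ),
        ENNReal.ofReal (‖G t x‖ * Real.log (2 + ‖G t x‖)))) ?_ ?_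
  · refine lintegral_mono fun t => ?_
    simp only [lusinKernel]
    rw [lintegral_const_mul' _ _ (by simp)]
    refine mul_le_mul' le_rfl ?_
    have hGt : Measurable (G t) := h.measurable_grad.comp measurable_prodMk_left
    simpa only [finrank_euclideanSpace_fin] using
      setLIntegral_closedBall_dyadicMaximal_le volume hρ (R := R) hGt
  · rw [lintegral_const_mul' _ _ (by simp), lintegral_add_left measurable_const,
      lintegral_const_mul' _ _ (ENNReal.mul_ne_top (by simp) (by simp))]
    refine ENNReal.mul_lt_top (by simp) (ENNReal.add_lt_top.2 ⟨?_, ?_⟩)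
    · simp only [lintegral_const, Measure.restrict_apply_univ, Real.volume_Icc]
      exact ENNReal.mul_lt_top (ENNReal.mul_lt_top (by simp) measure_closedBall_lt_top) (by simp)
    · exact ENNReal.mul_lt_top (ENNReal.mul_lt_top (by simp) (by simp)) hlog

lemma IsRegularField.measurableSet_regularPoints (h : IsRegularField T C b G) :
    MeasurableSet (regularPoints b) := by
  have h1 : ∀ n, Measurable fun p : ℝ × Vec d =>
      ‖mollify volume (stdBump (Vec d) n) (b p.1) p.2 - b p.1 p.2‖ := fun n =>
    ((measurable_mollify volume (stdBump (Vec d) n) h.measurable).sub h.measurable).norm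
  have h2 := measurableSet_tendsto (l := atTop) (𝓝 (0 : ℝ)) h1
  convert h2 using 1
  ext p
  exact tendsto_iff_norm_sub_tendsto_zero

lemma IsRegularField.ae_mem_regularPoints (h : IsRegularField T C b G) (t : ℝ) :
    ∀ᵐ x : Vec d, (t, x) ∈ regularPoints b :=
  ae_tendsto_mollify_stdBump volume (h.isWeakGradient t).locallyIntegrable

lemma IsRegularField.enorm_sub_le (h : IsRegularField T C b G) {ρ t : ℝ} {x y : Vec d}
    (hx : (t, x) ∈ regularPoints b) (hy : (t, y) ∈ regularPoints b) (hρ : ‖x - y‖ < ρ) :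
    ‖b t x - b t y‖ₑ ≤ (lusinKernel G ρ t x + lusinKernel G ρ t y) * ‖x - y‖ₑ := by
  rw [mul_comm]
  exact (h.isWeakGradient t).enorm_sub_le (h.measurable_grad.comp measurable_prodMk_left) hρ hx hy

end RegularField

/-! ### A priori bounds and stability for solution curves -/

section Curves

variable {d : ℕ} {T C : ℝ} {b : ℝ → Vec d → Vec d}

/-- Integral solutions of `X' = b_t(X)` on `[0, T]`. -/
def IsSolutionCurve (T : ℝ) (b : ℝ → Vec d → Vec d) (X : ℝ → Vec d) : Prop :=
  IntervalIntegrable (fun s => b s (X s)) volume 0 T ∧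
    ∀ t ∈ Icc (0 : ℝ) T, X t = X 0 + ∫ s in (0 : ℝ)..t, b s (X s)

lemma IsSolutionCurve.intervalIntegrable {X : ℝ → Vec d} (h : IsSolutionCurve T b X) {t : ℝ}
    (ht : t ∈ Icc 0 T) : IntervalIntegrable (fun s => b s (X s)) volume 0 t :=
  h.1.mono_set (by
    rw [uIcc_of_le ht.1, uIcc_of_le (ht.1.trans ht.2)]
    exact Icc_subset_Icc_right ht.2)

lemma IsSolutionCurve.continuousOn {X : ℝ → Vec d} (hT : 0 ≤ T) (h : IsSolutionCurve T b X) :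
    ContinuousOn X (Icc 0 T) := by
  have h1 := intervalIntegral.continuousOn_primitive_interval' h.1 left_mem_uIcc
  rw [uIcc_of_le hT] at h1
  exact (continuousOn_const.add h1).congr h.2

lemma enorm_intervalIntegral_le {F : Type*} [NormedAddCommGroup F] [NormedSpace ℝ F] {f : ℝ → F}
    {s t : ℝ} (hst : s ≤ t) : ‖∫ r in s..t, f r‖ₑ ≤ ∫⁻ r in Ioc s t, ‖f r‖ₑ := by
  rw [intervalIntegral.integral_of_le hst]
  exact enorm_integral_le_lintegral_enorm _

/-- A crude bound by the total variation; its sole purpose is the a priori finiteness that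
Gronwall's inequality demands. -/
lemma IsSolutionCurve.exists_bound {X : ℝ → Vec d} (h : IsSolutionCurve T b X) :
    ∃ M : ℝ≥0, ∀ t ∈ Icc (0 : ℝ) T, ‖X t‖ₑ ≤ M := by
  rcases lt_or_ge T 0 with hT | hT
  · exact ⟨0, fun t ht => absurd (ht.1.trans ht.2) (not_le.2 hT)⟩
  have hfin : ∫⁻ r in Ioc 0 T, ‖b r (X r)‖ₑ ≠ ⊤ :=
    ((intervalIntegrable_iff_integrableOn_Ioc_of_le hT).1 h.1).2.ne
  have hfin' : ‖X 0‖ₑ + ∫⁻ r in Ioc 0 T, ‖b r (X r)‖ₑ ≠ ⊤ :=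
    ENNReal.add_ne_top.2 ⟨by simp, hfin⟩
  refine ⟨(‖X 0‖ₑ + ∫⁻ r in Ioc 0 T, ‖b r (X r)‖ₑ).toNNReal, fun t ht => ?_⟩
  rw [ENNReal.coe_toNNReal hfin', h.2 t ht]
  refine (enorm_add_le _ _).trans (add_le_add le_rfl ?_)
  exact (enorm_intervalIntegral_le ht.1).trans (lintegral_mono_set (Ioc_subset_Ioc_right ht.2))

lemma IsSolutionCurve.norm_le {X : ℝ → Vec d} (hC : 0 ≤ C)
    (hgrowth : ∀ t x, ‖b t x‖ ≤ C * (1 + ‖x‖)) (h : IsSolutionCurve T b X) {t : ℝ}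
    (ht : t ∈ Icc 0 T) : 1 + ‖X t‖ ≤ (1 + ‖X 0‖) * Real.exp (2 * (C * T)) := by
  obtain ⟨M, hM⟩ := h.exists_bound
  have hT : 0 ≤ T := ht.1.trans ht.2
  have e : ∀ v : Vec d, ENNReal.ofReal (1 + ‖v‖) = 1 + ‖v‖ₑ := fun v => by
    rw [ENNReal.ofReal_add zero_le_one (norm_nonneg _), ENNReal.ofReal_one, ofReal_norm]
  have hk : ∫⁻ _ in Icc 0 T, ENNReal.ofReal C = ENNReal.ofReal (C * T) := by
    simp [ENNReal.ofReal_mul hC]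
  have key := le_mul_exp_of_le_add_setLIntegral (T := T) (u := fun s => ENNReal.ofReal (1 + ‖X s‖))
    (k := fun _ => ENNReal.ofReal C) (a := ENNReal.ofReal (1 + ‖X 0‖)) (M := 1 + M)
    (fun s hs => by rw [e]; exact add_le_add le_rfl (hM s hs))
    (by simp) (by rw [hk]; exact ENNReal.ofReal_ne_top) ?_ t ht
  · rw [hk, ENNReal.toReal_ofReal (by positivity), ← ENNReal.ofReal_mul (by positivity)] at key
    exact (ENNReal.ofReal_le_ofReal_iff (by positivity)).1 key
  · intro s hs
    rw [e, e, h.2 s hs, add_assoc]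
    refine add_le_add le_rfl ((enorm_add_le _ _).trans (add_le_add le_rfl ?_))
    refine (enorm_intervalIntegral_le hs.1).trans (lintegral_mono fun r => ?_)
    rw [← ENNReal.ofReal_mul hC, ← ofReal_norm]
    exact ENNReal.ofReal_le_ofReal (hgrowth _ _)

/-- The radius of a ball containing all solutions issued from the ball of radius `R`. -/
noncomputable def flowRadius (C T R : ℝ) : ℝ := (1 + R) * Real.exp (2 * (C * T))

lemma IsSolutionCurve.norm_le_flowRadius {X : ℝ → Vec d} (hC : 0 ≤ C)
    (hgrowth : ∀ t x, ‖b t x‖ ≤ C * (1 + ‖x‖)) (h : IsSolutionCurve T b X) {R : ℝ}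
    (hR : ‖X 0‖ ≤ R) {t : ℝ} (ht : t ∈ Icc 0 T) : ‖X t‖ ≤ flowRadius C T R := by
  have h1 := h.norm_le hC hgrowth ht
  have h2 : (1 + ‖X 0‖) * Real.exp (2 * (C * T)) ≤ flowRadius C T R := by
    unfold flowRadius
    gcongr
  linarith

lemma IsSolutionCurve.enorm_sub_le {X Z : ℝ → Vec d} (hX : IsSolutionCurve T b X)
    (hZ : IsSolutionCurve T b Z) {k : ℝ → ℝ≥0∞} (hk : ∫⁻ s in Icc 0 T, k s ≠ ⊤)
    (h : ∀ᵐ s ∂(volume.restrict (Icc (0 : ℝ) T)),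
      ‖b s (X s) - b s (Z s)‖ₑ ≤ k s * ‖X s - Z s‖ₑ) :
    ∀ t ∈ Icc (0 : ℝ) T, ‖X t - Z t‖ₑ ≤
      ‖X 0 - Z 0‖ₑ * ENNReal.ofReal (Real.exp (2 * (∫⁻ s in Icc 0 T, k s).toReal)) := by
  obtain ⟨M, hM⟩ := hX.exists_bound
  obtain ⟨N, hN⟩ := hZ.exists_bound
  refine le_mul_exp_of_le_add_setLIntegral (M := M + N)
    (fun t ht => _root_.enorm_sub_le.trans (add_le_add (hM t ht) (hN t ht))) (by simp) hk fun t ht => ?_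
  have e : X t - Z t = (X 0 - Z 0) + ∫ s in (0 : ℝ)..t, (b s (X s) - b s (Z s)) := by
    rw [intervalIntegral.integral_sub (hX.intervalIntegrable ht) (hZ.intervalIntegrable ht),
      hX.2 t ht, hZ.2 t ht]
    abel
  rw [e]
  refine (enorm_add_le _ _).trans (add_le_add le_rfl ?_)
  refine (enorm_intervalIntegral_le ht.1).trans (lintegral_mono_ae ?_)
  exact ae_restrict_of_ae_restrict_of_subset
    (Ioc_subset_Icc_self.trans (Icc_subset_Icc_right ht.2)) h

end Curves

/-! ### Transfer of null sets and integrals along a flow -/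

section Transport

variable {d : ℕ} {T : ℝ} {Y : ℝ → Vec d → Vec d}

/-- Almost every time slice of a null set is null, and so is its preimage under the flow at that
time; Fubini exchanges the quantifiers. Hence almost every trajectory ignores changes of the field
on null sets. -/
lemma ae_ae_comp_of_ae_prod {μ : Measure (Vec d)} [SFinite μ]
    (hY : Measurable (Function.uncurry Y)) (hac : ∀ t ∈ Icc (0 : ℝ) T, μ.map (Y t) ≪ volume) {P : ℝ × Vec d → Prop}
    (hP : ∀ᵐ p ∂((volume.restrict (Icc (0 : ℝ) T)).prod volume), P p) :
    ∀ᵐ x ∂μ, ∀ᵐ s ∂(volume.restrict (Icc (0 : ℝ) T)), P (s, Y s x) := by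
  set N := toMeasurable ((volume.restrict (Icc (0 : ℝ) T)).prod (volume : Measure (Vec d)))
    {p | ¬ P p} with hN
  have hNm : MeasurableSet N := measurableSet_toMeasurable _ _
  have hN0 : ((volume.restrict (Icc (0 : ℝ) T)).prod (volume : Measure (Vec d))) N = 0 := by
    rw [hN, measure_toMeasurable]
    exact hP
  have hYt : ∀ t, Measurable (Y t) := fun t => hY.comp measurable_prodMk_left
  have h1 : ∀ᵐ s ∂(volume.restrict (Icc (0 : ℝ) T)), ∀ᵐ x ∂μ, (s, Y s x) ∉ N := by
    filter_upwards [Measure.measure_ae_null_of_prod_null hN0, ae_restrict_mem measurableSet_Icc]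
      with s hs hsI
    have h2 := hac s hsI hs
    rw [Measure.map_apply (hYt s) (measurable_prodMk_left hNm)] at h2
    exact measure_eq_zero_iff_ae_notMem.1 h2
  have hm : MeasurableSet {p : ℝ × Vec d | (p.1, Y p.1 p.2) ∉ N} :=
    (measurable_fst.prodMk hY : Measurable fun p : ℝ × Vec d => (p.1, Y p.1 p.2)) hNm.compl
  rw [Measure.ae_ae_comm hm] at h1
  filter_upwards [h1] with x hx
  filter_upwards [hx] with s hs
  by_contra hcon
  exact hs (subset_toMeasurable _ _ hcon)

lemma HasLocallyBoundedCompression.absolutelyContinuous (hY : Measurable (Function.uncurry Y))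
    (h : HasLocallyBoundedCompression T Y) {t : ℝ} (ht : t ∈ Icc 0 T) :
    volume.map (Y t) ≪ volume := by
  have hYt : Measurable (Y t) := hY.comp measurable_prodMk_left
  refine Measure.AbsolutelyContinuous.mk fun A hA hA0 => ?_
  rw [Measure.map_apply hYt hA]
  have h1 : ∀ n : ℕ, volume (Y t ⁻¹' A ∩ Metric.closedBall 0 n) = 0 := by
    intro n
    obtain ⟨c, hc⟩ := h n
    have h2 := hc t ht A
    rw [Measure.map_apply hYt hA, Measure.restrict_apply (hYt hA), Measure.smul_apply, hA0,
      smul_zero] at h2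
    exact le_antisymm h2 zero_le
  rw [← inter_univ (Y t ⁻¹' A), ← Metric.iUnion_closedBall_nat 0, inter_iUnion]
  exact measure_iUnion_null h1

/-- Tonelli brings time outside, and at each fixed time the compression bound performs the change of
variables. Space-time integrability thereby becomes integrability along trajectories. -/
lemma lintegral_lintegral_comp_le (hY : Measurable (Function.uncurry Y)) {R R' : ℝ} {c : ℝ≥0∞}
    (hc : ∀ t ∈ Icc (0 : ℝ) T, (volume.restrict (Metric.closedBall (0 : Vec d) R)).map (Y t) ≤
      c • volume)
    (hR : ∀ᵐ x ∂(volume.restrict (Metric.closedBall (0 : Vec d) R)), ∀ t ∈ Icc (0 : ℝ) T,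
      ‖Y t x‖ ≤ R') {f : ℝ × Vec d → ℝ≥0∞} (hf : Measurable f) :
    ∫⁻ x in Metric.closedBall (0 : Vec d) R, ∫⁻ s in Icc 0 T, f (s, Y s x) ≤
      c * ∫⁻ s in Icc 0 T, ∫⁻ y in Metric.closedBall (0 : Vec d) R', f (s, y) := by
  have hYt : ∀ t, Measurable (Y t) := fun t => hY.comp measurable_prodMk_left
  have hb : MeasurableSet (Metric.closedBall (0 : Vec d) R') :=
    Metric.isClosed_closedBall.measurableSet
  rw [lintegral_lintegral_swap]
  · calc ∫⁻ s in Icc 0 T, ∫⁻ x in Metric.closedBall (0 : Vec d) R, f (s, Y s x)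
        ≤ ∫⁻ s in Icc 0 T, c * ∫⁻ y in Metric.closedBall (0 : Vec d) R', f (s, y) := by
          refine setLIntegral_mono' measurableSet_Icc fun s hs => ?_
          have hfs : Measurable fun y => f (s, y) := hf.comp measurable_prodMk_left
          calc ∫⁻ x in Metric.closedBall (0 : Vec d) R, f (s, Y s x)
              = ∫⁻ x in Metric.closedBall (0 : Vec d) R,
                  (Metric.closedBall (0 : Vec d) R').indicator (fun y => f (s, y)) (Y s x) := by
                refine lintegral_congr_ae (hR.mono fun x hx => ?_)
                have : Y s x ∈ Metric.closedBall (0 : Vec d) R' := by simpa using hx s hs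
                simp only [indicator_of_mem this]
            _ = ∫⁻ y, (Metric.closedBall (0 : Vec d) R').indicator (fun y => f (s, y)) y
                  ∂((volume.restrict (Metric.closedBall (0 : Vec d) R)).map (Y s)) := by
                rw [lintegral_map (hfs.indicator hb) (hYt s)]
            _ ≤ ∫⁻ y, (Metric.closedBall (0 : Vec d) R').indicator (fun y => f (s, y)) y
                  ∂(c • (volume : Measure (Vec d))) := lintegral_mono' (hc s hs) le_rfl
            _ = _ := by rw [lintegral_smul_measure, lintegral_indicator hb, smul_eq_mul]
      _ ≤ _ := by
          have hm : Measurable fun s : ℝ => ∫⁻ y in Metric.closedBall (0 : Vec d) R', f (s, y) :=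
            hf.lintegral_prod_right'
          rw [lintegral_const_mul _ hm]
  · have h1 : Measurable fun p : Vec d × ℝ => f (p.2, Y p.2 p.1) :=
      hf.comp (measurable_snd.prodMk (hY.comp measurable_swap))
    exact h1.aemeasurable

end Transport

/-! ### Energy of trajectories, uniqueness and Lipschitz restrictions -/

section Flow

variable {d : ℕ} {T C : ℝ} {b : ℝ → Vec d → Vec d} {G : ℝ → Vec d → (Vec d →L[ℝ] Vec d)}
  {Y Z : ℝ → Vec d → Vec d}

/-- A jointly measurable regular Lagrangian flow with locally bounded compression. -/
structure IsCompressibleFlow (T : ℝ) (b Y : ℝ → Vec d → Vec d) : Prop where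
  measurable : Measurable (Function.uncurry Y)
  solution : ∀ᵐ x : Vec d, Y 0 x = x ∧ IsSolutionCurve T b (fun t => Y t x)
  compression : HasLocallyBoundedCompression T Y

/-- Almost every trajectory is continuous, so measurability on a countable dense set of times passes
to all times, and a function continuous in t and measurable in x is jointly measurable. On the
exceptional null set the flow is replaced by the identity. -/
lemma IsRegularLagrangianFlow.exists_measurable (hT : 0 ≤ T) (h : IsRegularLagrangianFlow T b Y) :
    ∃ Y' : ℝ → Vec d → Vec d, Measurable (Function.uncurry Y') ∧
      ∀ᵐ x : Vec d, ∀ t ∈ Icc (0 : ℝ) T, Y' t x = Y t x := by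
  classical
  have hsol : ∀ᵐ x : Vec d, Y 0 x = x ∧ IsSolutionCurve T b (fun t => Y t x) := by
    filter_upwards [h.integral_solution] with x hx
    have h0 : Y 0 x = x := by simpa using hx.2 0 ⟨le_rfl, hT⟩
    refine ⟨h0, hx.1, fun t ht => ?_⟩
    simp only [h0]
    exact hx.2 t ht
  have : Nonempty (Icc (0 : ℝ) T) := ⟨⟨0, le_rfl, hT⟩⟩
  set q := TopologicalSpace.denseSeq (Icc (0 : ℝ) T) with hq
  have hgood : ∀ᵐ x : Vec d, (IsSolutionCurve T b (fun t => Y t x)) ∧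
      ∀ n, Y (q n) x = (h.aemeasurable (q n) (q n).2).mk _ x := by
    filter_upwards [hsol, ae_all_iff.2 fun n => (h.aemeasurable (q n) (q n).2).ae_eq_mk]
      with x h1 h2
    exact ⟨h1.2, h2⟩
  set S := toMeasurable volume {x : Vec d | ¬ ((IsSolutionCurve T b (fun t => Y t x)) ∧
      ∀ n, Y (q n) x = (h.aemeasurable (q n) (q n).2).mk _ x)} with hS
  have hSm : MeasurableSet S := measurableSet_toMeasurable _ _
  have hS0 : volume S = 0 := by
    rw [hS, measure_toMeasurable]
    exact hgood
  have hSn : ∀ x, x ∉ S → (IsSolutionCurve T b (fun t => Y t x)) ∧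
      ∀ n, Y (q n) x = (h.aemeasurable (q n) (q n).2).mk _ x := by
    intro x hx
    by_contra hcon
    exact hx (subset_toMeasurable _ _ hcon)
  set Y₁ : Icc (0 : ℝ) T → Vec d → Vec d := fun t x => if x ∈ S then x else Y t x with hY₁
  have hcont : ∀ x, Continuous fun t => Y₁ t x := by
    intro x
    by_cases hx : x ∈ S
    · simp only [hY₁, hx, if_true]
      exact continuous_const
    · simp only [hY₁, hx, if_false]
      exact ((hSn x hx).1.continuousOn hT).domRestrict
  have hmq : ∀ n, Measurable (Y₁ (q n)) := by
    intro n
    have : Y₁ (q n) = fun x => if x ∈ S then x else (h.aemeasurable (q n) (q n).2).mk _ x := by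
      ext1 x
      by_cases hx : x ∈ S
      · simp [hY₁, hx]
      · simp [hY₁, hx, (hSn x hx).2 n]
    rw [this]
    exact Measurable.ite hSm measurable_id (h.aemeasurable (q n) (q n).2).measurable_mk
  have hm : ∀ t, Measurable (Y₁ t) := by
    intro t
    obtain ⟨w, hw, hwt⟩ := mem_closure_iff_seq_limit.1
      (TopologicalSpace.denseRange_denseSeq (Icc (0 : ℝ) T) t)
    refine measurable_of_tendsto_metrizable (f := fun k => Y₁ (w k)) (fun k => ?_) ?_
    · obtain ⟨n, hn⟩ := hw k
      rw [← hn]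
      exact hmq n
    · exact tendsto_pi_nhds.2 fun x => ((hcont x).tendsto t).comp hwt
  have hjoint := measurable_uncurry_of_continuous_of_measurable hcont hm
  refine ⟨fun t x => Y₁ (projIcc 0 T hT t) x, ?_, ?_⟩
  · have hproj : Measurable fun p : ℝ × Vec d => (projIcc 0 T hT p.1, p.2) :=
      (continuous_projIcc.measurable.comp measurable_fst).prodMk measurable_snd
    exact hjoint.comp hproj
  · filter_upwards [measure_eq_zero_iff_ae_notMem.1 hS0] with x hx t ht
    simp only [hY₁, hx, if_false, projIcc_of_mem hT ht]

lemma IsSolutionCurve.congr {X X' : ℝ → Vec d} {b' : ℝ → Vec d → Vec d}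
    (hT : 0 ≤ T) (h : IsSolutionCurve T b X) (hX : ∀ t ∈ Icc (0 : ℝ) T, X' t = X t)
    (hb : ∀ᵐ s ∂(volume.restrict (Icc (0 : ℝ) T)), b s (X' s) = b' s (X' s)) :
    IsSolutionCurve T b' X' := by
  have hb1 : ∀ᵐ s ∂(volume.restrict (Icc (0 : ℝ) T)), b s (X s) = b' s (X' s) := by
    filter_upwards [hb, ae_restrict_mem measurableSet_Icc] with s hs hsI
    rw [← hs, hX s hsI]
  have hsub : ∀ t ∈ Icc (0 : ℝ) T, Ioc 0 t ⊆ Icc 0 T := fun t ht =>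
    Ioc_subset_Icc_self.trans (Icc_subset_Icc_right ht.2)
  have hb2 : ∀ t ∈ Icc (0 : ℝ) T, ∀ᵐ s ∂(volume.restrict (uIoc 0 t)), b s (X s) = b' s (X' s) := by
    intro t ht
    rw [uIoc_of_le ht.1]
    exact ae_restrict_of_ae_restrict_of_subset (hsub t ht) hb1
  refine ⟨h.1.congr_ae (hb2 T ⟨hT, le_rfl⟩), fun t ht => ?_⟩
  rw [hX t ht, hX 0 ⟨le_rfl, hT⟩, h.2 t ht, intervalIntegral.integral_congr_ae_restrict (hb2 t ht)]

lemma IsRegularLagrangianFlow.exists_isCompressibleFlow (hT : 0 ≤ T)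
    {b' : ℝ → Vec d → Vec d}
    (hbb' : ∀ᵐ p ∂((volume.restrict (Icc (0 : ℝ) T)).prod (volume : Measure (Vec d))),
      b p.1 p.2 = b' p.1 p.2)
    (h : IsRegularLagrangianFlow T b Y) (hc : HasLocallyBoundedCompression T Y) :
    ∃ Y' : ℝ → Vec d → Vec d, IsCompressibleFlow T b' Y' ∧
      ∀ᵐ x : Vec d, ∀ t ∈ Icc (0 : ℝ) T, Y' t x = Y t x := by
  obtain ⟨Y', hm, heq⟩ := h.exists_measurable hT
  have heqt : ∀ t ∈ Icc (0 : ℝ) T, Y' t =ᵐ[volume] Y t := fun t ht => heq.mono fun x hx => hx t ht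
  have hac : ∀ t ∈ Icc (0 : ℝ) T, volume.map (Y' t) ≪ volume := fun t ht => by
    rw [Measure.map_congr (heqt t ht)]
    exact h.absolutelyContinuous t ht
  refine ⟨Y', ⟨hm, ?_, ?_⟩, heq⟩
  · filter_upwards [heq, h.integral_solution, ae_ae_comp_of_ae_prod hm hac hbb'] with x h1 h2 h3
    have h0 : Y 0 x = x := by simpa using h2.2 0 ⟨le_rfl, hT⟩
    have h4 : IsSolutionCurve T b (fun t => Y t x) :=
      ⟨h2.1, fun t ht => by simp only [h0]; exact h2.2 t ht⟩
    exact ⟨(h1 0 ⟨le_rfl, hT⟩).trans h0, h4.congr hT h1 h3⟩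
  · intro R
    obtain ⟨c, hc⟩ := hc R
    refine ⟨c, fun t ht => ?_⟩
    rw [Measure.map_congr (ae_restrict_of_ae (heqt t ht))]
    exact hc t ht

lemma IsCompressibleFlow.isRegularLagrangianFlow (hT : 0 ≤ T) {b' : ℝ → Vec d → Vec d}
    (hbb' : ∀ᵐ p ∂((volume.restrict (Icc (0 : ℝ) T)).prod (volume : Measure (Vec d))),
      b p.1 p.2 = b' p.1 p.2)
    (h : IsCompressibleFlow T b' Y) : IsRegularLagrangianFlow T b Y where
  aemeasurable t _ := (h.measurable.comp measurable_prodMk_left :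
    Measurable (Y t)).aemeasurable
  absolutelyContinuous t ht := h.compression.absolutelyContinuous h.measurable ht
  integral_solution := by
    filter_upwards [h.solution, ae_ae_comp_of_ae_prod h.measurable
      (fun t ht => h.compression.absolutelyContinuous h.measurable ht) hbb'] with x h1 h2
    have h3 : IsSolutionCurve T b (fun t => Y t x) :=
      h1.2.congr hT (fun t _ => rfl) (h2.mono fun s hs => hs.symm)
    refine ⟨h3.1, fun t ht => ?_⟩
    have h4 := h3.2 t ht
    simp only [h1.1] at h4
    exact h4

/-- The integral of the Lusin kernel along a trajectory. -/
noncomputable def lusinEnergy (G : ℝ → Vec d → (Vec d →L[ℝ] Vec d)) (T ρ : ℝ)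
    (X : ℝ → Vec d) : ℝ≥0∞ :=
  ∫⁻ s in Icc 0 T, lusinKernel G ρ s (X s)

/-- A solution curve with finite Lusin energy which stays in the set of regular points. -/
structure IsGoodCurve (T ρ : ℝ) (b : ℝ → Vec d → Vec d) (G : ℝ → Vec d → (Vec d →L[ℝ] Vec d))
    (X : ℝ → Vec d) : Prop where
  solution : IsSolutionCurve T b X
  regular : ∀ᵐ s ∂(volume.restrict (Icc (0 : ℝ) T)), (s, X s) ∈ regularPoints b
  energy : lusinEnergy G T ρ X ≠ ⊤

lemma IsRegularField.measurable_lusinEnergy (hb : IsRegularField T C b G)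
    (hY : Measurable (Function.uncurry Y)) (ρ : ℝ) :
    Measurable fun x => lusinEnergy G T ρ (fun t => Y t x) := by
  have h0 : Measurable fun p : Vec d × ℝ => (p.2, Y p.2 p.1) :=
    measurable_snd.prodMk (hY.comp measurable_swap)
  have h1 := (hb.measurable_lusinKernel ρ).comp h0
  exact Measurable.lintegral_prod_right' (ν := volume.restrict (Icc 0 T)) h1

lemma IsRegularField.setLIntegral_lusinEnergy_le (hb : IsRegularField T C b G)
    (hY : Measurable (Function.uncurry Y)) {R R' : ℝ} {c : ℝ≥0∞}
    (hc : ∀ t ∈ Icc (0 : ℝ) T, (volume.restrict (Metric.closedBall (0 : Vec d) R)).map (Y t) ≤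
      c • volume)
    (hR : ∀ᵐ x ∂(volume.restrict (Metric.closedBall (0 : Vec d) R)), ∀ t ∈ Icc (0 : ℝ) T,
      ‖Y t x‖ ≤ R') (ρ : ℝ) :
    ∫⁻ x in Metric.closedBall (0 : Vec d) R, lusinEnergy G T ρ (fun t => Y t x) ≤
      c * ∫⁻ s in Icc 0 T, ∫⁻ y in Metric.closedBall (0 : Vec d) R', lusinKernel G ρ s y :=
  lintegral_lintegral_comp_le hY hc hR (hb.measurable_lusinKernel ρ)

lemma IsRegularField.ae_prod_mem_regularPoints (hb : IsRegularField T C b G) :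
    ∀ᵐ p ∂((volume.restrict (Icc (0 : ℝ) T)).prod (volume : Measure (Vec d))),
      p ∈ regularPoints b :=
  (Measure.ae_prod_mem_iff_ae_ae_mem hb.measurableSet_regularPoints).2
    (Eventually.of_forall hb.ae_mem_regularPoints)

lemma IsCompressibleFlow.ae_norm_le (hC : 0 ≤ C) (hb : IsRegularField T C b G)
    (hY : IsCompressibleFlow T b Y) (R : ℝ) :
    ∀ᵐ x ∂(volume.restrict (Metric.closedBall (0 : Vec d) R)), ∀ t ∈ Icc (0 : ℝ) T,
      ‖Y t x‖ ≤ flowRadius C T R := by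
  filter_upwards [ae_restrict_of_ae hY.solution,
    ae_restrict_mem Metric.isClosed_closedBall.measurableSet] with x hx hxR t ht
  refine hx.2.norm_le_flowRadius hC hb.growth ?_ ht
  rw [hx.1]
  simpa using hxR

lemma flowRadius_pos {R : ℝ} (hR : 0 < R) : 0 < flowRadius C T R := by
  unfold flowRadius
  positivity

lemma IsCompressibleFlow.setLIntegral_lusinEnergy_lt_top (hC : 0 ≤ C)
    (hb : IsRegularField T C b G) (hY : IsCompressibleFlow T b Y) {ρ R : ℝ} (hρ : 0 < ρ)
    (hR : 0 < R) :
    ∫⁻ x in Metric.closedBall (0 : Vec d) R, lusinEnergy G T ρ (fun t => Y t x) < ⊤ := by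
  obtain ⟨c, hc⟩ := hY.compression R
  refine (hb.setLIntegral_lusinEnergy_le hY.measurable hc (hY.ae_norm_le hC hb R) ρ).trans_lt ?_
  exact ENNReal.mul_lt_top (by simp) (hb.lintegral_lusinKernel_lt_top hρ (flowRadius_pos hR))

lemma ae_of_forall_ae_closedBall {P : Vec d → Prop}
    (h : ∀ n : ℕ, ∀ᵐ x ∂(volume.restrict (Metric.closedBall (0 : Vec d) (n + 1))), P x) :
    ∀ᵐ x : Vec d, P x := by
  have h1 : ∀ᵐ x : Vec d, ∀ n : ℕ, x ∈ Metric.closedBall (0 : Vec d) (n + 1) → P x :=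
    ae_all_iff.2 fun n => (ae_restrict_iff' Metric.isClosed_closedBall.measurableSet).1 (h n)
  filter_upwards [h1] with x hx
  obtain ⟨n, hn⟩ := exists_nat_ge ‖x‖
  exact hx n (by simpa using hn.trans (by linarith))

lemma IsCompressibleFlow.ae_isGoodCurve (hC : 0 ≤ C) (hb : IsRegularField T C b G)
    (hY : IsCompressibleFlow T b Y) {ρ : ℝ} (hρ : 0 < ρ) :
    ∀ᵐ x : Vec d, Y 0 x = x ∧ IsGoodCurve T ρ b G (fun t => Y t x) := by
  have h1 : ∀ᵐ x : Vec d, lusinEnergy G T ρ (fun t => Y t x) ≠ ⊤ := by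
    refine ae_of_forall_ae_closedBall fun n => ?_
    filter_upwards [ae_lt_top (hb.measurable_lusinEnergy hY.measurable ρ)
      (hY.setLIntegral_lusinEnergy_lt_top hC hb hρ (R := n + 1) (by positivity)).ne] with x hx
    exact hx.ne
  filter_upwards [h1, hY.solution, ae_ae_comp_of_ae_prod hY.measurable
    (fun t ht => hY.compression.absolutelyContinuous hY.measurable ht)
    hb.ae_prod_mem_regularPoints] with x h1 h2 h3
  exact ⟨h2.1, h2.2, h3, h1⟩

/-- Both curves stay in the ball of radius `flowRadius C T R`, so simultaneous positions are less
than ρ apart and the Lusin inequality applies at almost every time. Gronwall's kernel is the sum of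
the two Lusin kernels, whose integral is the sum of the energies. -/
lemma IsGoodCurve.enorm_sub_le (hC : 0 ≤ C) (hb : IsRegularField T C b G) {ρ R : ℝ}
    (hρ : 2 * flowRadius C T R < ρ) {X W : ℝ → Vec d} (hX : IsGoodCurve T ρ b G X)
    (hW : IsGoodCurve T ρ b G W) (hX0 : ‖X 0‖ ≤ R) (hW0 : ‖W 0‖ ≤ R) :
    ∀ t ∈ Icc (0 : ℝ) T, ‖X t - W t‖ₑ ≤ ‖X 0 - W 0‖ₑ * ENNReal.ofReal
      (Real.exp (2 * ((lusinEnergy G T ρ X).toReal + (lusinEnergy G T ρ W).toReal))) := by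
  have hadd : ∫⁻ s in Icc 0 T, (lusinKernel G ρ s (X s) + lusinKernel G ρ s (W s)) =
      lusinEnergy G T ρ X + lusinEnergy G T ρ W := by
    have hXm : AEMeasurable X (volume.restrict (Icc 0 T)) := by
      rcases lt_or_ge T 0 with hT | hT
      · simp [Icc_eq_empty (not_le.2 hT)]
      · exact (hX.solution.continuousOn hT).aemeasurable measurableSet_Icc
    exact lintegral_add_left' ((hb.measurable_lusinKernel ρ).comp_aemeasurable
      (aemeasurable_id.prodMk hXm)) _
  have hfin : lusinEnergy G T ρ X + lusinEnergy G T ρ W ≠ ⊤ :=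
    ENNReal.add_ne_top.2 ⟨hX.energy, hW.energy⟩
  have h1 := hX.solution.enorm_sub_le hW.solution
    (k := fun s => lusinKernel G ρ s (X s) + lusinKernel G ρ s (W s)) (by rwa [hadd]) ?_
  · rwa [hadd, ENNReal.toReal_add hX.energy hW.energy] at h1
  · filter_upwards [hX.regular, hW.regular, ae_restrict_mem measurableSet_Icc] with s h1 h2 hs
    refine hb.enorm_sub_le h1 h2 ?_
    have h3 := hX.solution.norm_le_flowRadius hC hb.growth hX0 hs
    have h4 := hW.solution.norm_le_flowRadius hC hb.growth hW0 hs
    linarith [norm_sub_le (X s) (W s)]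

/-- Both trajectories from x have finite energy, so equal initial points make the right-hand side of
the Gronwall estimate vanish. -/
theorem IsCompressibleFlow.unique (hC : 0 ≤ C) (hb : IsRegularField T C b G)
    (hY : IsCompressibleFlow T b Y) (hZ : IsCompressibleFlow T b Z) :
    ∀ᵐ x : Vec d, ∀ t ∈ Icc (0 : ℝ) T, Z t x = Y t x := by
  refine ae_of_forall_ae_closedBall fun n => ?_
  have hρ : 0 < 2 * flowRadius C T (n + 1) + 1 := by
    have := flowRadius_pos (C := C) (T := T) (R := n + 1) (by positivity)
    linarith
  filter_upwards [ae_restrict_of_ae (hY.ae_isGoodCurve hC hb hρ),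
    ae_restrict_of_ae (hZ.ae_isGoodCurve hC hb hρ),
    ae_restrict_mem Metric.isClosed_closedBall.measurableSet] with x h1 h2 hx t ht
  rw [mem_closedBall_zero_iff] at hx
  have h3 := h2.2.enorm_sub_le hC hb (lt_add_one _) h1.2 (by simpa only [h2.1] using hx)
    (by simpa only [h1.1] using hx) t ht
  simp only [h1.1, h2.1, sub_self, enorm_zero, zero_mul, nonpos_iff_eq_zero, enorm_eq_zero] at h3
  exact sub_eq_zero.1 h3

/-- A sublevel set of the energy, minus a null set: Chebyshev controls its complement and Gronwall
the Lipschitz constant. The property P serves to have the set avoid the points where a measurable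
version differs from the original flow. -/
theorem IsCompressibleFlow.exists_lipschitzOnWith (hC : 0 ≤ C) (hb : IsRegularField T C b G)
    (hY : IsCompressibleFlow T b Y) {P : Vec d → Prop} (hP : ∀ᵐ x, P x) {R ε : ℝ}
    (hR : 0 < R) (hε : 0 < ε) :
    ∃ A : Set (Vec d), A ⊆ Metric.closedBall 0 R ∧ MeasurableSet A ∧
      volume (Metric.closedBall 0 R \ A) < ENNReal.ofReal ε ∧ (∀ x ∈ A, P x) ∧
      ∃ K : ℝ≥0, ∀ t ∈ Icc (0 : ℝ) T, LipschitzOnWith K (Y t) A := by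
  set ρ := 2 * flowRadius C T R + 1 with hρdef
  have hρ : 0 < ρ := by
    have := flowRadius_pos (C := C) (T := T) hR
    linarith
  have hball : MeasurableSet (Metric.closedBall (0 : Vec d) R) :=
    Metric.isClosed_closedBall.measurableSet
  set H : Vec d → ℝ≥0∞ := fun x => lusinEnergy G T ρ (fun t => Y t x) with hH
  have hHm : Measurable H := hb.measurable_lusinEnergy hY.measurable ρ
  have hHint : ∫⁻ x in Metric.closedBall (0 : Vec d) R, H x < ⊤ :=
    hY.setLIntegral_lusinEnergy_lt_top hC hb hρ hR
  set Q : Vec d → Prop := fun x => P x ∧ Y 0 x = x ∧ IsGoodCurve T ρ b G (fun t => Y t x)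
  have hQ : ∀ᵐ x, Q x := hP.and (hY.ae_isGoodCurve hC hb hρ)
  set S := toMeasurable volume {x | ¬ Q x} with hS
  have hS0 : volume S = 0 := by
    rw [hS, measure_toMeasurable]
    exact hQ
  obtain ⟨l, hl⟩ : ∃ l : ℝ≥0, (∫⁻ x in Metric.closedBall (0 : Vec d) R, H x) / l <
      ENNReal.ofReal ε := by
    have h0 : ENNReal.ofReal ε ≠ 0 := by simpa using hε
    obtain ⟨l, hl⟩ := ENNReal.lt_iff_exists_nnreal_btwn.1
      (ENNReal.div_lt_top hHint.ne h0)
    refine ⟨l, ?_⟩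
    have hl0 : (l : ℝ≥0∞) ≠ 0 := (zero_le.trans_lt hl.1).ne'
    rw [ENNReal.div_lt_iff (Or.inl h0) (Or.inl ENNReal.ofReal_ne_top)] at hl
    rw [ENNReal.div_lt_iff (Or.inl hl0) (Or.inl ENNReal.coe_ne_top), mul_comm]
    exact hl.1
  -- In `ℝ≥0∞`, division by l = 0 gives ⊤ unless the numerator is 0, so no other case remains.
  have hl0 : (l : ℝ≥0∞) ≠ 0 ∨ ∫⁻ x in Metric.closedBall (0 : Vec d) R, H x = 0 := by
    by_contra! hcon
    rw [hcon.1, ENNReal.div_zero hcon.2] at hl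
    exact not_top_lt hl
  refine ⟨(Metric.closedBall 0 R ∩ {x | H x ≤ l}) \ S, fun x hx => hx.1.1,
    (hball.inter (measurableSet_le hHm measurable_const)).diff (measurableSet_toMeasurable _ _),
    ?_, fun x hx => ?_, ⟨(Real.exp (2 * (l + l))).toNNReal, fun t ht => ?_⟩⟩
  · have hsub : Metric.closedBall 0 R \ ((Metric.closedBall 0 R ∩ {x | H x ≤ l}) \ S) ⊆
        ({x | (l : ℝ≥0∞) < H x} ∩ Metric.closedBall 0 R) ∪ S := by
      intro x hx
      by_cases hxS : x ∈ S
      · exact Or.inr hxS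
      · refine Or.inl ⟨?_, hx.1⟩
        by_contra hcon
        exact hx.2 ⟨⟨hx.1, show H x ≤ l from not_lt.1 hcon⟩, hxS⟩
    refine ((measure_mono hsub).trans (measure_union_le _ _)).trans_lt ?_
    rw [hS0, add_zero, ← Measure.restrict_apply (measurableSet_lt measurable_const hHm)]
    refine lt_of_le_of_lt ?_ hl
    rcases hl0 with hl0 | hl0
    · rw [ENNReal.le_div_iff_mul_le (Or.inl hl0) (Or.inl ENNReal.coe_ne_top), mul_comm]
      refine le_trans (mul_le_mul' le_rfl (measure_mono fun x hx => ?_))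
        (mul_meas_ge_le_lintegral hHm l)
      exact (show (l : ℝ≥0∞) < H x from hx).le
    · rw [hl0, ENNReal.zero_div]
      rw [lintegral_eq_zero_iff hHm] at hl0
      refine le_of_eq (measure_mono_null (fun x hx => ?_) hl0)
      exact (zero_le.trans_lt (show (l : ℝ≥0∞) < H x from hx)).ne'
  · by_contra hcon
    exact hx.2 (subset_toMeasurable _ _ (fun h : Q x => hcon h.1))
  · intro x hx y hy
    have hgood : ∀ z ∈ (Metric.closedBall 0 R ∩ {x | H x ≤ l}) \ S, Q z := fun z hz => by
      by_contra hcon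
      exact hz.2 (subset_toMeasurable _ _ hcon)
    have hx' := hgood x hx
    have hy' := hgood y hy
    have h1 := hx'.2.2.enorm_sub_le hC hb (lt_add_one _) hy'.2.2
      (by simpa only [hx'.2.1, mem_closedBall_zero_iff] using hx.1.1)
      (by simpa only [hy'.2.1, mem_closedBall_zero_iff] using hy.1.1) t ht
    simp only [hx'.2.1, hy'.2.1] at h1
    rw [edist_eq_enorm_sub, edist_eq_enorm_sub, mul_comm]
    refine h1.trans (mul_le_mul' le_rfl ?_)
    rw [← ENNReal.ofReal_coe_nnreal, Real.coe_toNNReal _ (Real.exp_nonneg _)]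
    refine ENNReal.ofReal_le_ofReal (Real.exp_le_exp.2 ?_)
    have h2 : (H x).toReal ≤ l := ENNReal.toReal_le_coe_of_le_coe hx.1.2
    have h3 : (H y).toReal ≤ l := ENNReal.toReal_le_coe_of_le_coe hy.1.2
    simp only [hH] at h2 h3
    linarith

end Flow

/-! ### From Lipschitz pieces to approximate differentiability -/

section ApproxDifferentiability

variable {d : ℕ}

/-- A Lipschitz extension of f from A is differentiable almost everywhere by Rademacher. At a
density point of A in A, points of A near x satisfy the differential estimate, and the complement of
A has density zero. -/
lemma LipschitzOnWith.ae_approxDifferentiableAt {f : Vec d → Vec d} {A : Set (Vec d)}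
    (hA : MeasurableSet A) {K : ℝ≥0} (hf : LipschitzOnWith K f A) :
    ∀ᵐ x ∂(volume.restrict A), ApproxDifferentiableAt f x := by
  obtain ⟨g, hg, hfg⟩ := hf.extend_finite_dimension
  filter_upwards [ae_restrict_mem hA, ae_restrict_of_ae hg.ae_differentiableAt,
    Besicovitch.ae_tendsto_measure_inter_div volume A] with x hxA hgx hdens
  refine ⟨fderiv ℝ g x, fun ε hε => ?_⟩
  have hcompl : Tendsto (fun r => volume (Aᶜ ∩ Metric.closedBall x r) /
      volume (Metric.closedBall x r)) (𝓝[>] 0) (𝓝 0) := by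
    have h1 := ENNReal.Tendsto.sub (tendsto_const_nhds (x := (1 : ℝ≥0∞)) (f := 𝓝[>] (0 : ℝ))) hdens
      (Or.inl ENNReal.one_ne_top)
    rw [tsub_self] at h1
    refine h1.congr' ?_
    filter_upwards [self_mem_nhdsWithin] with r hr
    have hr0 : volume (Metric.closedBall x r) ≠ 0 := measure_closedBall_pos' volume x hr
    have hrt : volume (Metric.closedBall x r) ≠ ⊤ := measure_closedBall_ne_top volume x r
    have h2 : volume (A ∩ Metric.closedBall x r) + volume (Aᶜ ∩ Metric.closedBall x r) =
        volume (Metric.closedBall x r) := by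
      rw [inter_comm, inter_comm Aᶜ, ← diff_eq]
      exact measure_inter_add_diff _ hA
    have h3 : volume (A ∩ Metric.closedBall x r) / volume (Metric.closedBall x r) +
        volume (Aᶜ ∩ Metric.closedBall x r) / volume (Metric.closedBall x r) = 1 := by
      rw [← ENNReal.add_div, h2, ENNReal.div_self hr0 hrt]
    have h4 : volume (A ∩ Metric.closedBall x r) / volume (Metric.closedBall x r) ≠ ⊤ :=
      (ENNReal.div_lt_top (measure_lt_top_of_subset inter_subset_right hrt).ne hr0).ne
    rw [← h3, ENNReal.add_sub_cancel_left h4]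
  have hlit := hgx.hasFDerivAt.isLittleO.def hε
  rw [Metric.eventually_nhds_iff_ball] at hlit
  obtain ⟨δ, hδ, hball⟩ := hlit
  refine tendsto_of_tendsto_of_tendsto_of_le_of_le' tendsto_const_nhds hcompl
    (Eventually.of_forall fun r => zero_le) ?_
  have hr : ∀ᶠ r in 𝓝[>] (0 : ℝ), r < δ := nhdsWithin_le_nhds (Iio_mem_nhds hδ)
  filter_upwards [hr] with r hr
  refine ENNReal.div_le_div_right (measure_mono ?_) _
  intro y hy
  refine ⟨fun hyA => ?_, hy.2⟩
  have h1 := hball y (Metric.closedBall_subset_ball hr hy.2)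
  have h2 := hy.1
  simp only [mem_setOf_eq, hfg hyA, hfg hxA] at h2
  linarith

lemma ae_approxDifferentiableAt_of_lipschitzOnWith {f : Vec d → Vec d}
    (h : ∀ R : ℝ, 0 < R → ∀ ε : ℝ, 0 < ε → ∃ A : Set (Vec d), A ⊆ Metric.closedBall 0 R ∧
      MeasurableSet A ∧ volume (Metric.closedBall 0 R \ A) < ENNReal.ofReal ε ∧
      ∃ K : ℝ≥0, LipschitzOnWith K f A) :
    ∀ᵐ x : Vec d, ApproxDifferentiableAt f x := by
  refine ae_of_forall_ae_closedBall fun n => ?_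
  rw [ae_restrict_iff' Metric.isClosed_closedBall.measurableSet, ae_iff]
  refine le_antisymm (ENNReal.le_of_forall_pos_le_add fun ε hε _ => ?_) zero_le
  obtain ⟨A, hAR, hA, hvol, K, hK⟩ := h (n + 1) (by positivity) ε (by exact_mod_cast hε)
  have h1 := hK.ae_approxDifferentiableAt hA
  rw [ae_restrict_iff' hA, ae_iff] at h1
  rw [ENNReal.ofReal_coe_nnreal] at hvol
  rw [zero_add]
  refine le_trans (measure_mono (t := (Metric.closedBall 0 (n + 1) \ A) ∪
    {x | ¬ (x ∈ A → ApproxDifferentiableAt f x)}) ?_) ((measure_union_le _ _).trans ?_)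
  · intro x hx
    simp only [mem_setOf_eq, Classical.not_imp] at hx
    by_cases hxA : x ∈ A
    · exact Or.inr fun h => hx.2 (h hxA)
    · exact Or.inl ⟨hx.1, hxA⟩
  · rw [h1, add_zero]
    exact hvol.le

end ApproxDifferentiability

/-! ### First-order bounds on determinants and volume compression -/

section Determinant

variable {E : Type*} [NormedAddCommGroup E] [NormedSpace ℝ E] [FiniteDimensional ℝ E]

lemma differentiable_det_one_add :
    Differentiable ℝ fun A : E →L[ℝ] E => LinearMap.det ((1 + A : E →L[ℝ] E) : E →ₗ[ℝ] E) := by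
  classical
  let B := Module.finBasis ℝ E
  have e : ∀ A : E →L[ℝ] E, LinearMap.det ((1 + A : E →L[ℝ] E) : E →ₗ[ℝ] E) =
      ∑ σ : Equiv.Perm (Fin (Module.finrank ℝ E)), ((Equiv.Perm.sign σ : ℤ) : ℝ) *
        ∏ i, B.repr ((1 + A) (B i)) (σ i) := by
    intro A
    rw [← LinearMap.det_toMatrix B, Matrix.det_apply']
    simp [LinearMap.toMatrix_apply]
  have hent : ∀ i j, ContDiff ℝ 1 fun A : E →L[ℝ] E => B.repr ((1 + A) (B i)) j := by
    intro i j
    have h1 : ContDiff ℝ 1 fun A : E →L[ℝ] E => (1 + A) (B i) := by fun_prop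
    exact (LinearMap.toContinuousLinearMap (B.coord j)).contDiff.comp h1
  simp_rw [e]
  refine Differentiable.fun_sum fun σ _ => Differentiable.const_mul ?_ _
  exact (contDiff_prod fun i _ => hent i (σ i)).differentiable one_ne_zero

lemma hasDerivAt_det_one_add_smul (A : E →L[ℝ] E) :
    HasDerivAt (fun r : ℝ => LinearMap.det ((1 + r • A : E →L[ℝ] E) : E →ₗ[ℝ] E))
      (LinearMap.trace ℝ E (A : E →ₗ[ℝ] E)) 0 := by
  classical
  let B := Module.finBasis ℝ E
  set M := LinearMap.toMatrix B B (A : E →ₗ[ℝ] E) with hM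
  have e : ∀ r : ℝ, LinearMap.det ((1 + r • A : E →L[ℝ] E) : E →ₗ[ℝ] E) =
      Matrix.det (1 + r • M) := by
    intro r
    have h1 : ((1 + r • A : E →L[ℝ] E) : E →ₗ[ℝ] E) = LinearMap.id + r • (A : E →ₗ[ℝ] E) := by
      ext x
      simp
    rw [← LinearMap.det_toMatrix B, h1, map_add, map_smul, LinearMap.toMatrix_id]
  rw [LinearMap.trace_eq_matrix_trace ℝ B]
  -- The determinant of 1 + rM is a polynomial 1 + r tr M + r² p(r), so its derivative at 0 is the
  -- trace.
  set p := (Matrix.det (1 + (Polynomial.X : Polynomial ℝ) • M.map Polynomial.C)).divX.divX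
  have e' : (fun r : ℝ => LinearMap.det ((1 + r • A : E →L[ℝ] E) : E →ₗ[ℝ] E)) =
      fun r => 1 + Matrix.trace M * r + p.eval r * r ^ 2 :=
    funext fun r => by rw [e, Matrix.det_one_add_smul]
  rw [e']
  have h2 := (((hasDerivAt_id (0 : ℝ)).const_mul (Matrix.trace M)).const_add 1).fun_add
    ((p.hasDerivAt 0).fun_mul (hasDerivAt_pow 2 (0 : ℝ)))
  simpa using h2

/-- The derivative of det at the identity is the trace, and the remainder is o(|A|). Keeping η free
lets this error be made small against the gradient bound later. -/
lemma exists_det_one_add_ge {η : ℝ} (hη : 0 < η) : ∃ δ > 0, ∀ A : E →L[ℝ] E, ‖A‖ ≤ δ →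
    1 + LinearMap.trace ℝ E (A : E →ₗ[ℝ] E) - η * ‖A‖ ≤
      LinearMap.det ((1 + A : E →L[ℝ] E) : E →ₗ[ℝ] E) := by
  have hd := (differentiable_det_one_add (E := E) 0).hasFDerivAt
  set L := fderiv ℝ (fun A : E →L[ℝ] E => LinearMap.det ((1 + A : E →L[ℝ] E) : E →ₗ[ℝ] E)) 0
  have hL : ∀ A, L A = LinearMap.trace ℝ E (A : E →ₗ[ℝ] E) := by
    intro A
    have h1 : HasDerivAt (fun r : ℝ => r • A) A 0 := by
      simpa using (hasDerivAt_id (0 : ℝ)).smul_const A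
    have hd' : HasFDerivAt (fun A : E →L[ℝ] E =>
        LinearMap.det ((1 + A : E →L[ℝ] E) : E →ₗ[ℝ] E)) L ((0 : ℝ) • A) := by
      rw [zero_smul]
      exact hd
    have h2 : HasDerivAt (fun r : ℝ => LinearMap.det ((1 + r • A : E →L[ℝ] E) : E →ₗ[ℝ] E))
        (L A) 0 := (hd'.comp_hasDerivAt (0 : ℝ) h1 :)
    exact h2.unique (hasDerivAt_det_one_add_smul A)
  have hlit := hd.isLittleO.def hη
  rw [Metric.eventually_nhds_iff_ball] at hlit
  obtain ⟨δ, hδ, hball⟩ := hlit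
  refine ⟨δ / 2, by positivity, fun A hA => ?_⟩
  have h1 := hball A (by
    rw [mem_ball_zero_iff]
    linarith)
  have h0 : LinearMap.det (((1 : E →L[ℝ] E) + 0 : E →L[ℝ] E) : E →ₗ[ℝ] E) = 1 := by
    rw [add_zero]
    exact LinearMap.det_id
  simp only [sub_zero] at h1
  rw [h0, hL, Real.norm_eq_abs, abs_le] at h1
  linarith [h1.1]

/-- The area formula for an injective map: a lower bound on the Jacobian is an upper bound on the
density of the image measure. -/
lemma map_restrict_le_of_det [MeasurableSpace E] [BorelSpace E] (μ : Measure E)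
    [μ.IsAddHaarMeasure] {f : E → E} {f' : E → E →L[ℝ] E} {s : Set E} (hs : MeasurableSet s)
    (hfm : Measurable f) (hf' : ∀ x ∈ s, HasFDerivWithinAt f (f' x) s x) (hinj : InjOn f s)
    {c : ℝ≥0∞} (hdet : ∀ x ∈ s, 1 ≤ c * ENNReal.ofReal |(f' x).det|) (hc : c ≠ ⊤) :
    (μ.restrict s).map f ≤ c • μ := by
  refine Measure.le_iff.2 fun A hA => ?_
  have hm : MeasurableSet (f ⁻¹' A ∩ s) := (hfm hA).inter hs
  rw [Measure.map_apply hfm hA, Measure.restrict_apply (hfm hA), Measure.smul_apply, smul_eq_mul]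
  calc μ (f ⁻¹' A ∩ s) = ∫⁻ _ in f ⁻¹' A ∩ s, 1 ∂μ := by simp
    _ ≤ ∫⁻ x in f ⁻¹' A ∩ s, c * ENNReal.ofReal |(f' x).det| ∂μ :=
        setLIntegral_mono' hm fun x hx => hdet x hx.2
    _ = c * μ (f '' (f ⁻¹' A ∩ s)) := by
        rw [lintegral_const_mul' _ _ hc, lintegral_abs_det_fderiv_eq_addHaar_image μ hm
          (fun x hx => (hf' x hx.2).mono inter_subset_right) (hinj.mono inter_subset_right)]
    _ ≤ c * μ A := by
        gcongr
        rintro _ ⟨x, hx, rfl⟩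
        exact hx.1

end Determinant

/-! ### One Euler step -/

section EulerStep

variable {d : ℕ} {C : ℝ} {v : ℝ → Vec d → Vec d} {V : ℝ → Vec d → (Vec d →L[ℝ] Vec d)}
  {L : ℝ → ℝ} {D : ℝ → ℝ → ℝ≥0∞}

/-- A time-dependent field `v`, differentiable in space with gradient `V`, with linear growth and
gradient and divergence bounds on balls. -/
structure IsC1Field (C : ℝ) (v : ℝ → Vec d → Vec d) (V : ℝ → Vec d → (Vec d →L[ℝ] Vec d))
    (L : ℝ → ℝ) (D : ℝ → ℝ → ℝ≥0∞) : Prop where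
  measurable : Measurable (Function.uncurry v)
  measurable_grad : Measurable (Function.uncurry V)
  growth : ∀ t x, ‖v t x‖ ≤ C * (2 + ‖x‖)
  hasFDerivAt : ∀ t x, HasFDerivAt (v t) (V t x) x
  norm_grad_le : ∀ R t x, ‖x‖ ≤ R → ‖V t x‖ ≤ L R
  div_le : ∀ R t x, ‖x‖ ≤ R → ‖divOfGrad (V t) x‖ₑ ≤ D R t

/-- One step of the Euler scheme with the field averaged in time. -/
noncomputable def eulerStep (v : ℝ → Vec d → Vec d) (s t : ℝ) (x : Vec d) : Vec d :=
  x + ∫ r in Ioc s t, v r x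

variable (hv : IsC1Field C v V L D)
include hv

lemma IsC1Field.integrableOn (s t : ℝ) (x : Vec d) : IntegrableOn (fun r => v r x) (Ioc s t) :=
  Measure.integrableOn_of_bounded (M := C * (2 + ‖x‖)) (by simp)
    (hv.measurable.comp measurable_prodMk_right).aestronglyMeasurable
    (Eventually.of_forall fun r => hv.growth r x)

lemma IsC1Field.integrableOn_grad (s t : ℝ) (x : Vec d) :
    IntegrableOn (fun r => V r x) (Ioc s t) :=
  Measure.integrableOn_of_bounded (M := L ‖x‖) (by simp)
    (hv.measurable_grad.comp measurable_prodMk_right).aestronglyMeasurable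
    (Eventually.of_forall fun r => hv.norm_grad_le _ r x le_rfl)

lemma IsC1Field.measurable_eulerStep (s t : ℝ) : Measurable (eulerStep v s t) := by
  have h1 : StronglyMeasurable fun p : Vec d × ℝ => v p.2 p.1 :=
    (hv.measurable.comp measurable_swap).stronglyMeasurable
  exact measurable_id.add
    (StronglyMeasurable.integral_prod_right' (ν := volume.restrict (Ioc s t)) h1).measurable

lemma IsC1Field.hasFDerivAt_eulerStep (s t : ℝ) (x : Vec d) :
    HasFDerivAt (eulerStep v s t) (1 + ∫ r in Ioc s t, V r x) x := by
  refine (hasFDerivAt_id x).add ?_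
  refine hasFDerivAt_integral_of_dominated_of_fderiv_le (s := Metric.ball x 1)
    (bound := fun _ => L (‖x‖ + 1)) (F' := fun y r => V r y) (Metric.ball_mem_nhds x one_pos)
    (Eventually.of_forall fun y => (hv.integrableOn s t y).aestronglyMeasurable)
    (hv.integrableOn s t x) (hv.integrableOn_grad s t x).aestronglyMeasurable ?_ ?_ ?_
  · refine Eventually.of_forall fun r y hy => hv.norm_grad_le _ r y ?_
    have h1 : ‖y - x‖ < 1 := by simpa [dist_eq_norm] using hy
    linarith [norm_le_norm_add_norm_sub' y x]
  · simp
  · exact Eventually.of_forall fun r y _ => hv.hasFDerivAt r y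

lemma IsC1Field.norm_eulerStep_le {s t : ℝ} (hst : s ≤ t) (x : Vec d) :
    2 + ‖eulerStep v s t x‖ ≤ (2 + ‖x‖) * Real.exp (C * (t - s)) := by
  have h1 : ‖∫ r in Ioc s t, v r x‖ ≤ C * (2 + ‖x‖) * (t - s) := by
    have := norm_setIntegral_le_of_norm_le_const (μ := volume) (s := Ioc s t)
      (f := fun r => v r x) (by simp) fun r _ => hv.growth r x
    simpa [Measure.real, Real.volume_Ioc, ENNReal.toReal_ofReal (sub_nonneg.2 hst)] using this
  have h2 := Real.add_one_le_exp (C * (t - s))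
  have h3 : ‖eulerStep v s t x‖ ≤ ‖x‖ + C * (2 + ‖x‖) * (t - s) :=
    (norm_add_le _ _).trans (by linarith)
  calc 2 + ‖eulerStep v s t x‖ ≤ (2 + ‖x‖) * (C * (t - s) + 1) := by linarith
    _ ≤ _ := by gcongr

/-- On the ball the displacement has Lipschitz constant at most L(t - s) < 1, so it cannot
compensate x - y. -/
lemma IsC1Field.injOn_eulerStep {s t R : ℝ} (hst : s ≤ t) (hL : L R * (t - s) < 1) :
    InjOn (eulerStep v s t) (Metric.closedBall 0 R) := by
  intro x hx y hy hxy
  by_contra hne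
  have hpos : 0 < ‖x - y‖ := norm_pos_iff.2 (sub_ne_zero.2 hne)
  have hlip : ∀ r, ‖v r y - v r x‖ ≤ L R * ‖y - x‖ := fun r =>
    Convex.norm_image_sub_le_of_norm_hasFDerivWithin_le (𝕜 := ℝ) (f' := V r)
      (fun z _ => (hv.hasFDerivAt r z).hasFDerivWithinAt)
      (fun z hz => hv.norm_grad_le R r z (by simpa using hz)) (convex_closedBall 0 R) hx hy
  have h1 : x - y = ∫ r in Ioc s t, (v r y - v r x) := by
    rw [integral_sub (hv.integrableOn s t y) (hv.integrableOn s t x), sub_eq_sub_iff_add_eq_add,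
      add_comm _ y]
    exact hxy
  have h2 : ‖∫ r in Ioc s t, (v r y - v r x)‖ ≤ L R * ‖y - x‖ * (t - s) := by
    have := norm_setIntegral_le_of_norm_le_const (μ := volume) (s := Ioc s t)
      (f := fun r => v r y - v r x) (by simp) fun r _ => hlip r
    simpa [Measure.real, Real.volume_Ioc, ENNReal.toReal_ofReal (sub_nonneg.2 hst)] using this
  rw [← h1, norm_sub_rev y x] at h2
  nlinarith

lemma IsC1Field.norm_integral_grad_le {s t R : ℝ} (hst : s ≤ t) {x : Vec d} (hx : ‖x‖ ≤ R) :
    ‖∫ r in Ioc s t, V r x‖ ≤ L R * (t - s) := by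
  have := norm_setIntegral_le_of_norm_le_const (μ := volume) (s := Ioc s t)
    (f := fun r => V r x) (by simp) fun r _ => hv.norm_grad_le R r x hx
  simpa [Measure.real, Real.volume_Ioc, ENNReal.toReal_ofReal (sub_nonneg.2 hst)] using this

lemma IsC1Field.trace_integral_grad_ge {s t R : ℝ} {x : Vec d} (hx : ‖x‖ ≤ R)
    (hD : ∫⁻ r in Ioc s t, D R r ≠ ⊤) :
    -(∫⁻ r in Ioc s t, D R r).toReal ≤
      LinearMap.trace ℝ (Vec d) ((∫ r in Ioc s t, V r x : Vec d →L[ℝ] Vec d) : Vec d →ₗ[ℝ] Vec d) := by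
  set tr : (Vec d →L[ℝ] Vec d) →L[ℝ] ℝ :=
    LinearMap.toContinuousLinearMap ((LinearMap.trace ℝ (Vec d)).comp
      (ContinuousLinearMap.coeLM ℝ)) with htr
  have h1 := tr.integral_comp_comm (hv.integrableOn_grad s t x)
  change _ ≤ tr (∫ r in Ioc s t, V r x)
  rw [← h1]
  have h2 : ‖∫ r in Ioc s t, tr (V r x)‖ₑ ≤ ∫⁻ r in Ioc s t, D R r :=
    (enorm_integral_le_lintegral_enorm _).trans (lintegral_mono fun r => hv.div_le R r x hx)
  have h3 := ENNReal.toReal_mono hD h2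
  rw [toReal_enorm, Real.norm_eq_abs] at h3
  exact (abs_le.1 h3).1

/-- Volume compression of one Euler step on a ball. -/
lemma IsC1Field.map_eulerStep_le {s t R R₁ η δ : ℝ} (hst : s ≤ t) (hη : 0 ≤ η)
    (hδ : ∀ A : Vec d →L[ℝ] Vec d, ‖A‖ ≤ δ →
      1 + LinearMap.trace ℝ (Vec d) (A : Vec d →ₗ[ℝ] Vec d) - η * ‖A‖ ≤
        LinearMap.det ((1 + A : Vec d →L[ℝ] Vec d) : Vec d →ₗ[ℝ] Vec d))
    (hR : R ≤ R₁) (hL1 : L R₁ * (t - s) < 1) (hLδ : L R₁ * (t - s) ≤ δ)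
    (hLη : η * (L R₁ * (t - s)) ≤ 1 / 4) (hD : ∫⁻ r in Ioc s t, D R r ≤ ENNReal.ofReal (1 / 4)) :
    (volume.restrict (Metric.closedBall 0 R)).map (eulerStep v s t) ≤
      ENNReal.ofReal (Real.exp (2 * ((∫⁻ r in Ioc s t, D R r).toReal + η * (L R₁ * (t - s))))) •
        (volume : Measure (Vec d)) := by
  have hDfin : ∫⁻ r in Ioc s t, D R r ≠ ⊤ := ne_top_of_le_ne_top ENNReal.ofReal_ne_top hD
  have hD' : (∫⁻ r in Ioc s t, D R r).toReal ≤ 1 / 4 :=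
    ENNReal.toReal_le_of_le_ofReal (by norm_num) hD
  have hD0 : 0 ≤ (∫⁻ r in Ioc s t, D R r).toReal := ENNReal.toReal_nonneg
  refine map_restrict_le_of_det volume Metric.isClosed_closedBall.measurableSet
    (hv.measurable_eulerStep s t) (fun x _ => (hv.hasFDerivAt_eulerStep s t x).hasFDerivWithinAt)
    ((hv.injOn_eulerStep hst hL1).mono (Metric.closedBall_subset_closedBall hR)) (fun x hx => ?_)
    ENNReal.ofReal_ne_top
  have hxR : ‖x‖ ≤ R := by simpa using hx
  set A := ∫ r in Ioc s t, V r x with hA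
  have hAn : ‖A‖ ≤ L R₁ * (t - s) := hv.norm_integral_grad_le hst (hxR.trans hR)
  have h1 := hδ A (hAn.trans hLδ)
  have h2 := hv.trace_integral_grad_ge hxR hDfin
  set q := (∫⁻ r in Ioc s t, D R r).toReal
  set p := η * (L R₁ * (t - s))
  have h3 : η * ‖A‖ ≤ p := mul_le_mul_of_nonneg_left hAn hη
  have hp0 : 0 ≤ p := (mul_nonneg hη (norm_nonneg A)).trans h3
  have h4 : 1 - (q + p) ≤ (1 + A : Vec d →L[ℝ] Vec d).det := by
    change _ ≤ LinearMap.det ((1 + A : Vec d →L[ℝ] Vec d) : Vec d →ₗ[ℝ] Vec d)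
    linarith
  have h5 : 1 - (q + p) ≤ |(1 + A : Vec d →L[ℝ] Vec d).det| := h4.trans (le_abs_self _)
  rw [← ENNReal.ofReal_mul (Real.exp_nonneg _), ENNReal.one_le_ofReal]
  -- Since q and p are at most 1/4, their sum σ lies in [0, 1/2], where (1 + 2σ)(1 - σ) = 1 + σ(1 -
  -- 2σ) ≥ 1.
  calc (1 : ℝ) ≤ (2 * (q + p) + 1) * (1 - (q + p)) := by nlinarith
    _ ≤ Real.exp (2 * (q + p)) * |(1 + A : Vec d →L[ℝ] Vec d).det| := by
        gcongr
        · linarith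
        · exact Real.add_one_le_exp _

end EulerStep

/-! ### The Euler scheme and approximate flows of smooth fields -/

section EulerScheme

variable {d : ℕ} {C : ℝ} {v : ℝ → Vec d → Vec d} {V : ℝ → Vec d → (Vec d →L[ℝ] Vec d)}
  {L : ℝ → ℝ} {D : ℝ → ℝ → ℝ≥0∞}

/-- The iterates of the Euler scheme with step `h`. -/
noncomputable def eulerIter (v : ℝ → Vec d → Vec d) (h : ℝ) : ℕ → Vec d → Vec d
  | 0 => id
  | k + 1 => fun x => eulerStep v (k * h) ((k + 1) * h) (eulerIter v h k x)

variable (hv : IsC1Field C v V L D)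
include hv

lemma IsC1Field.measurable_eulerIter (h : ℝ) (k : ℕ) : Measurable (eulerIter v h k) := by
  induction k with
  | zero => exact measurable_id
  | succ k ih => exact (hv.measurable_eulerStep _ _).comp ih

lemma IsC1Field.norm_eulerIter_le {h : ℝ} (hh : 0 ≤ h) (k : ℕ) (x : Vec d) :
    2 + ‖eulerIter v h k x‖ ≤ (2 + ‖x‖) * Real.exp (C * (k * h)) := by
  induction k with
  | zero => simp [eulerIter]
  | succ k ih =>
    refine (hv.norm_eulerStep_le (by nlinarith) _).trans ?_
    calc (2 + ‖eulerIter v h k x‖) * Real.exp (C * ((k + 1) * h - k * h))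
        ≤ (2 + ‖x‖) * Real.exp (C * (k * h)) * Real.exp (C * ((k + 1) * h - k * h)) := by gcongr
      _ = _ := by
        rw [mul_assoc, ← Real.exp_add]
        push_cast
        ring_nf

/-- The radius of a ball containing all Euler polygons issued from the ball of radius `R`. -/
noncomputable def eulerRadius (C T R : ℝ) : ℝ := (2 + R) * Real.exp (C * T)

lemma IsC1Field.eulerIter_mem (hC : 0 ≤ C) {h T R : ℝ} (hh : 0 ≤ h) {k : ℕ} (hk : k * h ≤ T)
    {x : Vec d} (hx : ‖x‖ ≤ R) : ‖eulerIter v h k x‖ ≤ eulerRadius C T R := by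
  have h1 := hv.norm_eulerIter_le hh k x
  have h2 : (2 + ‖x‖) * Real.exp (C * (k * h)) ≤ eulerRadius C T R := by
    unfold eulerRadius
    have : 0 ≤ 2 + R := by linarith [norm_nonneg x]
    gcongr
  linarith

/-- Iterates from B(R) stay in the ball of radius `eulerRadius C T R`, so each step only needs
compression there. The constants multiply, hence the divergence integrals and the errors η L h add
up in the exponent. -/
lemma IsC1Field.map_eulerIter_le (hC : 0 ≤ C) {h T R R₁ η δ : ℝ} (hh : 0 ≤ h)
    (hη : 0 ≤ η)
    (hδ : ∀ A : Vec d →L[ℝ] Vec d, ‖A‖ ≤ δ →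
      1 + LinearMap.trace ℝ (Vec d) (A : Vec d →ₗ[ℝ] Vec d) - η * ‖A‖ ≤
        LinearMap.det ((1 + A : Vec d →L[ℝ] Vec d) : Vec d →ₗ[ℝ] Vec d))
    (hR : eulerRadius C T R ≤ R₁) (hL1 : L R₁ * h < 1) (hLδ : L R₁ * h ≤ δ)
    (hLη : η * (L R₁ * h) ≤ 1 / 4)
    (hD : ∀ k : ℕ, (k + 1) * h ≤ T →
      ∫⁻ r in Ioc (k * h) ((k + 1) * h), D (eulerRadius C T R) r ≤ ENNReal.ofReal (1 / 4))
    (k : ℕ) (hk : k * h ≤ T) :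
    ∫⁻ r in Ioc 0 (k * h), D (eulerRadius C T R) r ≠ ⊤ ∧
    (volume.restrict (Metric.closedBall 0 R)).map (eulerIter v h k) ≤
      ENNReal.ofReal (Real.exp (2 * ((∫⁻ r in Ioc 0 (k * h), D (eulerRadius C T R) r).toReal +
        η * (L R₁ * (k * h))))) • (volume : Measure (Vec d)) := by
  induction k with
  | zero =>
    refine ⟨by simp, ?_⟩
    simp only [CharP.cast_eq_zero, zero_mul, Ioc_self, Measure.restrict_empty,
      lintegral_zero_measure, ENNReal.toReal_zero, mul_zero, add_zero, Real.exp_zero,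
      ENNReal.ofReal_one, one_smul, eulerIter, Measure.map_id]
    exact Measure.restrict_le_self
  | succ k ih =>
    push_cast at hk ⊢
    have hkk : (k : ℝ) * h ≤ (k + 1) * h := by nlinarith
    obtain ⟨hfin, hle⟩ := ih (hkk.trans hk)
    have hstep := hD k hk
    have hfin' := ne_top_of_le_ne_top ENNReal.ofReal_ne_top hstep
    have hadd := setLIntegral_Ioc_add (f := D (eulerRadius C T R)) (r := 0)
      (by positivity : (0 : ℝ) ≤ k * h) hkk
    refine ⟨by rw [hadd]; exact ENNReal.add_ne_top.2 ⟨hfin, hfin'⟩, ?_⟩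
    have hsub : (k + 1) * h - k * h = h := by ring
    have h1 := hv.map_eulerStep_le (s := k * h) (t := (k + 1) * h) (R := eulerRadius C T R)
      (R₁ := R₁) hkk hη hδ hR (by rwa [hsub]) (by rwa [hsub]) (by rwa [hsub]) hstep
    rw [hsub] at h1
    refine Measure.le_iff.2 fun A hA => ?_
    have hm := hv.measurable_eulerStep (k * h) ((k + 1) * h)
    have hmk := hv.measurable_eulerIter h k
    have hmk1 := hv.measurable_eulerIter h (k + 1)
    have hB : MeasurableSet (Metric.closedBall (0 : Vec d) (eulerRadius C T R)) :=
      Metric.isClosed_closedBall.measurableSet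
    have e1 : (volume.restrict (Metric.closedBall 0 R)).map (eulerIter v h (k + 1)) A ≤
        (volume.restrict (Metric.closedBall 0 R)).map (eulerIter v h k)
          (eulerStep v (k * h) ((k + 1) * h) ⁻¹' A ∩
            Metric.closedBall (0 : Vec d) (eulerRadius C T R)) := by
      rw [Measure.map_apply hmk1 hA, Measure.map_apply hmk ((hm hA).inter hB),
        Measure.restrict_apply (hmk1 hA), Measure.restrict_apply (hmk ((hm hA).inter hB))]
      refine measure_mono fun x hx => ⟨⟨hx.1, ?_⟩, hx.2⟩
      simpa using hv.eulerIter_mem hC hh (hkk.trans hk) (by simpa using hx.2)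
    have e2 := h1 A
    rw [Measure.map_apply hm hA, Measure.restrict_apply (hm hA), Measure.smul_apply,
      smul_eq_mul] at e2
    have e3 := hle (eulerStep v (k * h) ((k + 1) * h) ⁻¹' A ∩
            Metric.closedBall (0 : Vec d) (eulerRadius C T R))
    rw [Measure.smul_apply, smul_eq_mul] at e3
    refine (e1.trans (e3.trans (mul_le_mul' le_rfl e2))).trans (le_of_eq ?_)
    rw [Measure.smul_apply, smul_eq_mul, ← mul_assoc, ← ENNReal.ofReal_mul (Real.exp_nonneg _),
      ← Real.exp_add, hadd, ENNReal.toReal_add hfin hfin']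
    congr 3
    ring

lemma IsC1Field.eulerIter_eq {h : ℝ} (hh : 0 < h) (x : Vec d) (k : ℕ) :
    IntegrableOn (fun s => v s (eulerIter v h ⌊s / h⌋₊ x)) (Ioc 0 (k * h)) ∧
    eulerIter v h k x = x + ∫ s in Ioc 0 (k * h), v s (eulerIter v h ⌊s / h⌋₊ x) := by
  induction k with
  | zero => simp [eulerIter]
  | succ k ih =>
    obtain ⟨ihi, ih⟩ := ih
    have hkk : (k : ℝ) * h ≤ (k + 1) * h := by nlinarith
    have hae : ∀ᵐ s ∂(volume.restrict (Ioc (k * h) ((k + 1) * h))),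
        v s (eulerIter v h k x) = v s (eulerIter v h ⌊s / h⌋₊ x) := by
      -- At the right endpoint the floor already equals k + 1; passing to the open interval discards
      -- this null set.
      rw [← Measure.restrict_congr_set Ioo_ae_eq_Ioc]
      filter_upwards [ae_restrict_mem measurableSet_Ioo] with s hs
      have : ⌊s / h⌋₊ = k := by
        have h0 : 0 ≤ s / h := div_nonneg ((by positivity : (0 : ℝ) ≤ k * h).trans hs.1.le) hh.le
        rw [Nat.floor_eq_iff h0]
        exact ⟨(le_div_iff₀ hh).2 hs.1.le, (div_lt_iff₀ hh).2 hs.2⟩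
      rw [this]
    have hint : IntegrableOn (fun s => v s (eulerIter v h ⌊s / h⌋₊ x))
        (Ioc (k * h) ((k + 1) * h)) :=
      (hv.integrableOn (k * h) ((k + 1) * h) (eulerIter v h k x)).congr hae
    have hU : Ioc (0 : ℝ) ((k + 1) * h) = Ioc 0 (k * h) ∪ Ioc (k * h) ((k + 1) * h) :=
      (Ioc_union_Ioc_eq_Ioc (by positivity) hkk).symm
    push_cast
    rw [hU]
    refine ⟨ihi.union hint, ?_⟩
    rw [setIntegral_union (Ioc_disjoint_Ioc_of_le le_rfl) measurableSet_Ioc ihi hint,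
      ← integral_congr_ae hae, ← add_assoc, ← ih]
    rfl

/-- A piecewise constant Euler approximation of the flow of `v`. -/
theorem IsC1Field.exists_approximate_flow (hC : 0 ≤ C) {T R₀ ε : ℝ} (hT : 0 < T) (hR₀ : 0 ≤ R₀)
    (hε : 0 < ε) (hDmono : ∀ R R' t, R ≤ R' → D R t ≤ D R' t)
    (hDfin : ∀ R, 0 < R → ∫⁻ r in Icc 0 T, D R r < ⊤) :
    ∃ Y : ℝ → Vec d → Vec d, Measurable (Function.uncurry Y) ∧
      (∀ R, ∀ x : Vec d, ‖x‖ ≤ R → ∀ t ∈ Icc (0 : ℝ) T, ‖Y t x‖ ≤ eulerRadius C T R) ∧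
      (∀ R ≤ R₀, ∀ t ∈ Icc (0 : ℝ) T, (volume.restrict (Metric.closedBall 0 R)).map (Y t) ≤
        ENNReal.ofReal (Real.exp (2 * ((∫⁻ r in Icc 0 T, D (eulerRadius C T R) r).toReal + 1))) •
          (volume : Measure (Vec d))) ∧
      (∀ x : Vec d, ‖x‖ ≤ R₀ → ∀ t ∈ Icc (0 : ℝ) T,
        IntegrableOn (fun s => v s (Y s x)) (Ioc 0 t) ∧
        ‖Y t x - (x + ∫ s in Ioc 0 t, v s (Y s x))‖ ≤ ε) := by
  set R₁ := eulerRadius C T R₀ with hR₁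
  have hR₁pos : 0 < R₁ := by
    simp only [hR₁, eulerRadius]
    positivity
  set Λ := L R₁ with hΛ
  have hΛ0 : 0 ≤ Λ := (norm_nonneg _).trans (hv.norm_grad_le R₁ 0 0 (by simpa using hR₁pos.le))
  -- With this η the determinant errors accumulated over [0,T] are at most ηΛT ≤ 1. This is the term
  -- +1 in the compression exponent, and it makes the bound independent of the Lipschitz constant Λ.
  set η : ℝ := 1 / (Λ * T + 1) with hη
  have hη0 : 0 < η := by positivity
  have hη1 : η ≤ 1 := by
    rw [hη, div_le_one (by positivity)]
    nlinarith
  have hηT : η * (Λ * T) ≤ 1 := by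
    rw [hη, div_mul_eq_mul_div, one_mul, div_le_one (by positivity)]
    linarith
  obtain ⟨δ, hδ0, hδ⟩ := exists_det_one_add_ge (E := Vec d) hη0
  obtain ⟨δ', hδ'0, hδ'⟩ := exists_pos_setLIntegral_Ioc_lt (hDfin R₁ hR₁pos).ne
    (ε := ENNReal.ofReal (1 / 4)) (by simp)
  -- The three bounds on the step ensure, in order, divergence mass at most 1/4 per step, Λh ≤
  -- min(1/4, δ) for injectivity and the determinant estimate, and a displacement at most ε per
  -- step.
  set m : ℝ := min δ' (min (min (1 / 4) δ / (Λ + 1)) (ε / (C * (2 + R₁) + 1))) with hm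
  have hm0 : 0 < m := by
    refine lt_min hδ'0 (lt_min (div_pos (lt_min (by norm_num) hδ0) (by positivity)) ?_)
    positivity
  obtain ⟨N, hN⟩ := exists_nat_gt (T / m)
  have hN0 : 0 < (N : ℝ) := (div_pos hT hm0).trans hN
  set h : ℝ := T / N with hh
  have hh0 : 0 < h := div_pos hT hN0
  have hhm : h < m := by
    rw [div_lt_iff₀ hm0] at hN
    rw [hh, div_lt_iff₀ hN0]
    linarith
  have hh1 : h < δ' := hhm.trans_le (min_le_left _ _)
  have hh2 : Λ * h ≤ min (1 / 4) δ := by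
    have := hhm.trans_le ((min_le_right _ _).trans (min_le_left _ _))
    rw [lt_div_iff₀ (by positivity)] at this
    linarith
  have hh3 : C * (2 + R₁) * h ≤ ε := by
    have := hhm.trans_le ((min_le_right _ _).trans (min_le_right _ _))
    rw [lt_div_iff₀ (by positivity)] at this
    linarith
  have hh4 : Λ * h ≤ 1 / 4 := hh2.trans (min_le_left _ _)
  have hfloor : ∀ t ∈ Icc (0 : ℝ) T, (⌊t / h⌋₊ : ℝ) * h ≤ t := fun t ht =>
    (le_div_iff₀ hh0).1 (Nat.floor_le (div_nonneg ht.1 hh0.le))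
  have hmem : ∀ R, ∀ x : Vec d, ‖x‖ ≤ R → ∀ t ∈ Icc (0 : ℝ) T,
      ‖eulerIter v h ⌊t / h⌋₊ x‖ ≤ eulerRadius C T R := fun R x hx t ht =>
    hv.eulerIter_mem hC hh0.le ((hfloor t ht).trans ht.2) hx
  refine ⟨fun t x => eulerIter v h ⌊t / h⌋₊ x, ?_, hmem, ?_, ?_⟩
  · have h1 : Measurable fun p : ℕ × Vec d => eulerIter v h p.1 p.2 :=
      measurable_from_prod_countable_right fun k => hv.measurable_eulerIter h k
    have h2 : Measurable fun p : ℝ × Vec d => (⌊p.1 / h⌋₊, p.2) :=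
      (Nat.measurable_floor.comp (measurable_fst.div_const h)).prodMk measurable_snd
    exact h1.comp h2
  · intro R hR t ht
    have hRR : eulerRadius C T R ≤ R₁ := by
      simp only [hR₁, eulerRadius]
      gcongr
    have hfin : ∫⁻ r in Icc 0 T, D (eulerRadius C T R) r ≠ ⊤ :=
      ((lintegral_mono fun r => hDmono _ _ r hRR).trans_lt (hDfin R₁ hR₁pos)).ne
    have hkT := (hfloor t ht).trans ht.2
    obtain ⟨_, h2⟩ := hv.map_eulerIter_le hC (T := T) (R := R) (R₁ := R₁) hh0.le hη0.le hδ hRR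
      (hh4.trans_lt (by norm_num)) (hh2.trans (min_le_right _ _))
      ((mul_le_of_le_one_left (by positivity) hη1).trans hh4)
      (fun k hk => (lintegral_mono fun r => hDmono _ _ r hRR).trans
        (hδ' _ _ (by positivity) hk (by linarith)).le) ⌊t / h⌋₊ hkT
    refine h2.trans (Measure.le_iff.2 fun A _ => ?_)
    rw [Measure.smul_apply, Measure.smul_apply, smul_eq_mul, smul_eq_mul]
    refine mul_le_mul' (ENNReal.ofReal_le_ofReal (Real.exp_le_exp.2 ?_)) le_rfl
    have h3 : (∫⁻ r in Ioc 0 (⌊t / h⌋₊ * h), D (eulerRadius C T R) r).toReal ≤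
        (∫⁻ r in Icc 0 T, D (eulerRadius C T R) r).toReal :=
      ENNReal.toReal_mono hfin (lintegral_mono_set
        (Ioc_subset_Icc_self.trans (Icc_subset_Icc_right hkT)))
    have h4 : η * (Λ * (⌊t / h⌋₊ * h)) ≤ 1 := by
      refine le_trans ?_ hηT
      gcongr
    linarith
  · intro x hx t ht
    obtain ⟨h1, h2⟩ := hv.eulerIter_eq hh0 x ⌊t / h⌋₊
    have hle := hfloor t ht
    have hm : Measurable fun s : ℝ => v s (eulerIter v h ⌊s / h⌋₊ x) := by
      have e1 : Measurable fun s : ℝ => eulerIter v h ⌊s / h⌋₊ x :=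
        (measurable_from_nat (f := fun k => eulerIter v h k x)).comp
          (Nat.measurable_floor.comp (measurable_id.div_const h))
      exact hv.measurable.comp (measurable_id.prodMk e1)
    have hbd : ∀ s ∈ Ioc (⌊t / h⌋₊ * h) t,
        ‖v s (eulerIter v h ⌊s / h⌋₊ x)‖ ≤ C * (2 + R₁) := by
      intro s hs
      refine (hv.growth _ _).trans ?_
      gcongr
      exact hmem R₀ x hx s ⟨(by positivity : (0 : ℝ) ≤ ⌊t / h⌋₊ * h).trans hs.1.le,
        hs.2.trans ht.2⟩
    have hint : IntegrableOn (fun s => v s (eulerIter v h ⌊s / h⌋₊ x)) (Ioc (⌊t / h⌋₊ * h) t) :=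
      Measure.integrableOn_of_bounded (M := C * (2 + R₁)) (by simp) hm.aestronglyMeasurable
        ((ae_restrict_mem measurableSet_Ioc).mono hbd)
    have hU : Ioc (0 : ℝ) t = Ioc 0 (⌊t / h⌋₊ * h) ∪ Ioc (⌊t / h⌋₊ * h) t :=
      (Ioc_union_Ioc_eq_Ioc (by positivity) hle).symm
    rw [hU]
    refine ⟨h1.union hint, ?_⟩
    -- The integral equation is exact up to the last grid time; the error is the integral over the
    -- final incomplete step.
    rw [setIntegral_union (Ioc_disjoint_Ioc_of_le le_rfl) measurableSet_Ioc h1 hint,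
      ← add_assoc, ← h2, sub_add_cancel_left, norm_neg]
    have h3 := norm_setIntegral_le_of_norm_le_const (μ := volume) (by simp) hbd
    rw [Measure.real, Real.volume_Ioc, ENNReal.toReal_ofReal (sub_nonneg.2 hle)] at h3
    refine h3.trans (le_trans ?_ hh3)
    have h4 : t - ⌊t / h⌋₊ * h ≤ h := by
      have := Nat.lt_floor_add_one (t / h)
      rw [div_lt_iff₀ hh0] at this
      linarith
    gcongr

end EulerScheme

/-! ### Approximate flows of the mollified fields and their comparison -/

section Approximation

variable {d : ℕ} {T C : ℝ} {b : ℝ → Vec d → Vec d} {G : ℝ → Vec d → (Vec d →L[ℝ] Vec d)}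

/-- The `L^∞` norm of the divergence on the ball of radius `R + 1`. -/
noncomputable def divBound (G : ℝ → Vec d → (Vec d →L[ℝ] Vec d)) (R t : ℝ) : ℝ≥0∞ :=
  eLpNorm (divOfGrad (G t)) ⊤ (volume.restrict (Metric.closedBall 0 (R + 1)))

lemma IsRegularField.norm_mollify_le (hC : 0 ≤ C) (hb : IsRegularField T C b G) (n : ℕ) (t : ℝ)
    (x : Vec d) : ‖mollify volume (stdBump (Vec d) n) (b t) x‖ ≤ C * (2 + ‖x‖) := by
  have h0 : 0 ≤ C * (2 + ‖x‖) := by positivity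
  rw [← ENNReal.ofReal_le_ofReal_iff h0, ofReal_norm]
  refine enorm_mollify_le volume (Eventually.of_forall fun y hy => ?_)
  rw [← ofReal_norm]
  refine ENNReal.ofReal_le_ofReal ((hb.growth t y).trans ?_)
  have h1 := hy.trans (stdBump_rOut_le_one n)
  rw [dist_eq_norm] at h1
  exact mul_le_mul_of_nonneg_left (by linarith [norm_le_norm_add_norm_sub' y x]) hC

/-- Only the gradient bound depends on n. Bumps of radius at most 1 turn 1 + |x| into 2 + |x| and
require the divergence on B(R + 1). -/
lemma IsRegularField.isC1Field_mollify (hC : 0 ≤ C) (hb : IsRegularField T C b G) (n : ℕ) :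
    IsC1Field C (fun t => mollify volume (stdBump (Vec d) n) (b t))
      (fun t => mollify volume (stdBump (Vec d) n) (G t))
      (fun R => (∫ z, ‖fderiv ℝ ((stdBump (Vec d) n).normed volume) z‖) * (C * (2 + R)))
      (divBound G) where
  measurable := measurable_mollify volume _ hb.measurable
  measurable_grad := measurable_mollify volume _ hb.measurable_grad
  growth t x := hb.norm_mollify_le hC n t x
  hasFDerivAt t x := (hb.isWeakGradient t).hasFDerivAt_mollify _ x
  norm_grad_le R t x hx := by
    refine (hb.isWeakGradient t).norm_mollify_grad_le _ fun y hy => (hb.growth t y).trans ?_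
    have h1 := hy.trans (stdBump_rOut_le_one n)
    rw [dist_eq_norm] at h1
    exact mul_le_mul_of_nonneg_left (by linarith [norm_le_norm_add_norm_sub' y x]) hC
  div_le R t x hx := by
    rw [divOfGrad_mollify (hb.isWeakGradient t).locallyIntegrable_grad]
    refine enorm_mollify_le volume ?_
    have h1 := ae_le_eLpNormEssSup (μ := volume.restrict (Metric.closedBall (0 : Vec d) (R + 1)))
      (f := divOfGrad (G t))
    rw [ae_restrict_iff' Metric.isClosed_closedBall.measurableSet] at h1
    filter_upwards [h1] with y hy hyx
    rw [divBound, eLpNorm_exponent_top]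
    refine hy ?_
    rw [mem_closedBall_zero_iff]
    have h2 := hyx.trans (stdBump_rOut_le_one n)
    rw [dist_eq_norm] at h2
    linarith [norm_le_norm_add_norm_sub' y x]

lemma divBound_mono {R R' : ℝ} (t : ℝ) (h : R ≤ R') : divBound G R t ≤ divBound G R' t :=
  eLpNorm_mono_measure _ (Measure.restrict_mono
    (Metric.closedBall_subset_closedBall (by linarith)) le_rfl)

/-- The compression constant of the approximate flows on the ball of radius `R`. -/
noncomputable def compressionBound (T C : ℝ) (G : ℝ → Vec d → (Vec d →L[ℝ] Vec d)) (R : ℝ) : ℝ≥0 :=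
  Real.toNNReal
    (Real.exp (2 * ((∫⁻ r in Icc 0 T, divBound G (eulerRadius C T R) r).toReal + 1)))

/-- `Y` solves the equation for the `n`-th mollification of `b` up to an error `1 / (n + 1)`, for
initial points in the ball of radius `n`. -/
structure IsApproximateFlow (T C : ℝ) (b : ℝ → Vec d → Vec d)
    (G : ℝ → Vec d → (Vec d →L[ℝ] Vec d)) (n : ℕ) (Y : ℝ → Vec d → Vec d) : Prop where
  measurable : Measurable (Function.uncurry Y)
  norm_le : ∀ R, ∀ x : Vec d, ‖x‖ ≤ R → ∀ t ∈ Icc (0 : ℝ) T, ‖Y t x‖ ≤ eulerRadius C T R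
  compression : ∀ R ≤ (n : ℝ), ∀ t ∈ Icc (0 : ℝ) T,
    (volume.restrict (Metric.closedBall 0 R)).map (Y t) ≤
      (compressionBound T C G R : ℝ≥0∞) • (volume : Measure (Vec d))
  error_le : ∀ x : Vec d, ‖x‖ ≤ n → ∀ t ∈ Icc (0 : ℝ) T,
    IntegrableOn (fun s => mollify volume (stdBump (Vec d) n) (b s) (Y s x)) (Ioc 0 t) ∧
    ‖Y t x - (x + ∫ s in Ioc 0 t, mollify volume (stdBump (Vec d) n) (b s) (Y s x))‖ ≤
      1 / (n + 1)

lemma IsRegularField.exists_isApproximateFlow (hT : 0 < T) (hC : 0 ≤ C)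
    (hb : IsRegularField T C b G) (n : ℕ) : ∃ Y, IsApproximateFlow T C b G n Y := by
  obtain ⟨Y, h1, h2, h3, h4⟩ := (hb.isC1Field_mollify hC n).exists_approximate_flow hC hT
    (Nat.cast_nonneg n) (ε := 1 / (n + 1)) (by positivity) (fun R R' t h => divBound_mono t h)
    (fun R hR => hb.div_lt_top (R + 1) (by linarith))
  exact ⟨Y, h1, h2, h3, h4⟩

/-- The defect of `Y` as a solution of the equation for `b`. -/
noncomputable def flowDefect (T : ℝ) (b : ℝ → Vec d → Vec d) (n : ℕ) (X : ℝ → Vec d) : ℝ≥0∞ :=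
  ENNReal.ofReal (1 / (n + 1)) +
    ∫⁻ s in Icc 0 T, ‖mollify volume (stdBump (Vec d) n) (b s) (X s) - b s (X s)‖ₑ

lemma IsRegularField.measurable_mollify_sub (hb : IsRegularField T C b G) (n : ℕ) :
    Measurable fun p : ℝ × Vec d =>
      ‖mollify volume (stdBump (Vec d) n) (b p.1) p.2 - b p.1 p.2‖ₑ :=
  ((measurable_mollify volume (stdBump (Vec d) n) hb.measurable).sub hb.measurable).enorm

/-- Dominated convergence: mollifications converge almost everywhere in space-time, and the growth
bounds dominate on a ball. -/
lemma IsRegularField.tendsto_lintegral_mollify_sub (hC : 0 ≤ C) (hb : IsRegularField T C b G)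
    (R : ℝ) :
    Tendsto (fun n : ℕ => ∫⁻ s in Icc 0 T, ∫⁻ x in Metric.closedBall (0 : Vec d) R,
      ‖mollify volume (stdBump (Vec d) n) (b s) x - b s x‖ₑ) atTop (𝓝 0) := by
  set ν := (volume.restrict (Icc 0 T)).prod (volume.restrict (Metric.closedBall (0 : Vec d) R))
  have h1 : Tendsto (fun n : ℕ => ∫⁻ p,
      ‖mollify volume (stdBump (Vec d) n) (b p.1) p.2 - b p.1 p.2‖ₑ ∂ν) atTop
      (𝓝 (∫⁻ _, 0 ∂ν)) := by
    refine tendsto_lintegral_of_dominated_convergence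
      (fun _ => ENNReal.ofReal (C * (2 + R) + C * (1 + R))) (fun n => hb.measurable_mollify_sub n)
      (fun n => ?_) ?_ ?_
    · have h2 : ∀ᵐ p ∂ν, p.2 ∈ Metric.closedBall (0 : Vec d) R :=
        Measure.quasiMeasurePreserving_snd.ae
          (ae_restrict_mem Metric.isClosed_closedBall.measurableSet)
      filter_upwards [h2] with p hp
      rw [mem_closedBall_zero_iff] at hp
      rw [← ofReal_norm]
      refine ENNReal.ofReal_le_ofReal ((norm_sub_le _ _).trans (add_le_add ?_ ?_))
      · refine (hb.norm_mollify_le hC n p.1 p.2).trans ?_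
        gcongr
      · refine (hb.growth p.1 p.2).trans ?_
        gcongr
    · rw [lintegral_const]
      refine ENNReal.mul_ne_top ENNReal.ofReal_ne_top ?_
      change ((volume.restrict (Icc 0 T)).prod
        (volume.restrict (Metric.closedBall (0 : Vec d) R))) univ ≠ ⊤
      rw [Measure.prod_restrict, Measure.restrict_apply_univ, Measure.prod_prod]
      exact ENNReal.mul_ne_top (by simp) (measure_closedBall_ne_top volume _ _)
    · have h3 : ∀ᵐ p ∂ν, p ∈ regularPoints b :=
        (Measure.ae_prod_mem_iff_ae_ae_mem hb.measurableSet_regularPoints).2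
          (Eventually.of_forall fun t => ae_restrict_of_ae (hb.ae_mem_regularPoints t))
      filter_upwards [h3] with p hp
      have h4 : Tendsto (fun n => mollify volume (stdBump (Vec d) n) (b p.1) p.2) atTop
        (𝓝 (b p.1 p.2)) := hp
      simpa using (h4.sub (tendsto_const_nhds (x := b p.1 p.2))).enorm
  rw [lintegral_zero] at h1
  refine h1.congr fun n => ?_
  exact lintegral_prod _ (hb.measurable_mollify_sub n).aemeasurable

variable {n : ℕ} {Y : ℝ → Vec d → Vec d}

lemma IsRegularField.measurable_flowDefect (hb : IsRegularField T C b G)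
    (hY : Measurable (Function.uncurry Y)) (n : ℕ) :
    Measurable fun x => flowDefect T b n (fun t => Y t x) := by
  have h0 : Measurable fun p : Vec d × ℝ => (p.2, Y p.2 p.1) :=
    measurable_snd.prodMk (hY.comp measurable_swap)
  have h1 := (hb.measurable_mollify_sub n).comp h0
  exact (Measurable.lintegral_prod_right' (ν := volume.restrict (Icc 0 T)) h1).const_add _

/-- Compression carries the L¹ mollification error over to trajectories. Its constant does not
depend on n, so for fixed R the bound tends to 0. -/
lemma IsApproximateFlow.setLIntegral_flowDefect_le (hb : IsRegularField T C b G)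
    (hY : IsApproximateFlow T C b G n Y) {R : ℝ} (hR : R ≤ n) :
    ∫⁻ x in Metric.closedBall (0 : Vec d) R, flowDefect T b n (fun t => Y t x) ≤
      ENNReal.ofReal (1 / (n + 1)) * volume (Metric.closedBall (0 : Vec d) R) +
      compressionBound T C G R * ∫⁻ s in Icc 0 T,
        ∫⁻ x in Metric.closedBall (0 : Vec d) (eulerRadius C T R),
          ‖mollify volume (stdBump (Vec d) n) (b s) x - b s x‖ₑ := by
  simp only [flowDefect]
  rw [lintegral_add_left measurable_const]
  refine add_le_add (by simp) ?_
  refine lintegral_lintegral_comp_le hY.measurable (hY.compression R hR) ?_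
    (hb.measurable_mollify_sub n)
  filter_upwards [ae_restrict_mem Metric.isClosed_closedBall.measurableSet] with x hx
  exact hY.norm_le R x (by simpa using hx)

lemma IsApproximateFlow.setLIntegral_lusinEnergy_le (hb : IsRegularField T C b G)
    (hY : IsApproximateFlow T C b G n Y) {R : ℝ} (hR : R ≤ n) (ρ : ℝ) :
    ∫⁻ x in Metric.closedBall (0 : Vec d) R, lusinEnergy G T ρ (fun t => Y t x) ≤
      compressionBound T C G R * ∫⁻ s in Icc 0 T,
        ∫⁻ y in Metric.closedBall (0 : Vec d) (eulerRadius C T R), lusinKernel G ρ s y := by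
  refine hb.setLIntegral_lusinEnergy_le hY.measurable (hY.compression R hR) ?_ ρ
  filter_upwards [ae_restrict_mem Metric.isClosed_closedBall.measurableSet] with x hx
  exact hY.norm_le R x (by simpa using hx)

lemma IsRegularField.integrableOn_comp (hC : 0 ≤ C) (hb : IsRegularField T C b G)
    {X : ℝ → Vec d} (hX : Measurable X) {R t : ℝ} (hXR : ∀ s ∈ Icc (0 : ℝ) T, ‖X s‖ ≤ R)
    (ht : t ∈ Icc 0 T) : IntegrableOn (fun s => b s (X s)) (Ioc 0 t) := by
  refine Measure.integrableOn_of_bounded (M := C * (1 + R)) (by simp)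
    (hb.measurable.comp (measurable_id.prodMk hX)).aestronglyMeasurable ?_
  filter_upwards [ae_restrict_mem measurableSet_Ioc] with s hs
  refine (hb.growth s (X s)).trans ?_
  have := hXR s ⟨hs.1.le, hs.2.trans ht.2⟩
  gcongr

/-- The curve W is left free: it will be the trajectory itself, another approximate trajectory, or
the limit. -/
lemma IsApproximateFlow.enorm_sub_integral_le (hb : IsRegularField T C b G)
    (hY : IsApproximateFlow T C b G n Y) {x : Vec d} (hx : ‖x‖ ≤ n) {t : ℝ} (ht : t ∈ Icc 0 T)
    {W : ℝ → Vec d} (hW : IntegrableOn (fun s => b s (W s)) (Ioc 0 t)) :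
    ‖Y t x - (x + ∫ s in Ioc 0 t, b s (W s))‖ₑ ≤ flowDefect T b n (fun t => Y t x) +
      ∫⁻ s in Ioc 0 t, ‖b s (Y s x) - b s (W s)‖ₑ := by
  obtain ⟨h1, h2⟩ := hY.error_le x hx t ht
  set v : ℝ → Vec d := fun s => mollify volume (stdBump (Vec d) n) (b s) (Y s x)
  have e : Y t x - (x + ∫ s in Ioc 0 t, b s (W s)) =
      (Y t x - (x + ∫ s in Ioc 0 t, v s)) + ∫ s in Ioc 0 t, (v s - b s (W s)) := by
    rw [integral_sub h1 hW]
    abel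
  have hYx : Measurable fun s : ℝ => (s, Y s x) :=
    measurable_id.prodMk (hY.measurable.comp measurable_prodMk_right)
  rw [e, flowDefect, add_assoc]
  refine (enorm_add_le _ _).trans (add_le_add ?_ ?_)
  · rw [← ofReal_norm]
    exact ENNReal.ofReal_le_ofReal h2
  · calc ‖∫ s in Ioc 0 t, (v s - b s (W s))‖ₑ ≤ ∫⁻ s in Ioc 0 t, ‖v s - b s (W s)‖ₑ :=
          enorm_integral_le_lintegral_enorm _
      _ ≤ ∫⁻ s in Ioc 0 t, (‖v s - b s (Y s x)‖ₑ + ‖b s (Y s x) - b s (W s)‖ₑ) := by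
          refine lintegral_mono fun s => ?_
          rw [← sub_add_sub_cancel (v s) (b s (Y s x)) (b s (W s))]
          exact enorm_add_le _ _
      _ = (∫⁻ s in Ioc 0 t, ‖v s - b s (Y s x)‖ₑ) +
            ∫⁻ s in Ioc 0 t, ‖b s (Y s x) - b s (W s)‖ₑ :=
          lintegral_add_left ((hb.measurable_mollify_sub n).comp hYx) _
      _ ≤ _ := by
          refine add_le_add (lintegral_mono_set ?_) le_rfl
          exact Ioc_subset_Icc_self.trans (Icc_subset_Icc_right ht.2)

lemma ae_mem_regularPoints_of_compression (hb : IsRegularField T C b G)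
    (hY : Measurable (Function.uncurry Y)) {R : ℝ} {c : ℝ≥0∞}
    (hc : ∀ t ∈ Icc (0 : ℝ) T,
      (volume.restrict (Metric.closedBall (0 : Vec d) R)).map (Y t) ≤ c • volume) :
    ∀ᵐ x ∂(volume.restrict (Metric.closedBall (0 : Vec d) R)),
      ∀ᵐ s ∂(volume.restrict (Icc (0 : ℝ) T)), (s, Y s x) ∈ regularPoints b :=
  ae_ae_comp_of_ae_prod hY (fun t ht => Measure.absolutelyContinuous_of_le_smul (hc t ht))
    hb.ae_prod_mem_regularPoints

/-- Both trajectories are compared with x + ∫ b(Z), so the defects enter Gronwall's inequality as an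
initial error. The kernel belongs to the unmollified b and is evaluated at its regular points, so it
does not involve the mollification scales. -/
lemma IsApproximateFlow.ae_enorm_sub_le (hC : 0 ≤ C) (hb : IsRegularField T C b G) {m : ℕ}
    {Z : ℝ → Vec d → Vec d} (hY : IsApproximateFlow T C b G n Y)
    (hZ : IsApproximateFlow T C b G m Z) {R ρ : ℝ} (hRn : R ≤ n) (hRm : R ≤ m)
    (hρ : 2 * eulerRadius C T R < ρ) :
    ∀ᵐ x ∂(volume.restrict (Metric.closedBall (0 : Vec d) R)),
      lusinEnergy G T ρ (fun t => Y t x) ≠ ⊤ → lusinEnergy G T ρ (fun t => Z t x) ≠ ⊤ →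
      ∀ t ∈ Icc (0 : ℝ) T, ‖Y t x - Z t x‖ₑ ≤
        (flowDefect T b n (fun t => Y t x) + flowDefect T b m (fun t => Z t x)) *
        ENNReal.ofReal (Real.exp (2 * ((lusinEnergy G T ρ (fun t => Y t x)).toReal +
          (lusinEnergy G T ρ (fun t => Z t x)).toReal))) := by
  filter_upwards [ae_restrict_mem Metric.isClosed_closedBall.measurableSet,
    ae_mem_regularPoints_of_compression hb hY.measurable (hY.compression R hRn),
    ae_mem_regularPoints_of_compression hb hZ.measurable (hZ.compression R hRm)]
    with x hx hregY hregZ hHY hHZ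
  rw [mem_closedBall_zero_iff] at hx
  have hYm : Measurable fun s => Y s x := hY.measurable.comp measurable_prodMk_right
  have hZm : Measurable fun s => Z s x := hZ.measurable.comp measurable_prodMk_right
  have hadd : ∫⁻ s in Icc 0 T, (lusinKernel G ρ s (Y s x) + lusinKernel G ρ s (Z s x)) =
      lusinEnergy G T ρ (fun t => Y t x) + lusinEnergy G T ρ (fun t => Z t x) := by
    have hm : Measurable fun s : ℝ => (s, Y s x) := measurable_id.prodMk hYm
    exact lintegral_add_left ((hb.measurable_lusinKernel ρ).comp hm) _
  have hfin := ENNReal.add_ne_top.2 ⟨hHY, hHZ⟩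
  have key := le_mul_exp_of_le_add_setLIntegral (T := T)
    (u := fun t => ‖Y t x - Z t x‖ₑ)
    (k := fun s => lusinKernel G ρ s (Y s x) + lusinKernel G ρ s (Z s x))
    (a := flowDefect T b n (fun t => Y t x) + flowDefect T b m (fun t => Z t x))
    (M := ENNReal.ofReal (eulerRadius C T R + eulerRadius C T R)) (fun t ht => ?_)
    ENNReal.ofReal_ne_top (by rwa [hadd]) (fun t ht => ?_)
  · rwa [hadd, ENNReal.toReal_add hHY hHZ] at key
  · rw [← ofReal_norm]
    exact ENNReal.ofReal_le_ofReal ((norm_sub_le _ _).trans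
      (add_le_add (hY.norm_le R x hx t ht) (hZ.norm_le R x hx t ht)))
  · have hint : IntegrableOn (fun s => b s (Z s x)) (Ioc 0 t) :=
      hb.integrableOn_comp hC hZm (hZ.norm_le R x hx) ht
    have h1 := hY.enorm_sub_integral_le hb (hx.trans hRn) ht hint
    have h2 := hZ.enorm_sub_integral_le hb (hx.trans hRm) ht hint
    simp only [sub_self, enorm_zero, lintegral_zero, add_zero] at h2
    have e : Y t x - Z t x = (Y t x - (x + ∫ s in Ioc 0 t, b s (Z s x))) -
        (Z t x - (x + ∫ s in Ioc 0 t, b s (Z s x))) := by abel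
    rw [e]
    refine (enorm_sub_le.trans (add_le_add h1 h2)).trans ?_
    rw [add_right_comm]
    refine add_le_add le_rfl (lintegral_mono_ae ?_)
    refine ae_restrict_of_ae_restrict_of_subset
      (Ioc_subset_Icc_self.trans (Icc_subset_Icc_right ht.2)) ?_
    filter_upwards [hregY, hregZ, ae_restrict_mem measurableSet_Icc] with s h3 h4 hs
    refine hb.enorm_sub_le h3 h4 (lt_of_le_of_lt (norm_sub_le _ _) ?_)
    linarith [hY.norm_le R x hx s hs, hZ.norm_le R x hx s hs]

end Approximation

/-! ### Almost everywhere convergence and stability of compression under limits -/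

/-- **Borel–Cantelli** for functions with summable relative integrals. -/
lemma ae_eventually_le_of_lintegral_le {α : Type*} [MeasurableSpace α] {μ : Measure α}
    {f : ℕ → α → ℝ≥0∞} (hf : ∀ j, Measurable (f j)) {ε δ : ℕ → ℝ} (hε : ∀ j, 0 < ε j)
    (hs : Summable δ) {N : ℕ}
    (h : ∀ j ≥ N, ∫⁻ x, f j x ∂μ ≤ ENNReal.ofReal (ε j * δ j)) :
    ∀ᵐ x ∂μ, ∀ᶠ j in atTop, f j x ≤ ENNReal.ofReal (ε j) := by
  have hle : ∀ i, μ {x | ENNReal.ofReal (ε (i + N)) ≤ f (i + N) x} ≤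
      ENNReal.ofReal (δ (i + N)) := fun i => by
    have h1 := (mul_meas_ge_le_lintegral (μ := μ) (hf (i + N))
      (ENNReal.ofReal (ε (i + N)))).trans (h (i + N) (Nat.le_add_left _ _))
    rw [ENNReal.ofReal_mul (hε _).le] at h1
    exact (ENNReal.mul_le_mul_iff_right (ENNReal.ofReal_pos.2 (hε _)).ne'
      ENNReal.ofReal_ne_top).1 h1
  have hsum : ∑' i, μ {x | ENNReal.ofReal (ε (i + N)) ≤ f (i + N) x} ≠ ⊤ :=
    ne_top_of_le_ne_top (((summable_nat_add_iff N).2 hs).tsum_ofReal_ne_top)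
      (ENNReal.tsum_le_tsum hle)
  filter_upwards [ae_eventually_notMem hsum] with x hx
  rw [← map_add_atTop_eq_nat N, eventually_map]
  filter_upwards [hx] with i hi
  exact (not_le.1 hi).le

/-- For open U the indicator of g⁻¹(U) is at most the lower limit of those of the f_j⁻¹(U), so Fatou
gives the bound on open sets. Outer regularity extends it to all measurable sets. -/
lemma map_le_smul_of_tendsto {α E : Type*} [MeasurableSpace α] {μ : Measure α}
    [TopologicalSpace E] [MeasurableSpace E] [BorelSpace E] {ν : Measure E} [ν.OuterRegular]
    {c : ℝ≥0∞} (hc : c ≠ ⊤) {f : ℕ → α → E} {g : α → E} (hf : ∀ j, Measurable (f j))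
    (hg : Measurable g) (hlim : ∀ᵐ x ∂μ, Tendsto (fun j => f j x) atTop (𝓝 (g x)))
    (h : ∀ᶠ j in atTop, μ.map (f j) ≤ c • ν) : μ.map g ≤ c • ν := by
  have hopen : ∀ U, IsOpen U → μ.map g U ≤ (c • ν) U := fun U hU => by
    rw [Measure.map_apply hg hU.measurableSet, ← lintegral_indicator_one (hg hU.measurableSet)]
    calc ∫⁻ x, (g ⁻¹' U).indicator 1 x ∂μ
        ≤ ∫⁻ x, liminf (fun j => (f j ⁻¹' U).indicator (1 : α → ℝ≥0∞) x) atTop ∂μ := by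
          refine lintegral_mono_ae ?_
          filter_upwards [hlim] with x hx
          by_cases hxU : x ∈ g ⁻¹' U
          · rw [indicator_of_mem hxU]
            refine le_liminf_of_le (by isBoundedDefault) ?_
            filter_upwards [hx.eventually (hU.mem_nhds hxU)] with j hj
            rw [indicator_of_mem (show x ∈ f j ⁻¹' U from hj)]
          · rw [indicator_of_notMem hxU]
            exact zero_le
      _ ≤ liminf (fun j => ∫⁻ x, (f j ⁻¹' U).indicator (1 : α → ℝ≥0∞) x ∂μ) atTop :=
          lintegral_liminf_le fun j => measurable_one.indicator (hf j hU.measurableSet)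
      _ ≤ (c • ν) U := by
          refine liminf_le_of_frequently_le' (Eventually.frequently ?_)
          filter_upwards [h] with j hj
          rw [lintegral_indicator_one (hf j hU.measurableSet),
            ← Measure.map_apply (hf j) hU.measurableSet]
          exact hj U
  have : (c • ν).OuterRegular := Measure.OuterRegular.smul ν hc
  refine Measure.le_iff.2 fun s _ => ?_
  rw [s.measure_eq_iInf_isOpen (c • ν)]
  exact le_iInf₂ fun U hsU => le_iInf fun hU => (measure_mono hsU).trans (hopen U hU)

/-! ### Construction of the flow as a limit of approximations -/

section Limit

variable {d : ℕ} {T C : ℝ} {b : ℝ → Vec d → Vec d} {G : ℝ → Vec d → (Vec d →L[ℝ] Vec d)}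

/-- The size of the defect of the `j`-th term of a fast approximation. -/
noncomputable def defectSize (j : ℕ) : ℝ := (1 / 2) ^ j * Real.exp (-(4 * ((j : ℝ) + 2) ^ 2))

lemma defectSize_pos (j : ℕ) : 0 < defectSize j := by
  unfold defectSize; positivity

lemma defectSize_le (j : ℕ) : defectSize j ≤ (1 / 2) ^ j := by
  unfold defectSize
  have h : Real.exp (-(4 * ((j : ℝ) + 2) ^ 2)) ≤ 1 := by
    rw [Real.exp_le_one_iff, neg_nonpos]; positivity
  exact mul_le_of_le_one_right (by positivity) h

lemma defectSize_succ_le (j : ℕ) : defectSize (j + 1) ≤ defectSize j := by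
  unfold defectSize
  refine mul_le_mul (pow_le_pow_of_le_one (by norm_num) (by norm_num) (Nat.le_succ j))
    (Real.exp_le_exp.2 ?_) (Real.exp_pos _).le (by positivity)
  push_cast
  have : (0 : ℝ) ≤ j := j.cast_nonneg
  nlinarith

/-- Approximate flows of increasing accuracy, whose defects decay fast. -/
structure IsFastApproximation (T C : ℝ) (b : ℝ → Vec d → Vec d)
    (G : ℝ → Vec d → (Vec d →L[ℝ] Vec d)) (φ : ℕ → ℕ) (Y : ℕ → ℝ → Vec d → Vec d) : Prop where
  le : ∀ j, j ≤ φ j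
  isApproximateFlow : ∀ j, IsApproximateFlow T C b G (φ j) (Y j)
  defect_le : ∀ j : ℕ, ∫⁻ x in Metric.closedBall (0 : Vec d) j,
    flowDefect T b (φ j) (fun t => Y j t x) ≤ ENNReal.ofReal (defectSize j * (1 / 2) ^ j)

lemma IsRegularField.exists_isFastApproximation (hT : 0 < T) (hC : 0 ≤ C)
    (hb : IsRegularField T C b G) : ∃ φ Y, IsFastApproximation T C b G φ Y := by
  choose Y hY using fun n => hb.exists_isApproximateFlow hT hC n
  have key : ∀ j : ℕ, ∃ n, j ≤ n ∧ ∫⁻ x in Metric.closedBall (0 : Vec d) j,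
      flowDefect T b n (fun t => Y n t x) ≤ ENNReal.ofReal (defectSize j * (1 / 2) ^ j) :=
    fun j => by
    have h1 : Tendsto (fun n : ℕ => ENNReal.ofReal (1 / ((n : ℝ) + 1)) *
        volume (Metric.closedBall (0 : Vec d) j) +
        compressionBound T C G j * ∫⁻ s in Icc 0 T,
          ∫⁻ x in Metric.closedBall (0 : Vec d) (eulerRadius C T j),
            ‖mollify volume (stdBump (Vec d) n) (b s) x - b s x‖ₑ) atTop (𝓝 0) := by
      have h2 : Tendsto (fun n : ℕ => ENNReal.ofReal (1 / ((n : ℝ) + 1))) atTop (𝓝 0) := by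
        simpa using ENNReal.tendsto_ofReal tendsto_one_div_add_atTop_nhds_zero_nat
      have h3 := ENNReal.Tendsto.mul_const (b := volume (Metric.closedBall (0 : Vec d) j)) h2
        (Or.inr measure_closedBall_lt_top.ne)
      have h4 := ENNReal.Tendsto.const_mul (a := (compressionBound T C G j : ℝ≥0∞))
        (hb.tendsto_lintegral_mollify_sub hC (eulerRadius C T j)) (Or.inr ENNReal.coe_ne_top)
      simpa using h3.add h4
    have hpos : 0 < ENNReal.ofReal (defectSize j * (1 / 2) ^ j) :=
      ENNReal.ofReal_pos.2 (mul_pos (defectSize_pos j) (by positivity))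
    obtain ⟨n, hn, hjn⟩ := ((h1.eventually (gt_mem_nhds hpos)).and (eventually_ge_atTop j)).exists
    exact ⟨n, hjn, ((hY n).setLIntegral_flowDefect_le hb (Nat.cast_le.2 hjn)).trans hn.le⟩
  choose φ hφ using key
  exact ⟨φ, fun j => Y (φ j), fun j => (hφ j).1, fun j => hY _, fun j => (hφ j).2⟩

variable {φ : ℕ → ℕ} {Y : ℕ → ℝ → Vec d → Vec d}

lemma eulerRadius_pos {R : ℝ} (hR : 0 ≤ R) : 0 < eulerRadius C T R := by
  unfold eulerRadius; positivity

lemma IsFastApproximation.cast_le (hY : IsFastApproximation T C b G φ Y) {N j : ℕ} (h : N ≤ j) :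
    (N : ℝ) ≤ φ j := Nat.cast_le.2 (h.trans (hY.le j))

lemma IsFastApproximation.ae_flowDefect_le (hb : IsRegularField T C b G)
    (hY : IsFastApproximation T C b G φ Y) (N : ℕ) :
    ∀ᵐ x ∂(volume.restrict (Metric.closedBall (0 : Vec d) N)), ∀ᶠ j in atTop,
      flowDefect T b (φ j) (fun t => Y j t x) ≤ ENNReal.ofReal (defectSize j) :=
  ae_eventually_le_of_lintegral_le
    (fun j => hb.measurable_flowDefect (hY.isApproximateFlow j).measurable (φ j)) defectSize_pos
    summable_geometric_two (N := N) fun j hj =>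
    (lintegral_mono_set (Metric.closedBall_subset_closedBall (Nat.cast_le.2 hj))).trans
      (hY.defect_le j)

/-- The energies have integrals bounded by Λ uniformly for j ≥ N, and Λ/(j + 1)² is summable; hence
Borel–Cantelli leaves only quadratic growth. -/
lemma IsFastApproximation.ae_lusinEnergy_le (hb : IsRegularField T C b G)
    (hY : IsFastApproximation T C b G φ Y) (N : ℕ) {ρ : ℝ} (hρ : 0 < ρ) :
    ∀ᵐ x ∂(volume.restrict (Metric.closedBall (0 : Vec d) N)), ∀ᶠ j : ℕ in atTop,
      lusinEnergy G T ρ (fun t => Y j t x) ≤ ENNReal.ofReal (((j : ℝ) + 1) ^ 2) := by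
  set Λ : ℝ≥0∞ := compressionBound T C G N * ∫⁻ s in Icc 0 T,
    ∫⁻ y in Metric.closedBall (0 : Vec d) (eulerRadius C T N), lusinKernel G ρ s y with hΛ
  have hΛt : Λ ≠ ⊤ := ENNReal.mul_ne_top ENNReal.coe_ne_top
    (hb.lintegral_lusinKernel_lt_top hρ (eulerRadius_pos N.cast_nonneg)).ne
  have hsum : Summable fun j : ℕ => Λ.toReal * (1 / ((j : ℝ) + 1) ^ 2) := by
    have h1 := (summable_nat_add_iff 1).2 (Real.summable_one_div_nat_pow.2 one_lt_two)
    push_cast at h1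
    exact h1.mul_left _
  refine ae_eventually_le_of_lintegral_le
    (fun j => hb.measurable_lusinEnergy (hY.isApproximateFlow j).measurable ρ)
    (fun j => by positivity) hsum (N := N) fun j hj => ?_
  refine ((hY.isApproximateFlow j).setLIntegral_lusinEnergy_le hb (hY.cast_le hj) ρ).trans ?_
  rw [← hΛ, mul_left_comm, mul_one_div_cancel (by positivity), mul_one, ENNReal.ofReal_toReal hΛt]

/-- The Gronwall exponent is eventually at most 2((j + 1)² + (j + 2)²) ≤ 4(j + 2)², exactly what the
exponential factor of `defectSize` cancels. -/
lemma IsFastApproximation.ae_dist_succ_le (hC : 0 ≤ C) (hb : IsRegularField T C b G)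
    (hY : IsFastApproximation T C b G φ Y) (N : ℕ) :
    ∀ᵐ x ∂(volume.restrict (Metric.closedBall (0 : Vec d) N)), ∀ᶠ j : ℕ in atTop,
      ∀ t ∈ Icc (0 : ℝ) T, dist (Y j t x) (Y (j + 1) t x) ≤ 2 * (1 / 2) ^ j := by
  set ρ := 2 * eulerRadius C T N + 1 with hρ
  have hρ0 : 0 < ρ := by
    have := eulerRadius_pos (C := C) (T := T) (R := N) N.cast_nonneg
    linarith
  have hall := ae_all_iff.2 fun j : ℕ => eventually_imp_distrib_left.2 fun hj : N ≤ j =>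
    (hY.isApproximateFlow j).ae_enorm_sub_le hC hb (hY.isApproximateFlow (j + 1))
      (hY.cast_le hj) (hY.cast_le (hj.trans (Nat.le_succ j))) (ρ := ρ) (by linarith)
  filter_upwards [hall, hY.ae_flowDefect_le hb N, hY.ae_lusinEnergy_le hb N hρ0]
    with x hx hdef hen
  filter_upwards [hdef, (tendsto_add_atTop_nat 1).eventually hdef, hen,
    (tendsto_add_atTop_nat 1).eventually hen, eventually_ge_atTop N] with j hd hd' he he' hj t ht
  have h0 : (0 : ℝ) ≤ 2 * (1 / 2) ^ j := by positivity
  rw [dist_eq_norm, ← ENNReal.ofReal_le_ofReal_iff h0, ofReal_norm]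
  refine (hx j hj (ne_top_of_le_ne_top ENNReal.ofReal_ne_top he)
    (ne_top_of_le_ne_top ENNReal.ofReal_ne_top he') t ht).trans ?_
  have hd'' := hd'.trans (ENNReal.ofReal_le_ofReal (defectSize_succ_le j))
  refine (mul_le_mul' (add_le_add hd hd'') le_rfl).trans ?_
  have hr := ENNReal.toReal_le_of_le_ofReal (by positivity) he
  have hr' := ENNReal.toReal_le_of_le_ofReal (by positivity) he'
  rw [← ENNReal.ofReal_add (defectSize_pos j).le (defectSize_pos j).le,
    ← ENNReal.ofReal_mul (by linarith [defectSize_pos j])]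
  refine ENNReal.ofReal_le_ofReal ?_
  calc (defectSize j + defectSize j) * Real.exp _
      ≤ (defectSize j + defectSize j) * Real.exp (4 * ((j : ℝ) + 2) ^ 2) := by
        refine mul_le_mul_of_nonneg_left (Real.exp_le_exp.2 ?_) (by linarith [defectSize_pos j])
        push_cast at hr'
        have : (0 : ℝ) ≤ j := j.cast_nonneg
        nlinarith
    _ = 2 * (1 / 2) ^ j * (Real.exp (-(4 * ((j : ℝ) + 2) ^ 2)) *
          Real.exp (4 * ((j : ℝ) + 2) ^ 2)) := by
        unfold defectSize; ring
    _ = 2 * (1 / 2) ^ j := by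
        rw [← Real.exp_add, neg_add_cancel, Real.exp_zero, mul_one]

/-- The constant 4 is the sum 2(1 + 1/2 + 1/4 + …) of the geometric tail. -/
lemma tendsto_and_dist_limUnder_le {E : Type*} [MetricSpace E] [CompleteSpace E] [Nonempty E]
    {f : ℕ → E} {J : ℕ} (h : ∀ j ≥ J, dist (f j) (f (j + 1)) ≤ 2 * (1 / 2) ^ j) :
    Tendsto f atTop (𝓝 (limUnder atTop f)) ∧
      ∀ j ≥ J, dist (f j) (limUnder atTop f) ≤ 4 * (1 / 2) ^ j := by
  have hstep : ∀ k ≥ J, ∀ i, dist (f (i + k)) (f (i + 1 + k)) ≤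
      2 * (1 / 2) ^ k * (1 / 2) ^ i := fun k hk i => by
    have h1 := h (i + k) (hk.trans (Nat.le_add_left _ _))
    rw [pow_add, add_right_comm] at h1
    linarith
  have hlim : Tendsto f atTop (𝓝 (limUnder atTop f)) := by
    obtain ⟨a, ha⟩ := cauchySeq_tendsto_of_complete
      (cauchySeq_of_le_geometric (1 / 2) _ (by norm_num) (hstep J le_rfl))
    exact tendsto_nhds_limUnder ⟨a, (tendsto_add_atTop_iff_nat J).1 ha⟩
  refine ⟨hlim, fun k hk => ?_⟩
  have h2 := dist_le_of_le_geometric_of_tendsto (1 / 2) _ (by norm_num) (hstep k hk)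
    ((tendsto_add_atTop_iff_nat k).2 hlim) 0
  rw [zero_add] at h2
  refine h2.trans (le_of_eq ?_)
  ring

/-- The pointwise limit of a sequence of flows. -/
noncomputable def limitFlow (Y : ℕ → ℝ → Vec d → Vec d) (t : ℝ) (x : Vec d) : Vec d :=
  limUnder atTop fun j => Y j t x

lemma measurable_limitFlow (hY : ∀ j, Measurable (Function.uncurry (Y j))) :
    Measurable (Function.uncurry (limitFlow Y)) :=
  (StronglyMeasurable.limUnder (l := atTop) (f := fun j => Function.uncurry (Y j))
    fun j => (hY j).stronglyMeasurable).measurable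

lemma IsFastApproximation.ae_dist_limitFlow_le (hC : 0 ≤ C) (hb : IsRegularField T C b G)
    (hY : IsFastApproximation T C b G φ Y) (N : ℕ) :
    ∀ᵐ x ∂(volume.restrict (Metric.closedBall (0 : Vec d) N)),
      (∀ t ∈ Icc (0 : ℝ) T, Tendsto (fun j => Y j t x) atTop (𝓝 (limitFlow Y t x))) ∧
      ∀ᶠ j : ℕ in atTop, ∀ t ∈ Icc (0 : ℝ) T,
        dist (Y j t x) (limitFlow Y t x) ≤ 4 * (1 / 2) ^ j := by
  filter_upwards [hY.ae_dist_succ_le hC hb N] with x hx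
  obtain ⟨J, hJ⟩ := eventually_atTop.1 hx
  have h := fun t ht => tendsto_and_dist_limUnder_le fun j hj => hJ j hj t ht
  exact ⟨fun t ht => (h t ht).1, eventually_atTop.2 ⟨J, fun j hj t ht => (h t ht).2 j hj⟩⟩

lemma IsFastApproximation.compression (hC : 0 ≤ C) (hb : IsRegularField T C b G)
    (hY : IsFastApproximation T C b G φ Y) (N : ℕ) {t : ℝ} (ht : t ∈ Icc 0 T) :
    (volume.restrict (Metric.closedBall 0 (N : ℝ))).map (limitFlow Y t) ≤
      (compressionBound T C G N : ℝ≥0∞) • (volume : Measure (Vec d)) := by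
  refine map_le_smul_of_tendsto ENNReal.coe_ne_top (f := fun j => Y j t)
    (fun j => (hY.isApproximateFlow j).measurable.comp measurable_prodMk_left)
    ((measurable_limitFlow fun j => (hY.isApproximateFlow j).measurable).comp
      measurable_prodMk_left) ?_ ?_
  · filter_upwards [hY.ae_dist_limitFlow_le hC hb N] with x hx using hx.1 t ht
  · filter_upwards [eventually_ge_atTop N] with j hj
    exact (hY.isApproximateFlow j).compression N (hY.cast_le hj) t ht

lemma IsFastApproximation.ae_norm_limitFlow_le (hC : 0 ≤ C) (hb : IsRegularField T C b G)
    (hY : IsFastApproximation T C b G φ Y) (N : ℕ) :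
    ∀ᵐ x ∂(volume.restrict (Metric.closedBall (0 : Vec d) N)), ∀ t ∈ Icc (0 : ℝ) T,
      ‖limitFlow Y t x‖ ≤ eulerRadius C T N := by
  filter_upwards [hY.ae_dist_limitFlow_le hC hb N,
    ae_restrict_mem Metric.isClosed_closedBall.measurableSet] with x hx hxN t ht
  exact le_of_tendsto (hx.1 t ht).norm (Eventually.of_forall fun j =>
    (hY.isApproximateFlow j).norm_le N x (mem_closedBall_zero_iff.1 hxN) t ht)

lemma IsRegularField.lintegral_enorm_sub_le (hb : IsRegularField T C b G) {X W : ℝ → Vec d}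
    (hX : Measurable X)
    (hXr : ∀ᵐ s ∂(volume.restrict (Icc (0 : ℝ) T)), (s, X s) ∈ regularPoints b)
    (hWr : ∀ᵐ s ∂(volume.restrict (Icc (0 : ℝ) T)), (s, W s) ∈ regularPoints b) {r ρ : ℝ}
    (hr : ∀ s ∈ Icc (0 : ℝ) T, dist (X s) (W s) ≤ r) (hrρ : r < ρ) :
    ∫⁻ s in Icc 0 T, ‖b s (X s) - b s (W s)‖ₑ ≤
      (lusinEnergy G T ρ X + lusinEnergy G T ρ W) * ENNReal.ofReal r := by
  have hadd : ∫⁻ s in Icc 0 T, (lusinKernel G ρ s (X s) + lusinKernel G ρ s (W s)) =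
      lusinEnergy G T ρ X + lusinEnergy G T ρ W := by
    have hm : Measurable fun s : ℝ => (s, X s) := measurable_id.prodMk hX
    exact lintegral_add_left ((hb.measurable_lusinKernel ρ).comp hm) _
  rw [← hadd, ← lintegral_mul_const' _ _ ENNReal.ofReal_ne_top]
  refine lintegral_mono_ae ?_
  filter_upwards [hXr, hWr, ae_restrict_mem measurableSet_Icc] with s h3 h4 hs
  have h5 := hr s hs
  rw [dist_eq_norm] at h5
  refine (hb.enorm_sub_le h3 h4 (h5.trans_lt hrρ)).trans (mul_le_mul' le_rfl ?_)
  rw [← ofReal_norm]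
  exact ENNReal.ofReal_le_ofReal h5

/-- The Lusin inequality bounds the integral of |b(Y_j) - b(limit)| by the two energies times the
uniform distance. The energy of the approximations grows at most quadratically while the distance
decays like 2^(-j), so the product vanishes; no continuity of b is needed. -/
lemma IsFastApproximation.ae_eq_integral (hC : 0 ≤ C) (hb : IsRegularField T C b G)
    (hY : IsFastApproximation T C b G φ Y) (N : ℕ) :
    ∀ᵐ x ∂(volume.restrict (Metric.closedBall (0 : Vec d) N)), ∀ t ∈ Icc (0 : ℝ) T,
      IntegrableOn (fun s => b s (limitFlow Y s x)) (Ioc 0 t) ∧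
      limitFlow Y t x = x + ∫ s in Ioc 0 t, b s (limitFlow Y s x) := by
  have hm := measurable_limitFlow fun j => (hY.isApproximateFlow j).measurable
  have hcomp := fun t (ht : t ∈ Icc 0 T) => hY.compression hC hb N ht
  have hR := hY.ae_norm_limitFlow_le hC hb N
  -- The radius 1 suffices, since only curves at distance at most 4·2^(-j) < 1 are compared.
  have hρ : (0 : ℝ) < 1 := one_pos
  have hfin : ∀ᵐ x ∂(volume.restrict (Metric.closedBall (0 : Vec d) N)),
      lusinEnergy G T 1 (fun t => limitFlow Y t x) < ⊤ :=
    ae_lt_top (hb.measurable_lusinEnergy hm 1) (ne_top_of_le_ne_top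
      (ENNReal.mul_ne_top ENNReal.coe_ne_top
        (hb.lintegral_lusinKernel_lt_top hρ (eulerRadius_pos N.cast_nonneg)).ne)
      (hb.setLIntegral_lusinEnergy_le hm hcomp hR 1))
  have hreg := ae_all_iff.2 fun j : ℕ => eventually_imp_distrib_left.2 fun hj : N ≤ j =>
    ae_mem_regularPoints_of_compression hb (hY.isApproximateFlow j).measurable
      ((hY.isApproximateFlow j).compression N (hY.cast_le hj))
  filter_upwards [hY.ae_dist_limitFlow_le hC hb N, hY.ae_flowDefect_le hb N,
    hY.ae_lusinEnergy_le hb N hρ, ae_restrict_mem Metric.isClosed_closedBall.measurableSet,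
    ae_mem_regularPoints_of_compression hb hm hcomp, hreg, hR, hfin]
    with x hx hdef hen hxN hregW hregY hRx hfinx t ht
  have hWm : Measurable fun s => limitFlow Y s x := hm.comp measurable_prodMk_right
  have hint := hb.integrableOn_comp hC hWm hRx ht
  refine ⟨hint, ?_⟩
  have hYm : ∀ j, Measurable fun s => Y j s x := fun j =>
    (hY.isApproximateFlow j).measurable.comp measurable_prodMk_right
  set W := fun s => limitFlow Y s x
  set E := (lusinEnergy G T 1 W).toReal with hE
  have hEe : lusinEnergy G T 1 W = ENNReal.ofReal E := (ENNReal.ofReal_toReal hfinx.ne).symm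
  have hlim : Tendsto (fun j : ℕ => defectSize j +
      (((j : ℝ) + 1) ^ 2 + E) * (4 * (1 / 2) ^ j)) atTop (𝓝 0) := by
    have hr : |(1 / 2 : ℝ)| < 1 := by norm_num [abs_of_pos]
    have h1 := (tendsto_pow_atTop_nhds_zero_of_abs_lt_one hr).const_mul (4 + 4 * E)
    have h2 := (tendsto_pow_const_mul_const_pow_of_abs_lt_one 1 hr).const_mul 8
    have h3 := (tendsto_pow_const_mul_const_pow_of_abs_lt_one 2 hr).const_mul 4
    have h4 := squeeze_zero (fun j => (defectSize_pos j).le) defectSize_le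
      (tendsto_pow_atTop_nhds_zero_of_abs_lt_one hr)
    have h5 := h4.add ((h1.add h2).add h3)
    simp only [mul_zero, add_zero] at h5
    refine h5.congr fun j => ?_
    ring
  have hbound : ∀ᶠ j : ℕ in atTop, ‖Y j t x - (x + ∫ s in Ioc 0 t, b s (W s))‖ ≤
      defectSize j + (((j : ℝ) + 1) ^ 2 + E) * (4 * (1 / 2) ^ j) := by
    have hsmall : ∀ᶠ j : ℕ in atTop, 4 * (1 / 2 : ℝ) ^ j < 1 := by
      have h1 := (tendsto_pow_atTop_nhds_zero_of_lt_one (r := (1 / 2 : ℝ)) (by norm_num)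
        (by norm_num)).const_mul 4
      rw [mul_zero] at h1
      exact h1.eventually (gt_mem_nhds one_pos)
    filter_upwards [hx.2, hdef, hen, eventually_ge_atTop N, hsmall] with j hjd hjdef hjen hj hj1
    have hθ := defectSize_pos j
    have hE0 : 0 ≤ E := ENNReal.toReal_nonneg
    rw [← ENNReal.ofReal_le_ofReal_iff (by positivity), ofReal_norm]
    refine ((hY.isApproximateFlow j).enorm_sub_integral_le hb
      ((mem_closedBall_zero_iff.1 hxN).trans (hY.cast_le hj)) ht hint).trans ?_
    rw [ENNReal.ofReal_add hθ.le (by positivity)]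
    refine add_le_add hjdef ?_
    rw [ENNReal.ofReal_mul (by positivity), ENNReal.ofReal_add (by positivity) hE0, ← hEe]
    have hsub : Ioc 0 t ⊆ Icc 0 T := Ioc_subset_Icc_self.trans (Icc_subset_Icc_right ht.2)
    exact ((lintegral_mono_set hsub).trans
      (hb.lintegral_enorm_sub_le (hYm j) (hregY j hj) hregW hjd hj1)).trans
      (mul_le_mul' (add_le_add hjen le_rfl) le_rfl)
  have h0 : Tendsto (fun j => Y j t x - (x + ∫ s in Ioc 0 t, b s (W s))) atTop (𝓝 0) :=
    squeeze_zero_norm' hbound hlim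
  have h1 := (hx.1 t ht).sub_const (x + ∫ s in Ioc 0 t, b s (W s))
  exact sub_eq_zero.1 (tendsto_nhds_unique h1 h0)

/-- Existence of a flow with locally bounded compression. -/
theorem IsRegularField.exists_isCompressibleFlow (hT : 0 < T) (hC : 0 ≤ C)
    (hb : IsRegularField T C b G) : ∃ Y, IsCompressibleFlow T b Y := by
  obtain ⟨φ, Y, hY⟩ := hb.exists_isFastApproximation hT hC
  refine ⟨limitFlow Y, measurable_limitFlow fun j => (hY.isApproximateFlow j).measurable,
    ae_of_forall_ae_closedBall fun n => ?_, fun R => ?_⟩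
  · have h := hY.ae_eq_integral hC hb (n + 1)
    push_cast at h
    filter_upwards [h] with x hx
    have h0 : limitFlow Y 0 x = x := by
      simpa using (hx 0 ⟨le_rfl, hT.le⟩).2
    refine ⟨h0, (intervalIntegrable_iff_integrableOn_Ioc_of_le hT.le).2
      (hx T ⟨hT.le, le_rfl⟩).1, fun t ht => ?_⟩
    simp only [h0]
    rw [intervalIntegral.integral_of_le ht.1]
    exact (hx t ht).2
  · obtain ⟨N, hN⟩ := exists_nat_ge R
    refine ⟨compressionBound T C G N, fun t ht => le_trans ?_ (hY.compression hC hb N ht)⟩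
    have hm : Measurable (limitFlow Y t) := (measurable_limitFlow fun j =>
      (hY.isApproximateFlow j).measurable).comp measurable_prodMk_left
    exact Measure.map_mono (Measure.restrict_mono (Metric.closedBall_subset_closedBall hN) le_rfl)
      hm

end Limit

/-! ### The main theorem -/

theorem proposition5p2 {d : ℕ} (T : ℝ) (hT : 0 < T)
    (b : ℝ → EuclideanSpace ℝ (Fin d) → EuclideanSpace ℝ (Fin d))
    (G : ℝ → EuclideanSpace ℝ (Fin d) →
      (EuclideanSpace ℝ (Fin d) →L[ℝ] EuclideanSpace ℝ (Fin d)))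
    (hb : MemL1W11loc T b G)
    (hgrowth : MemLp (fun p : ℝ × EuclideanSpace ℝ (Fin d) => ‖b p.1 p.2‖ / (1 + ‖p.2‖)) ⊤
      ((volume.restrict (Icc (0 : ℝ) T)).prod volume))
    (hdiv : ∀ R : ℝ, 0 < R →
      ∫⁻ t in Icc (0 : ℝ) T,
        eLpNorm (divOfGrad (G t)) ⊤ (volume.restrict (Metric.closedBall 0 R)) < ⊤)
    (hlog : ∀ R : ℝ, 0 < R →
      ∫⁻ t in Icc (0 : ℝ) T, ∫⁻ x in Metric.closedBall (0 : EuclideanSpace ℝ (Fin d)) R,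
        ENNReal.ofReal (‖G t x‖ * Real.log (2 + ‖G t x‖)) < ⊤) :
    (∃ Y : ℝ → EuclideanSpace ℝ (Fin d) → EuclideanSpace ℝ (Fin d),
      IsRegularLagrangianFlow T b Y ∧ HasLocallyBoundedCompression T Y) ∧
    ∀ Y : ℝ → EuclideanSpace ℝ (Fin d) → EuclideanSpace ℝ (Fin d),
      IsRegularLagrangianFlow T b Y → HasLocallyBoundedCompression T Y →
      (∀ Z : ℝ → EuclideanSpace ℝ (Fin d) → EuclideanSpace ℝ (Fin d),
        IsRegularLagrangianFlow T b Z → HasLocallyBoundedCompression T Z →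
        ∀ᵐ x ∂(volume : Measure (EuclideanSpace ℝ (Fin d))), ∀ t ∈ Icc (0 : ℝ) T,
          Z t x = Y t x) ∧
      (∀ R : ℝ, 0 < R → ∀ ε : ℝ, 0 < ε →
        ∃ E : Set (EuclideanSpace ℝ (Fin d)), E ⊆ Metric.closedBall 0 R ∧ MeasurableSet E ∧
          volume (Metric.closedBall 0 R \ E) < ENNReal.ofReal ε ∧
          ∃ K : ℝ≥0, ∀ t ∈ Icc (0 : ℝ) T, LipschitzOnWith K (Y t) E) ∧
      (∀ t ∈ Icc (0 : ℝ) T, ∀ᵐ x ∂(volume : Measure (EuclideanSpace ℝ (Fin d))),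
        ApproxDifferentiableAt (Y t) x) := by
  obtain ⟨C, b', G', hC, hb', hbb'⟩ := exists_isRegularField hb hgrowth hdiv hlog
  refine ⟨?_, fun Y hY hYc => ?_⟩
  · obtain ⟨Y, hY⟩ := hb'.exists_isCompressibleFlow hT hC
    exact ⟨Y, hY.isRegularLagrangianFlow hT.le hbb', hY.compression⟩
  · obtain ⟨Y', hY', hYY'⟩ := hY.exists_isCompressibleFlow hT.le hbb' hYc
    have hlip : ∀ R : ℝ, 0 < R → ∀ ε : ℝ, 0 < ε → ∃ E : Set (EuclideanSpace ℝ (Fin d)),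
        E ⊆ Metric.closedBall 0 R ∧ MeasurableSet E ∧
          volume (Metric.closedBall 0 R \ E) < ENNReal.ofReal ε ∧
          ∃ K : ℝ≥0, ∀ t ∈ Icc (0 : ℝ) T, LipschitzOnWith K (Y t) E := fun R hR ε hε => by
      -- The set is chosen inside the points where Y' and Y agree at all times, so the Lipschitz
      -- bound holds for Y itself and not just up to null sets.
      obtain ⟨A, hAR, hA, hAε, hAY, K, hK⟩ := hY'.exists_lipschitzOnWith hC hb' hYY' hR hε
      refine ⟨A, hAR, hA, hAε, K, fun t ht x hx y hy => ?_⟩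
      rw [← hAY x hx t ht, ← hAY y hy t ht]
      exact hK t ht hx hy
    refine ⟨fun Z hZ hZc => ?_, hlip, fun t ht =>
      ae_approxDifferentiableAt_of_lipschitzOnWith fun R hR ε hε => ?_⟩
    · obtain ⟨Z', hZ', hZZ'⟩ := hZ.exists_isCompressibleFlow hT.le hbb' hZc
      filter_upwards [hYY', hZZ', hY'.unique hC hb' hZ'] with x h1 h2 h3 t ht
      rw [← h2 t ht, h3 t ht, h1 t ht]
    · obtain ⟨A, hAR, hA, hAε, K, hK⟩ := hlip R hR ε hε
      exact ⟨A, hAR, hA, hAε, K, hK t ht⟩
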